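/- **Corollary (Uniform correlation decay).** Consider the spin chain on $\mathbb Z$ with on-site algebra $M_d(\mathbb C)$, $d\ge 2$, local algebras $\mathfrak A_X=\bigotimes_{x\in X}M_d(\mathbb C)$ for finite $X\subset\mathbb Z$, and quasi-local $C^*$-algebra $\mathfrak A_{\mathbb Z}$. Let $h:[0,\infty)\to[0,\infty)$ be non-decreasing and subadditive, let $\beta>2$, put $F_\beta(x)=e^{-h(x)}(1+x)^{-\beta}$, and let $C_\beta$ be a constant with $$\sum_{z\in\mathbb Z}F_\beta(|x-z|)F_\beta(|z-y|)\le C_\beta F_\beta(|x-y|)\qquad(x,y\in\mathbb Z).$$ Let $\Phi$ be a (time-independent) interaction, i.e. $\Phi(Z)=\Phi(Z)^*\in\mathfrak A_Z$ for every finite $Z\subset\mathbb Z$, with $$\|\Phi\|_{h,\beta}=\sup_{x,y\in\mathbb Z}\ \sum_{Z\ni x,y}\frac{\|\Phi(Z)\|}{F_\beta(|x-y|)}<\infty ,$$ and let $\tau_t(A)=\lim_{n\to\infty}e^{itH_{[-n,n]}}Ae^{-itH_{[-n,n]}}$, $H_\Lambda=\sum_{Z\subset\Lambda}\Phi(Z)$,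 be its dynamics on $\mathfrak A_{\mathbb Z}$. Let $\omega$ be a ground state of $\Phi$, i.e. a state with $\omega\big(A^*\sum_Z[\Phi(Z),A]\big)\ge 0$ for all local $A$. Let $\Omega$ be the GNS vector of $\omega$, and let $H_\omega$ be the GNS Hamiltonian, i.e. the self-adjoint operator with $e^{itH_\omega}\pi_\omega(A)\Omega=\pi_\omega(\tau_t(A))\Omega$ for all $A\in\mathfrak A_{\mathbb Z}$, $t\in\mathbb R$. Suppose that for some $\gamma>0$ $$\text{(i)}\ \ \operatorname{spec}(H_\omega)\setminus\{0\}\subset[\gamma,\infty)\qquad\text{and}\qquad\text{(ii)}\ \ \ker(H_\omega)=\mathbb C\,\Omega .$$ Put $$\kappa(\beta)=\frac{16}{C_\beta}\Big(\frac{\beta}{2}-1\Big)^{-2},\qquad \nu=2\|\Phi\|_{h,\beta}\,C_\beta,\qquad u=\frac{\gamma}{2\nu+\gamma}.$$ Then there is a constant $\mu>0$, depending only on $h$, $\beta$, $C_\beta$, $\|\Phi\|_{h,\beta}$ and $\gamma$ (in particular not on the sizes of the supports $X,Y$ below), such that for all nonempty finite $X,Y\subset\mathbb Z$ with $\max X<\min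 Y$ and all $A\in\mathfrak A_X$, $B\in\mathfrak A_Y$, $$|\omega(AB)-\omega(A)\omega(B)|\le\mu\,\|A\|\,\|B\|\,e^{-u\,h(d(X,Y))},\qquad d(X,Y)=\min_{x\in X,\,y\in Y}|x-y| .$$ Moreover, whenever $h(d(X,Y))>0$, the same inequality holds with $\mu$ replaced by the explicit value $$1+\frac{\kappa(\beta)}{\pi}+\sqrt{\frac{2\nu+\gamma}{\pi\,\gamma\,h(d(X,Y))}} .$$ -/

import Mathlib

open scoped NNReal ENNReal ComplexOrder Topology
open Filter

namespace SpinChain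

noncomputable section

/-- Classical configurations of the chain: basis labels of `⨂_{x ∈ ℤ} ℂ^d`. -/
abbrev Configuration (d : ℕ) : Type := ℤ → Fin d
/-- The Hilbert space `ℓ²` over all configurations. It carries a faithful representation of every
matrix algebra `⨂_{x ∈ X} M_d(ℂ)`, `X ⊆ ℤ` finite (see `matrixRep`), compatible with the inclusions
`A ↦ A ⊗ 1`. It serves only to realise the quasi-local algebra. -/
abbrev ChainSpace (d : ℕ) : Type := lp (fun _ : Configuration d => ℂ) 2

/-- `σ|_X`. -/
def restrict {d : ℕ} (X : Finset ℤ) (σ : Configuration d) : X → Fin d := fun x => σ x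

/-- The configuration equal to `b` on `X` and to `σ` off `X`. -/
def override {d : ℕ} (X : Finset ℤ) (σ : Configuration d) (b : X → Fin d) : Configuration d :=
  fun x => if hx : x ∈ X then b ⟨x, hx⟩ else σ x

theorem restrict_override {d : ℕ} (X : Finset ℤ) (σ : Configuration d) (b : X → Fin d) :
    restrict X (override X σ b) = b := by
  funext x
  simp [restrict, override]

theorem override_override {d : ℕ} (X : Finset ℤ) (σ : Configuration d) (b c : X → Fin d) :
    override X (override X σ b) c = override X σ c := by
  funext x
  by_cases hx : x ∈ X <;> simp [override, hx]

theorem override_restrict {d : ℕ} (X : Finset ℤ) (σ : Configuration d) :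
    override X σ (restrict X σ) = σ := by
  funext x
  by_cases hx : x ∈ X <;> simp [restrict, override, hx]

/-- Replacing the restriction `a` to `X` by `b`. -/
def overrideEquiv {d : ℕ} (X : Finset ℤ) (a b : X → Fin d) :
    {σ : Configuration d // restrict X σ = a} ≃ {σ : Configuration d // restrict X σ = b} where
  toFun σ := ⟨override X σ b, restrict_override X σ b⟩
  invFun σ := ⟨override X σ a, restrict_override X σ a⟩
  left_inv σ := by
    obtain ⟨σ, rfl⟩ := σ
    simp [override_override, override_restrict]
  right_inv σ := by
    obtain ⟨σ, rfl⟩ := σ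
    simp [override_override, override_restrict]

theorem hasSum_override {d : ℕ} (X : Finset ℤ) (a b : X → Fin d) {E : Type*}
    [AddCommMonoid E] [TopologicalSpace E] (f : Configuration d → E) (s : E) :
    HasSum (fun σ => if restrict X σ = a then f (override X σ b) else 0) s ↔
      HasSum (fun σ => if restrict X σ = b then f σ else 0) s := by
  have h1 := hasSum_subtype_iff_indicator (f := fun σ => f (override X σ b)) (a := s)
    (s := {σ : Configuration d | restrict X σ = a})
  have h2 := hasSum_subtype_iff_indicator (f := f) (a := s)
    (s := {σ : Configuration d | restrict X σ = b})
  have e1 : (fun σ => if restrict X σ = a then f (override X σ b) else 0) =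
      Set.indicator {σ : Configuration d | restrict X σ = a} (fun σ => f (override X σ b)) := by
    funext σ
    simp [Set.indicator]
  have e2 : (fun σ => if restrict X σ = b then f σ else 0) =
      Set.indicator {σ : Configuration d | restrict X σ = b} f := by
    funext σ
    simp [Set.indicator]
  rw [e1, e2, ← h1, ← h2]
  exact (overrideEquiv X a b).hasSum_iff (f := f ∘ Subtype.val)

theorem tsum_override {d : ℕ} (X : Finset ℤ) (a b : X → Fin d) (f : Configuration d → ℂ) :
    (∑' σ, if restrict X σ = a then f (override X σ b) else 0) =
      ∑' σ, if restrict X σ = b then f σ else 0 := by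
  by_cases hs : Summable fun σ => if restrict X σ = b then f σ else 0
  · exact ((hasSum_override X a b f _).2 hs.hasSum).tsum_eq
  · rw [tsum_eq_zero_of_not_summable hs, tsum_eq_zero_of_not_summable]
    rintro ⟨s, h⟩
    exact hs ⟨s, (hasSum_override X a b f s).1 h⟩

theorem hasSum_unit {d : ℕ} (X : Finset ℤ) (a b : X → Fin d) (ψ : ChainSpace d) :
    ∃ s ≤ ‖ψ‖ ^ 2,
      HasSum (fun σ => ‖if restrict X σ = a then ψ (override X σ b) else 0‖ ^ 2) s := by
  have h0 : HasSum (fun σ => ‖ψ σ‖ ^ 2) (‖ψ‖ ^ 2) := by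
    have := lp.hasSum_norm (p := 2) (by norm_num) ψ
    simpa using this
  have h1 : Summable (fun σ => if restrict X σ = b then ‖ψ σ‖ ^ 2 else 0) := by
    refine Summable.of_nonneg_of_le (fun σ => ?_) (fun σ => ?_) h0.summable <;>
    split_ifs <;> first | positivity | exact le_rfl
  refine ⟨∑' σ, if restrict X σ = b then ‖ψ σ‖ ^ 2 else 0, ?_, ?_⟩
  · rw [← h0.tsum_eq]
    refine h1.tsum_le_tsum (fun σ => ?_) h0.summable
    split_ifs <;> first | positivity | exact le_rfl
  · have h2 := (hasSum_override X a b (fun σ => ‖ψ σ‖ ^ 2) _).2 h1.hasSum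
    convert h2 using 2 with σ
    split_ifs <;> simp

/-- The vector `|a⟩⟨b|_X ψ`. -/
def unitVec {d : ℕ} (X : Finset ℤ) (a b : X → Fin d) (ψ : ChainSpace d) : ChainSpace d :=
  ⟨fun σ => if restrict X σ = a then ψ (override X σ b) else 0, by
    obtain ⟨s, -, hs⟩ := hasSum_unit X a b ψ
    refine memℓp_gen ?_
    simpa using hs.summable⟩

theorem unitVec_apply {d : ℕ} (X : Finset ℤ) (a b : X → Fin d) (ψ : ChainSpace d)
    (σ : Configuration d) :
    unitVec X a b ψ σ = if restrict X σ = a then ψ (override X σ b) else 0 := rfl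

theorem norm_unitVec_le {d : ℕ} (X : Finset ℤ) (a b : X → Fin d) (ψ : ChainSpace d) :
    ‖unitVec X a b ψ‖ ≤ ‖ψ‖ := by
  obtain ⟨s, hs, hs'⟩ := hasSum_unit X a b ψ
  have h := lp.hasSum_norm (p := 2) (by norm_num) (unitVec X a b ψ)
  have h2 : HasSum (fun σ => ‖unitVec X a b ψ σ‖ ^ 2) (‖unitVec X a b ψ‖ ^ 2) := by
    simpa using h
  have h3 : ‖unitVec X a b ψ‖ ^ 2 = s := h2.unique hs'
  exact le_of_sq_le_sq (h3 ▸ hs) (norm_nonneg _)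

/-- The matrix unit `|a⟩⟨b|` of the sites in `X`, tensored with the identity elsewhere. -/
def matrixUnit {d : ℕ} (X : Finset ℤ) (a b : X → Fin d) : ChainSpace d →L[ℂ] ChainSpace d :=
  LinearMap.mkContinuous
    { toFun := unitVec X a b
      map_add' := fun ψ φ => by
        ext σ
        simp only [unitVec_apply, lp.coeFn_add, Pi.add_apply]
        split_ifs <;> simp
      map_smul' := fun c ψ => by
        ext σ
        simp only [unitVec_apply, lp.coeFn_smul, Pi.smul_apply, RingHom.id_apply]
        split_ifs <;> simp }
    1 (fun ψ => by simpa using norm_unitVec_le X a b ψ)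

theorem matrixUnit_apply {d : ℕ} (X : Finset ℤ) (a b : X → Fin d) (ψ : ChainSpace d)
    (σ : Configuration d) :
    matrixUnit X a b ψ σ = if restrict X σ = a then ψ (override X σ b) else 0 := rfl

theorem adjoint_matrixUnit {d : ℕ} (X : Finset ℤ) (a b : X → Fin d) :
    star (matrixUnit X a b) = matrixUnit X b a := by
  rw [ContinuousLinearMap.star_eq_adjoint]
  symm
  rw [ContinuousLinearMap.eq_adjoint_iff]
  intro φ ψ
  rw [lp.inner_eq_tsum, lp.inner_eq_tsum]
  have e1 : ∀ σ, inner ℂ (matrixUnit X b a φ σ) (ψ σ) =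
      if restrict X σ = b then
        (fun τ => inner ℂ (φ τ) (ψ (override X τ b))) (override X σ a) else 0 := by
    intro σ
    rw [matrixUnit_apply]
    split_ifs with h
    · simp only [override_override]
      rw [← h, override_restrict]
    · exact inner_zero_left _
  have e2 : ∀ σ, inner ℂ (φ σ) (matrixUnit X a b ψ σ) =
      if restrict X σ = a then (fun τ => inner ℂ (φ τ) (ψ (override X τ b))) σ else 0 := by
    intro σ
    rw [matrixUnit_apply]
    split_ifs with h
    · rfl
    · exact inner_zero_right _
  rw [tsum_congr e1, tsum_congr e2]
  exact tsum_override X b a fun τ => inner ℂ (φ τ) (ψ (override X τ b))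

/-- The bounded operator of a matrix `M` acting on the tensor factors in `X`:
`(M ψ)(σ) = ∑ b, M (σ|_X) b * ψ (b on X, σ off X)`. -/
def matrixOp {d : ℕ} (X : Finset ℤ) (M : Matrix (X → Fin d) (X → Fin d) ℂ) :
    ChainSpace d →L[ℂ] ChainSpace d :=
  ∑ a, ∑ b, M a b • matrixUnit X a b

theorem matrixOp_apply {d : ℕ} (X : Finset ℤ) (M : Matrix (X → Fin d) (X → Fin d) ℂ)
    (ψ : ChainSpace d) (σ : Configuration d) :
    matrixOp X M ψ σ = ∑ b, M (restrict X σ) b * ψ (override X σ b) := by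
  have : ∀ a, (∑ b, M a b • matrixUnit X a b ψ : ChainSpace d) σ =
      if restrict X σ = a then ∑ b, M a b * ψ (override X σ b) else 0 := by
    intro a
    rw [lp.coeFn_sum, Finset.sum_apply]
    simp only [lp.coeFn_smul, Pi.smul_apply, matrixUnit_apply, smul_eq_mul]
    split_ifs <;> simp
  rw [matrixOp]
  simp only [_root_.sum_apply, _root_.smul_apply]
  rw [lp.coeFn_sum, Finset.sum_apply]
  simp only [this]
  simp

/-- The representation on the chain of `⨂_{x ∈ X} M_d(ℂ)`, realised as the matrices indexed by the
configurations of `X`. -/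
def matrixRep {d : ℕ} (X : Finset ℤ) :
    Matrix (X → Fin d) (X → Fin d) ℂ →⋆ₐ[ℂ] (ChainSpace d →L[ℂ] ChainSpace d) where
  toFun := matrixOp X
  map_one' := by
    ext ψ σ
    rw [matrixOp_apply]
    simp [Matrix.one_apply, override_restrict]
  map_zero' := by simp [matrixOp]
  map_add' M N := by simp [matrixOp, add_smul, Finset.sum_add_distrib]
  map_mul' M N := by
    ext ψ σ
    simp only [_root_.mul_apply_eq_comp, matrixOp_apply, Matrix.mul_apply, Finset.sum_mul,
      Finset.mul_sum, restrict_override, override_override, mul_assoc]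
    exact Finset.sum_comm
  commutes' c := by
    ext ψ σ
    rw [matrixOp_apply]
    simp [Algebra.algebraMap_eq_smul_one, Matrix.one_apply, override_restrict]
  map_star' M := by
    simp only [matrixOp, star_sum, star_smul, adjoint_matrixUnit, Matrix.star_apply]
    exact Finset.sum_comm

/-- The norm closure of the union of the (upward directed) family of the local matrix algebras. -/
def quasiLocalSubalgebra (d : ℕ) : StarSubalgebra ℂ (ChainSpace d →L[ℂ] ChainSpace d) :=
  (⨆ X : Finset ℤ, (matrixRep (d := d) X).range).topologicalClosure

/-- The quasi-local C*-algebra `𝔄_ℤ` of the spin chain with on-site algebra `M_d(ℂ)`. -/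
def QuasiLocal (d : ℕ) : Type := quasiLocalSubalgebra d

instance instIsClosedQuasiLocal (d : ℕ) :
    IsClosed (quasiLocalSubalgebra d : Set (ChainSpace d →L[ℂ] ChainSpace d)) :=
  StarSubalgebra.isClosed_topologicalClosure _

instance instCStarAlgebraQuasiLocal (d : ℕ) : CStarAlgebra (QuasiLocal d) :=
  inferInstanceAs (CStarAlgebra (quasiLocalSubalgebra d))

instance instPartialOrderQuasiLocal (d : ℕ) : PartialOrder (QuasiLocal d) :=
  CStarAlgebra.spectralOrder _

instance instStarOrderedRingQuasiLocal (d : ℕ) : StarOrderedRing (QuasiLocal d) :=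
  CStarAlgebra.spectralOrderedRing _

/-- The inclusion of `⨂_{x ∈ X} M_d(ℂ)` into `𝔄_ℤ`. -/
def localEmbedding {d : ℕ} (X : Finset ℤ) :
    Matrix (X → Fin d) (X → Fin d) ℂ →⋆ₐ[ℂ] QuasiLocal d :=
  (matrixRep X).codRestrict (quasiLocalSubalgebra d) fun M =>
    StarSubalgebra.le_topologicalClosure _
      (le_iSup (fun X : Finset ℤ => (matrixRep (d := d) X).range) X ⟨M, rfl⟩)

/-- The algebra `𝔄_X` of observables supported in the finite set `X`. -/
def localAlgebra (d : ℕ) (X : Finset ℤ) : StarSubalgebra ℂ (QuasiLocal d) :=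
  (localEmbedding X).range

/-- A (time-independent) interaction: `Φ(Z) = Φ(Z)* ∈ 𝔄_Z` for every finite `Z ⊆ ℤ`. -/
structure Interaction (d : ℕ) where
  /-- The interaction term of a finite set of sites. -/
  term : Finset ℤ → QuasiLocal d
  isSelfAdjoint : ∀ Z, IsSelfAdjoint (term Z)
  mem_localAlgebra : ∀ Z, term Z ∈ localAlgebra d Z

/-- The function `F_β(x) = e^{-h(x)} (1 + x)^{-β}`. -/
def decayF (h : ℝ≥0 → ℝ≥0) (β : ℝ) (x : ℝ≥0) : ℝ :=
  Real.exp (-(h x : ℝ)) * (1 / (1 + (x : ℝ)) ^ β)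

/-- The distance `|x - y|` of two sites. -/
def siteDist (x y : ℤ) : ℝ≥0 := ((x - y).natAbs : ℝ≥0)

/-- `C` is a convolution constant of `F_β`:
`∑_z F_β(|x - z|) F_β(|z - y|) ≤ C F_β(|x - y|)` for all sites `x`, `y`. -/
def IsConvolutionConstant (h : ℝ≥0 → ℝ≥0) (β C : ℝ) : Prop :=
  ∀ x y : ℤ,
    Summable (fun z : ℤ => decayF h β (siteDist x z) * decayF h β (siteDist z y)) ∧
    ∑' z : ℤ, decayF h β (siteDist x z) * decayF h β (siteDist z y) ≤
      C * decayF h β (siteDist x y)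

/-- `‖Φ‖_{h,β} = sup_{x,y} ∑_{Z ∋ x,y} ‖Φ(Z)‖ / F_β(|x - y|)`. -/
def Interaction.decayNorm {d : ℕ} (Φ : Interaction d) (h : ℝ≥0 → ℝ≥0) (β : ℝ) : ℝ≥0∞ :=
  ⨆ (x : ℤ) (y : ℤ), ∑' Z : {Z : Finset ℤ // x ∈ Z ∧ y ∈ Z},
    ENNReal.ofReal (‖Φ.term Z‖ / decayF h β (siteDist x y))

/-- The local Hamiltonian `H_Λ = ∑_{Z ⊆ Λ} Φ(Z)`. -/
def Interaction.hamiltonian {d : ℕ} (Φ : Interaction d) (Λ : Finset ℤ) : QuasiLocal d :=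
  ∑ Z ∈ Λ.powerset, Φ.term Z

/-- The finite-volume dynamics `τ^Λ_t(A) = e^{itH_Λ} A e^{-itH_Λ}`. -/
def Interaction.localDynamics {d : ℕ} (Φ : Interaction d) (Λ : Finset ℤ) (t : ℝ)
    (A : QuasiLocal d) : QuasiLocal d :=
  NormedSpace.exp ((Complex.I * t) • Φ.hamiltonian Λ) * A *
    NormedSpace.exp (-(Complex.I * t) • Φ.hamiltonian Λ)

/-- The quasi-local dynamics `τ_t(A)`, the norm limit of `τ^Λ_t(A)` as `Λ = [-n, n]` grows to `ℤ`. -/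
def Interaction.dynamics {d : ℕ} (Φ : Interaction d) (t : ℝ) (A : QuasiLocal d) : QuasiLocal d :=
  limUnder atTop fun n : ℕ => Φ.localDynamics (Finset.Icc (-(n : ℤ)) n) t A

/-- The derivation `δ(A) = i ∑_Z [Φ(Z), A]`, for local observables `A`. -/
def Interaction.derivation {d : ℕ} (Φ : Interaction d) (A : QuasiLocal d) : QuasiLocal d :=
  Complex.I • ∑' Z : Finset ℤ, (Φ.term Z * A - A * Φ.term Z)

/-- `ω` is a ground state of `Φ`: a state (a positive functional with `ω(1) = 1`) such that
`-i ω(A* δ(A)) ≥ 0` for every local observable `A`. -/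
def IsGroundState {d : ℕ} (Φ : Interaction d) (ω : QuasiLocal d →ₚ[ℂ] ℂ) : Prop :=
  ω 1 = 1 ∧ ∀ (X : Finset ℤ), ∀ A ∈ localAlgebra d X,
    0 ≤ -Complex.I * ω (star A * Φ.derivation A)

/-- The vector `π_ω(A) Ω` of the GNS space of `ω`. -/
def gnsVec {d : ℕ} (ω : QuasiLocal d →ₚ[ℂ] ℂ) (A : QuasiLocal d) : ω.GNS :=
  ((ω.toPreGNS A : ω.PreGNS) : ω.GNS)

/-- The bounded operator `U_t` on the GNS space with `U_t π_ω(A) Ω = π_ω(τ_t(A)) Ω` for all `A`.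
It is unique, because the vectors `π_ω(A) Ω` are dense, and it exists (and is unitary) whenever
`ω` is invariant under `τ_t`, in particular if `ω` is a ground state. -/
def gnsUnitary {d : ℕ} (Φ : Interaction d) (ω : QuasiLocal d →ₚ[ℂ] ℂ) (t : ℝ) :
    ω.GNS →L[ℂ] ω.GNS :=
  Classical.epsilon fun U : ω.GNS →L[ℂ] ω.GNS =>
    ∀ A : QuasiLocal d, U (gnsVec ω A) = gnsVec ω (Φ.dynamics t A)

/-- `φ = lim_{t → 0} (U_t ψ - ψ) / (i t)`. -/
def IsGenerated {E : Type*} [NormedAddCommGroup E] [NormedSpace ℂ E]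
    (U : ℝ → E →L[ℂ] E) (ψ φ : E) : Prop :=
  Tendsto (fun t : ℝ => (Complex.I * t)⁻¹ • (U t ψ - ψ)) (𝓝[≠] 0) (𝓝 φ)

theorem isGenerated_add {E : Type*} [NormedAddCommGroup E] [NormedSpace ℂ E]
    {U : ℝ → E →L[ℂ] E} {ψ φ ψ' φ' : E} (h : IsGenerated U ψ φ) (h' : IsGenerated U ψ' φ') :
    IsGenerated U (ψ + ψ') (φ + φ') := by
  refine (Tendsto.add h h').congr fun t => ?_
  rw [map_add, ← smul_add]
  congr 1
  abel

theorem isGenerated_smul {E : Type*} [NormedAddCommGroup E] [NormedSpace ℂ E]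
    {U : ℝ → E →L[ℂ] E} {ψ φ : E} (c : ℂ) (h : IsGenerated U ψ φ) :
    IsGenerated U (c • ψ) (c • φ) := by
  refine (Tendsto.const_smul h c).congr fun t => ?_
  rw [map_smul, ← smul_sub, smul_comm]

/-- The generator `H` of `U_t = e^{itH}`: `H ψ = lim_{t → 0} (U_t ψ - ψ) / (i t)`, on the domain of
all `ψ` for which this limit exists. -/
def generator {E : Type*} [NormedAddCommGroup E] [NormedSpace ℂ E]
    (U : ℝ → E →L[ℂ] E) : E →ₗ.[ℂ] E where
  domain :=
    { carrier := {ψ | ∃ φ, IsGenerated U ψ φ}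
      add_mem' := by
        rintro ψ ψ' ⟨φ, hφ⟩ ⟨φ', hφ'⟩
        exact ⟨φ + φ', isGenerated_add hφ hφ'⟩
      zero_mem' := ⟨0, by simp [IsGenerated]⟩
      smul_mem' := by
        rintro c ψ ⟨φ, hφ⟩
        exact ⟨c • φ, isGenerated_smul c hφ⟩ }
  toFun :=
    { toFun := fun ψ => Classical.choose ψ.2
      map_add' := fun ψ ψ' => tendsto_nhds_unique (Classical.choose_spec (ψ + ψ').2)
        (isGenerated_add (Classical.choose_spec ψ.2) (Classical.choose_spec ψ'.2))
      map_smul' := fun c ψ => tendsto_nhds_unique (Classical.choose_spec (c • ψ).2)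
        (isGenerated_smul c (Classical.choose_spec ψ.2)) }

/-- The GNS Hamiltonian `H_ω`: the self-adjoint operator with
`e^{itH_ω} π_ω(A) Ω = π_ω(τ_t(A)) Ω`. -/
def gnsHamiltonian {d : ℕ} (Φ : Interaction d) (ω : QuasiLocal d →ₚ[ℂ] ℂ) : ω.GNS →ₗ.[ℂ] ω.GNS :=
  generator (gnsUnitary Φ ω)

/-- The spectrum of an unbounded operator `T`: all `z` for which `T - z` has no bounded two-sided
inverse. -/
def operatorSpectrum {E : Type*} [NormedAddCommGroup E] [NormedSpace ℂ E] (T : E →ₗ.[ℂ] E) :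
    Set ℂ :=
  {z | ¬ ∃ R : E →L[ℂ] E,
    (∀ ψ : E, ∃ hψ : R ψ ∈ T.domain, T ⟨R ψ, hψ⟩ - z • R ψ = ψ) ∧
    (∀ φ : T.domain, R (T φ - z • (φ : E)) = φ)}

/-- The kernel of an unbounded operator. -/
def operatorKernel {E : Type*} [NormedAddCommGroup E] [NormedSpace ℂ E] (T : E →ₗ.[ℂ] E) : Set E :=
  {ψ | ∃ hψ : ψ ∈ T.domain, T ⟨ψ, hψ⟩ = 0}

/-- The distance `d(X, Y) = min {|x - y| : x ∈ X, y ∈ Y}` of two nonempty finite sets of sites. -/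
def setDist (X Y : Finset ℤ) : ℝ≥0 :=
  ((sInf {n : ℕ | ∃ x ∈ X, ∃ y ∈ Y, n = (x - y).natAbs} : ℕ) : ℝ≥0)

/-- `κ(β) = (16 / C_β) (β/2 - 1)^{-2}`. -/
def kappa (β C : ℝ) : ℝ := 16 / C * ((β / 2 - 1) ^ 2)⁻¹

/-- `ν = 2 ‖Φ‖_{h,β} C_β`, where `N = ‖Φ‖_{h,β}`. -/
def velocity (N : ℝ≥0) (C : ℝ) : ℝ := 2 * N * C

end

end SpinChain

/-!
Write `ν = 2 ‖Φ‖ C`. The correlation of `A` and `B` is `⟪A'* Ω, B' Ω⟫` with `A' = A - ω(A)`,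
`B' = B - ω(B)` (`centered`), and it is estimated by confronting locality with the spectral gap.

*Locality.* The Lieb–Robinson bound `norm_lie_dynamics_le` reads
`‖[A, τ_t(B)]‖ ≤ 2 ‖A‖ ‖B‖ (e^{ν|t|} - 1) / C · S(X, Y)`, `S(X, Y) = ∑_{x ∈ X, y ∈ Y} F_β(|x - y|)`.
In a finite volume it comes from iterating the step `norm_lie_heis_le`: conjugation by
`e^{itH} e^{-itL}`, where `L` collects the terms that commute with `A`, turns the commutator
into a function of time whose derivative only involves the terms that meet the support of `A`. The
bound does not depend on the volume, so the local dynamics converge (`hasDynamics`). Since `X` lies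
to the left of `Y`, `|x - y|` is at least the sum of the distances of `x` and `y` to a cut, so
`S(X, Y) ≤ 8 (β/2 - 1)^{-2} e^{-h(d(X, Y))}` independently of the sizes of `X` and `Y`
(`coupling_le`). This is where `β > 2` enters.

*Invariance.* Applied to `A + c`, the ground state inequality gives `ω ∘ δ = 0`. Together with the
control of the boundary terms this yields `ω ∘ τ_t = ω` (`IsGroundState.apply_dynamics`), hence a
group `U_t = e^{itH}` of isometries of the GNS space with `U_t A Ω = τ_t(A) Ω`.

*Gap.* Let `E(λ) = (πα)^{-1/2} ∫_0^λ e^{-s²/4α} ds`. For `λ ≥ 0`,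
`π E(λ) = ∫_0^∞ e^{-αt²} (e^{itλ} - e^{-itλ}) / (it) dt`, while `E(0) = 0` and
`0 ≤ 1 - E(λ) ≤ e^{-γ²/4α}` for `λ ≥ γ`. Therefore
`π^{-1} ∫_0^∞ e^{-αt²} ⟪φ, (U_t - U_{-t}) ψ⟫ / (it) dt` reproduces `⟪φ, ψ⟫` up to
`e^{-γ²/4α} ‖φ‖ ‖ψ‖` if `ψ ⊥ ker H`
(`IsUnitaryGroup.norm_inner_sub_integral_filteredInner_le`). Mathlib has no spectral theorem for
unbounded operators; the continuous functional calculus of the bounded self-adjoint operator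
`T = (H + 1)⁻¹` takes its place. Its spectrum lies in `[0, (1 + γ)⁻¹] ∪ {1}`, and `U_t T` is the
continuous function `x e^{it(1/x - 1)}` of `T` (`IsResolventNegOne.apply_eq_cfc_phase`).

*Conclusion.* The filter is applied to `⟪A'* Ω, B' Ω⟫` and to `⟪B'* Ω, A' Ω⟫`. Both are equal to the
correlation, because `A` and `B` commute, and by invariance the sum of the two integrands is
`e^{-αt²} ω([A, τ_t(B)] - [A, τ_{-t}(B)]) / (it)`. For `t ≤ s` the Lieb–Robinson bound applies,
for `t > s` the Gaussian is small (`IsGroundState.norm_correlation_le`). With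
`s = 2 h / (2ν + γ)` and `α = γ / (2s)` all three error terms decay like `e^{-u h}`. At distances
with `h < 1` the uniform bound follows from `|ω(AB) - ω(A) ω(B)| ≤ 2 ‖A‖ ‖B‖`.
-/

namespace SpinChain

noncomputable section

/-! ### Heisenberg evolution in a C*-algebra -/

section Heisenberg
variable {𝒜 : Type*} [CStarAlgebra 𝒜]

/-- The propagator `e^{itH}`. -/
def propagator (H : 𝒜) (t : ℝ) : 𝒜 := NormedSpace.exp ((Complex.I * t) • H)

theorem propagator_eq_exp_smul (H : 𝒜) (t : ℝ) :
    propagator H t = NormedSpace.exp (t • (Complex.I • H)) := by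
  rw [propagator, mul_comm, mul_smul, Complex.coe_smul]

@[simp]
theorem propagator_zero (H : 𝒜) : propagator H 0 = 1 := by
  simp [propagator]

theorem propagator_add (H : 𝒜) (s t : ℝ) :
    propagator H (s + t) = propagator H s * propagator H t := by
  let _ : NormedAlgebra ℚ 𝒜 := NormedAlgebra.restrictScalars ℚ ℂ 𝒜
  simp only [propagator_eq_exp_smul, add_smul]
  exact NormedSpace.exp_add_of_commute (((Commute.refl _).smul_left _).smul_right _)

@[simp]
theorem propagator_mul_neg (H : 𝒜) (t : ℝ) : propagator H t * propagator H (-t) = 1 := by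
  rw [← propagator_add]; simp

@[simp]
theorem propagator_neg_mul (H : 𝒜) (t : ℝ) : propagator H (-t) * propagator H t = 1 := by
  rw [← propagator_add]; simp

theorem star_propagator {H : 𝒜} (hH : IsSelfAdjoint H) (t : ℝ) :
    star (propagator H t) = propagator H (-t) := by
  rw [propagator, propagator, NormedSpace.star_exp, star_smul, hH.star_eq]
  simp

theorem propagator_mem_unitary {H : 𝒜} (hH : IsSelfAdjoint H) (t : ℝ) :
    propagator H t ∈ unitary 𝒜 := by
  rw [Unitary.mem_iff, star_propagator hH]
  simp

theorem norm_propagator_mul {H : 𝒜} (hH : IsSelfAdjoint H) (t : ℝ) (A : 𝒜) :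
    ‖propagator H t * A‖ = ‖A‖ :=
  CStarRing.norm_mem_unitary_mul A (propagator_mem_unitary hH t)

theorem norm_mul_propagator {H : 𝒜} (hH : IsSelfAdjoint H) (t : ℝ) (A : 𝒜) :
    ‖A * propagator H t‖ = ‖A‖ :=
  CStarRing.norm_mul_mem_unitary A (propagator_mem_unitary hH t)

theorem commute_propagator {H A : 𝒜} (h : Commute A H) (t : ℝ) : Commute A (propagator H t) := by
  exact (h.smul_right _).exp_right

theorem hasDerivAt_propagator (H : 𝒜) (t : ℝ) :
    HasDerivAt (propagator H) (propagator H t * (Complex.I • H)) t := by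
  have := hasDerivAt_exp_smul_const (𝕂 := ℝ) (Complex.I • H) t
  rw [show propagator H = fun t : ℝ => NormedSpace.exp (t • (Complex.I • H)) from
    funext (propagator_eq_exp_smul H)]
  exact this

theorem hasDerivAt_propagator_neg (H : 𝒜) (t : ℝ) :
    HasDerivAt (fun s => propagator H (-s)) (-((Complex.I • H) * propagator H (-t))) t := by
  have h1 := (hasDerivAt_propagator H (-t)).scomp t (hasDerivAt_neg t)
  have h2 : Commute (Complex.I • H) (propagator H (-t)) :=
    commute_propagator ((Commute.refl H).smul_left _) _
  rw [h2.eq]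
  simpa [Function.comp_def] using h1

/-- The Heisenberg evolution `e^{itH} A e^{-itH}`. -/
def heis (H : 𝒜) (t : ℝ) (A : 𝒜) : 𝒜 := propagator H t * A * propagator H (-t)

@[simp]
theorem heis_zero_time (H A : 𝒜) : heis H 0 A = A := by simp [heis]

theorem heis_add_time (H : 𝒜) (s t : ℝ) (A : 𝒜) : heis H (s + t) A = heis H s (heis H t A) := by
  simp only [heis, propagator_add, show -(s + t) = -t + -s by ring, mul_assoc]

theorem heis_add (H : 𝒜) (t : ℝ) (A B : 𝒜) : heis H t (A + B) = heis H t A + heis H t B := by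
  simp [heis, mul_add, add_mul]

theorem heis_sub (H : 𝒜) (t : ℝ) (A B : 𝒜) : heis H t (A - B) = heis H t A - heis H t B := by
  simp [heis, mul_sub, sub_mul]

theorem heis_smul (H : 𝒜) (t : ℝ) (c : ℂ) (A : 𝒜) : heis H t (c • A) = c • heis H t A := by
  simp [heis]

theorem heis_sum (H : 𝒜) (t : ℝ) {ι : Type*} (s : Finset ι) (A : ι → 𝒜) :
    heis H t (∑ i ∈ s, A i) = ∑ i ∈ s, heis H t (A i) := by
  simp [heis, Finset.mul_sum, Finset.sum_mul]

theorem heis_one (H : 𝒜) (t : ℝ) : heis H t 1 = 1 := by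
  simp [heis]

theorem heis_mul (H : 𝒜) (t : ℝ) (A B : 𝒜) : heis H t (A * B) = heis H t A * heis H t B := by
  have : heis H t A * heis H t B =
      propagator H t * A * (propagator H (-t) * propagator H t) * B * propagator H (-t) := by
    simp only [heis, mul_assoc]
  rw [this, propagator_neg_mul, mul_one, heis, mul_assoc (propagator H t) A B]

theorem heis_lie (H : 𝒜) (t : ℝ) (A B : 𝒜) : heis H t ⁅A, B⁆ = ⁅heis H t A, heis H t B⁆ := by
  simp only [Ring.lie_def, heis_sub, heis_mul]

theorem star_heis {H : 𝒜} (hH : IsSelfAdjoint H) (t : ℝ) (A : 𝒜) :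
    star (heis H t A) = heis H t (star A) := by
  simp [heis, star_propagator hH, mul_assoc]

theorem norm_heis {H : 𝒜} (hH : IsSelfAdjoint H) (t : ℝ) (A : 𝒜) : ‖heis H t A‖ = ‖A‖ := by
  rw [heis, norm_mul_propagator hH, norm_propagator_mul hH]

theorem hasDerivAt_heis (H : 𝒜) (t : ℝ) (A : 𝒜) :
    HasDerivAt (fun s => heis H s A) (heis H t (Complex.I • ⁅H, A⁆)) t := by
  have h := ((hasDerivAt_propagator H t).mul_const A).mul (hasDerivAt_propagator_neg H t)
  refine h.congr_deriv ?_
  simp only [heis, Ring.lie_def, smul_sub, mul_sub, sub_mul, mul_neg, mul_assoc,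
    smul_mul_assoc, mul_smul_comm]
  abel

theorem norm_lie_le (A B : 𝒜) : ‖⁅A, B⁆‖ ≤ 2 * ‖A‖ * ‖B‖ := by
  rw [Ring.lie_def]
  calc ‖A * B - B * A‖ ≤ ‖A * B‖ + ‖B * A‖ := norm_sub_le _ _
    _ ≤ ‖A‖ * ‖B‖ + ‖B‖ * ‖A‖ := add_le_add (norm_mul_le _ _) (norm_mul_le _ _)
    _ = _ := by ring

theorem norm_lie_comm (A B : 𝒜) : ‖⁅A, B⁆‖ = ‖⁅B, A⁆‖ := by
  rw [Ring.lie_def, Ring.lie_def, norm_sub_rev]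

/-- Conjugation by the evolution exchanges the roles of the two observables. -/
theorem norm_lie_heis_neg {H : 𝒜} (hH : IsSelfAdjoint H) (t : ℝ) (A B : 𝒜) :
    ‖⁅heis H (-t) A, B⁆‖ = ‖⁅heis H t B, A⁆‖ := by
  rw [← norm_heis hH t, heis_lie, ← heis_add_time, norm_lie_comm]
  simp

theorem norm_heis_sub_self_le {H : 𝒜} (hH : IsSelfAdjoint H) (t : ℝ) (A : 𝒜) :
    ‖heis H t A - A‖ ≤ |t| * ‖⁅H, A⁆‖ := by
  have := (convex_univ (𝕜 := ℝ) (E := ℝ)).norm_image_sub_le_of_norm_hasDerivWithin_le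
    (f := fun s => heis H s A) (f' := fun s => heis H s (Complex.I • ⁅H, A⁆)) (C := ‖⁅H, A⁆‖)
    (fun x _ => (hasDerivAt_heis H x A).hasDerivWithinAt)
    (fun x _ => by rw [norm_heis hH, norm_smul]; simp) (Set.mem_univ 0) (Set.mem_univ t)
  simpa [mul_comm] using this

/-- One step of the Lieb–Robinson iteration. Let `L` be a part of `H` that commutes with `A`. Then
`V = e^{itH} e^{-itL}` satisfies `V* τ_t(A) V = A`, so `[τ_t(A), B]` is unitarily equivalent to
`[A, V* B V]`, and the derivative of `V* B V` is `-i V* [τ_t(H - L), B] V`. -/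
theorem norm_lie_heis_le {H L A B : 𝒜} (hH : IsSelfAdjoint H) (hL : IsSelfAdjoint L)
    (hAL : Commute A L) {b b' : ℝ → ℝ} (hb : ∀ t, HasDerivAt b (b' t) t)
    (h0 : ‖⁅A, B⁆‖ ≤ b 0)
    (hb' : ∀ t, 0 ≤ t → 2 * ‖A‖ * ‖⁅heis H t (H - L), B⁆‖ ≤ b' t) {t : ℝ} (ht : 0 ≤ t) :
    ‖⁅heis H t A, B⁆‖ ≤ b t := by
  -- For self-adjoint `H` and `L` these are unitary and adjoint to each other.
  let V : ℝ → 𝒜 := fun s => propagator H s * propagator L (-s)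
  let W : ℝ → 𝒜 := fun s => propagator L s * propagator H (-s)
  have hnorm : ∀ s X, ‖W s * X * V s‖ = ‖X‖ := by
    intro s X
    simp only [V, W, ← mul_assoc]
    rw [norm_mul_propagator hL, norm_mul_propagator hH, mul_assoc, norm_propagator_mul hL,
      norm_propagator_mul hH]
  have hV : ∀ s, HasDerivAt V (Complex.I • (heis H s (H - L) * V s)) s := by
    intro s
    refine ((hasDerivAt_propagator H s).mul (hasDerivAt_propagator_neg L s)).congr_deriv ?_
    have : propagator H (-s) * (propagator H s * propagator L (-s)) = propagator L (-s) := by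
      rw [← mul_assoc, propagator_neg_mul, one_mul]
    simp only [heis, V, mul_assoc, this]
    simp only [mul_sub, sub_mul, smul_sub, smul_mul_assoc, mul_smul_comm, mul_neg]
    abel
  have hW : ∀ s, HasDerivAt W (-(Complex.I • (W s * heis H s (H - L)))) s := by
    intro s
    refine ((hasDerivAt_propagator L s).mul (hasDerivAt_propagator_neg H s)).congr_deriv ?_
    have : W s * heis H s (H - L) = propagator L s * (H - L) * propagator H (-s) := by
      simp only [heis, W]
      calc _ = propagator L s * (propagator H (-s) * propagator H s) * (H - L) *
            propagator H (-s) := by simp only [mul_assoc]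
        _ = _ := by rw [propagator_neg_mul, mul_one]
    rw [this]
    simp only [mul_sub, sub_mul, smul_sub, mul_assoc, smul_mul_assoc, mul_smul_comm, mul_neg]
    abel
  have hG : ∀ s, HasDerivAt (fun s => W s * B * V s)
      (-(Complex.I • (W s * ⁅heis H s (H - L), B⁆ * V s))) s := by
    intro s
    refine (((hW s).mul_const B).mul (hV s)).congr_deriv ?_
    simp only [Ring.lie_def, mul_sub, sub_mul, smul_sub, mul_assoc, smul_mul_assoc,
      mul_smul_comm, neg_mul]
    abel
  have hA : ∀ s, W s * heis H s A * V s = A := by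
    intro s
    have e : W s * heis H s A * V s = propagator L s * (propagator H (-s) * propagator H s) * A *
        (propagator H (-s) * propagator H s) * propagator L (-s) := by
      simp only [W, V, heis, mul_assoc]
    rw [e]
    simp only [propagator_neg_mul, mul_one]
    rw [← (commute_propagator hAL s).eq, mul_assoc, propagator_mul_neg, mul_one]
  have hVW : ∀ s, V s * W s = 1 := by
    intro s
    calc V s * W s = propagator H s * (propagator L (-s) * propagator L s) *
          propagator H (-s) := by simp only [V, W, mul_assoc]
      _ = 1 := by rw [propagator_neg_mul, mul_one, propagator_mul_neg]
  have hf : ∀ s, ⁅A, W s * B * V s⁆ = W s * ⁅heis H s A, B⁆ * V s := by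
    intro s
    have h1 : W s * (heis H s A * B) * V s = (W s * heis H s A * V s) * (W s * B * V s) := by
      calc _ = W s * heis H s A * 1 * B * V s := by simp only [mul_one, mul_assoc]
        _ = _ := by rw [← hVW s]; simp only [mul_assoc]
    have h2 : W s * (B * heis H s A) * V s = (W s * B * V s) * (W s * heis H s A * V s) := by
      calc _ = W s * B * 1 * heis H s A * V s := by simp only [mul_one, mul_assoc]
        _ = _ := by rw [← hVW s]; simp only [mul_assoc]
    rw [Ring.lie_def, Ring.lie_def, mul_sub, sub_mul, h1, h2, hA]
  have hderiv : ∀ s, HasDerivAt (fun s => ⁅A, W s * B * V s⁆)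
      (⁅A, -(Complex.I • (W s * ⁅heis H s (H - L), B⁆ * V s))⁆) s := by
    intro s
    simp only [Ring.lie_def]
    exact ((hG s).const_mul A).sub ((hG s).mul_const A)
  have key := image_norm_le_of_norm_deriv_right_le_deriv_boundary (a := 0) (b := t)
    (f := fun s => ⁅A, W s * B * V s⁆) (B := b) (B' := b')
    (fun s _ => (hderiv s).continuousAt.continuousWithinAt)
    (fun s _ => (hderiv s).hasDerivWithinAt)
    (by simpa [W, V] using h0) hb
    (fun s hs => by
      refine le_trans (norm_lie_le _ _) (le_trans (le_of_eq ?_) (hb' s hs.1))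
      rw [norm_neg, norm_smul, hnorm]
      simp)
    (Set.right_mem_Icc.2 ht)
  simpa only [hf, hnorm] using key

end Heisenberg

theorem localDynamics_eq_heis {d : ℕ} (Φ : Interaction d) (Λ : Finset ℤ) (t : ℝ)
    (A : QuasiLocal d) : Φ.localDynamics Λ t A = heis (Φ.hamiltonian Λ) t A := by
  simp [Interaction.localDynamics, heis, propagator]

/-! ### Local algebras -/

section LocalAlgebras
variable {d : ℕ}

theorem matrixRep_apply (X : Finset ℤ) (M : Matrix (X → Fin d) (X → Fin d) ℂ)
    (ψ : ChainSpace d) (σ : Configuration d) :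
    matrixRep X M ψ σ = ∑ b, M (restrict X σ) b * ψ (override X σ b) :=
  matrixOp_apply X M ψ σ

theorem restrict_override_of_disjoint {X Y : Finset ℤ} (h : Disjoint X Y) (σ : Configuration d)
    (b : X → Fin d) : restrict Y (override X σ b) = restrict Y σ := by
  funext y
  have : (y : ℤ) ∉ X := fun hy => Finset.disjoint_left.1 h hy y.2
  simp [restrict, override, this]

theorem override_override_of_disjoint {X Y : Finset ℤ} (h : Disjoint X Y) (σ : Configuration d)
    (b : X → Fin d) (c : Y → Fin d) :
    override Y (override X σ b) c = override X (override Y σ c) b := by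
  funext x
  by_cases hx : x ∈ X
  · have : x ∉ Y := Finset.disjoint_left.1 h hx
    simp [override, hx, this]
  · simp [override, hx]

/-- Observables with disjoint supports commute. -/
theorem commute_of_disjoint {X Y : Finset ℤ} (h : Disjoint X Y) {A B : QuasiLocal d}
    (hA : A ∈ localAlgebra d X) (hB : B ∈ localAlgebra d Y) : Commute A B := by
  obtain ⟨M, rfl⟩ := hA
  obtain ⟨N, rfl⟩ := hB
  refine Subtype.ext ?_
  change matrixRep X M * matrixRep Y N = matrixRep Y N * matrixRep X M
  ext ψ σ
  simp only [_root_.mul_apply_eq_comp, matrixRep_apply, Finset.mul_sum,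
    restrict_override_of_disjoint h, restrict_override_of_disjoint h.symm,
    override_override_of_disjoint h]
  rw [Finset.sum_comm]
  exact Finset.sum_congr rfl fun _ _ => Finset.sum_congr rfl fun _ _ => by ring

theorem lie_eq_zero_of_disjoint {X Y : Finset ℤ} (h : Disjoint X Y) {A B : QuasiLocal d}
    (hA : A ∈ localAlgebra d X) (hB : B ∈ localAlgebra d Y) : ⁅A, B⁆ = 0 := by
  rw [Ring.lie_def, (commute_of_disjoint h hA hB).eq, sub_self]

/-- The configuration of `Y` equal to `c` on `X` and to `a` off `X`. -/
def overrideOn (X Y : Finset ℤ) (a : Y → Fin d) (c : X → Fin d) : Y → Fin d :=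
  fun y => if hy : (y : ℤ) ∈ X then c ⟨y, hy⟩ else a y

/-- Isotony. A matrix over the configurations of `X` acts on those of `Y ⊇ X` through the
entries of configurations that agree on `Y \ X`. -/
theorem localAlgebra_mono {X Y : Finset ℤ} (h : X ⊆ Y) : localAlgebra d X ≤ localAlgebra d Y := by
  rintro _ ⟨M, rfl⟩
  let N : Matrix (Y → Fin d) (Y → Fin d) ℂ := fun a b =>
    ∑ c : X → Fin d, if b = overrideOn X Y a c then M (fun x => a ⟨x, h x.2⟩) c else 0
  refine ⟨N, ?_⟩
  refine Subtype.ext ?_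
  change matrixRep Y N = matrixRep X M
  ext ψ σ
  have e : ∀ c : X → Fin d, override Y σ (overrideOn X Y (restrict Y σ) c) = override X σ c := by
    intro c
    funext x
    by_cases hy : x ∈ Y
    · by_cases hx : x ∈ X <;> simp [override, overrideOn, restrict, hx, hy]
    · have hx : x ∉ X := fun hx => hy (h hx)
      simp [override, hx, hy]
  rw [matrixRep_apply, matrixRep_apply]
  simp only [N, Finset.sum_mul]
  rw [Finset.sum_comm]
  refine Finset.sum_congr rfl fun c _ => ?_
  simp only [ite_mul, zero_mul]
  rw [Finset.sum_ite_eq' Finset.univ, if_pos (Finset.mem_univ _), e]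
  rfl

/-- Local observables are dense in the quasi-local algebra. -/
theorem exists_localAlgebra_norm_sub_lt (A : QuasiLocal d) {ε : ℝ} (hε : 0 < ε) :
    ∃ X : Finset ℤ, ∃ B ∈ localAlgebra d X, ‖A - B‖ < ε := by
  have hA : (A.1 : ChainSpace d →L[ℂ] ChainSpace d) ∈
      closure (((⨆ X : Finset ℤ, (matrixRep (d := d) X).range) :
        StarSubalgebra ℂ (ChainSpace d →L[ℂ] ChainSpace d)) : Set _) := A.2
  have hdir : Directed (· ≤ ·) fun X : Finset ℤ => (matrixRep (d := d) X).range := by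
    intro X Y
    have key : ∀ {Z W : Finset ℤ}, Z ⊆ W →
        (matrixRep (d := d) Z).range ≤ (matrixRep (d := d) W).range := by
      rintro Z W hZW _ ⟨M, rfl⟩
      obtain ⟨N, hN⟩ := localAlgebra_mono hZW (⟨M, rfl⟩ : localEmbedding Z M ∈ localAlgebra d Z)
      exact ⟨N, congrArg Subtype.val hN⟩
    exact ⟨X ∪ Y, key Finset.subset_union_left, key Finset.subset_union_right⟩
  rw [StarSubalgebra.coe_iSup_of_directed hdir, Metric.mem_closure_iff] at hA
  obtain ⟨b, hb, hlt⟩ := hA ε hε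
  obtain ⟨X, M, rfl⟩ := Set.mem_iUnion.1 hb
  refine ⟨X, localEmbedding X M, ⟨M, rfl⟩, ?_⟩
  rw [dist_eq_norm] at hlt
  exact hlt

theorem isClosed_localAlgebra (X : Finset ℤ) :
    IsClosed (localAlgebra d X : Set (QuasiLocal d)) := by
  have h : FiniteDimensional ℂ (LinearMap.range (localEmbedding (d := d) X).toLinearMap) :=
    inferInstance
  exact Submodule.closed_of_finiteDimensional
    (LinearMap.range (localEmbedding (d := d) X).toLinearMap)

theorem exp_mem_localAlgebra {X : Finset ℤ} {H : QuasiLocal d} (hH : H ∈ localAlgebra d X) :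
    NormedSpace.exp H ∈ localAlgebra d X := by
  let _ : NormedAlgebra ℚ (QuasiLocal d) := NormedAlgebra.restrictScalars ℚ ℂ _
  have : IsScalarTower ℚ ℂ (QuasiLocal d) := IsScalarTower.of_algebraMap_smul fun _ _ => rfl
  exact NormedSpace.exp_mem (R := ℂ) (s := localAlgebra d X) (isClosed_localAlgebra X) hH

theorem heis_mem_localAlgebra {X : Finset ℤ} {H A : QuasiLocal d} (hH : H ∈ localAlgebra d X)
    (hA : A ∈ localAlgebra d X) (t : ℝ) : heis H t A ∈ localAlgebra d X := by
  have h : ∀ s, propagator H s ∈ localAlgebra d X := fun s =>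
    exp_mem_localAlgebra (SMulMemClass.smul_mem _ hH)
  exact mul_mem (mul_mem (h t) hA) (h (-t))

theorem hamiltonian_mem_localAlgebra (Φ : Interaction d) (Λ : Finset ℤ) :
    Φ.hamiltonian Λ ∈ localAlgebra d Λ :=
  sum_mem fun Z hZ => localAlgebra_mono (Finset.mem_powerset.1 hZ) (Φ.mem_localAlgebra Z)

theorem isSelfAdjoint_hamiltonian (Φ : Interaction d) (Λ : Finset ℤ) :
    IsSelfAdjoint (Φ.hamiltonian Λ) :=
  isSelfAdjoint_sum _ fun Z _ => Φ.isSelfAdjoint Z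

end LocalAlgebras

/-! ### Lieb–Robinson bound in a finite volume -/

section Decay
variable {h : ℝ≥0 → ℝ≥0} {β C : ℝ}

theorem decayF_pos (h : ℝ≥0 → ℝ≥0) (β : ℝ) (x : ℝ≥0) : 0 < decayF h β x := by
  unfold decayF; positivity

theorem siteDist_comm (x y : ℤ) : siteDist x y = siteDist y x := by
  rw [siteDist, siteDist, ← Int.natAbs_neg, neg_sub]

theorem IsConvolutionConstant.pos (hC : IsConvolutionConstant h β C) : 0 < C := by
  obtain ⟨hs, hle⟩ := hC 0 0
  have h1 : 0 < ∑' z : ℤ, decayF h β (siteDist 0 z) * decayF h β (siteDist z 0) :=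
    hs.tsum_pos (fun _ => (mul_pos (decayF_pos _ _ _) (decayF_pos _ _ _)).le) 0
      (mul_pos (decayF_pos _ _ _) (decayF_pos _ _ _))
  exact pos_of_mul_pos_left (h1.trans_le hle) (decayF_pos _ _ _).le

theorem IsConvolutionConstant.sum_le (hC : IsConvolutionConstant h β C) (s : Finset ℤ) (x y : ℤ) :
    ∑ z ∈ s, decayF h β (siteDist x z) * decayF h β (siteDist z y) ≤
      C * decayF h β (siteDist x y) :=
  ((hC x y).1.sum_le_tsum s fun _ _ =>
    (mul_pos (decayF_pos _ _ _) (decayF_pos _ _ _)).le).trans (hC x y).2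

/-- The double sum `∑_{x ∈ X} ∑_{y ∈ Y} F_β(|x - y|)` that measures the coupling between `X` and
`Y`. -/
def coupling (h : ℝ≥0 → ℝ≥0) (β : ℝ) (X Y : Finset ℤ) : ℝ :=
  ∑ x ∈ X, ∑ y ∈ Y, decayF h β (siteDist x y)

theorem coupling_nonneg (h : ℝ≥0 → ℝ≥0) (β : ℝ) (X Y : Finset ℤ) : 0 ≤ coupling h β X Y :=
  Finset.sum_nonneg fun _ _ => Finset.sum_nonneg fun _ _ => (decayF_pos _ _ _).le

theorem coupling_comm (h : ℝ≥0 → ℝ≥0) (β : ℝ) (X Y : Finset ℤ) :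
    coupling h β X Y = coupling h β Y X := by
  rw [coupling, Finset.sum_comm, coupling]
  simp only [siteDist_comm]

/-- The indicator of `X ∩ Y ≠ ∅`. -/
def meets (X Y : Finset ℤ) : ℝ := if Disjoint X Y then 0 else 1

theorem meets_nonneg (X Y : Finset ℤ) : 0 ≤ meets X Y := by
  unfold meets; split_ifs <;> norm_num

theorem meets_comm (X Y : Finset ℤ) : meets X Y = meets Y X := by
  simp only [meets, disjoint_comm]

/-- The number of points of `X ∩ Y` bounds the indicator of `X ∩ Y ≠ ∅`. -/
theorem meets_le_sum (X Y : Finset ℤ) : meets X Y ≤ ∑ y ∈ Y, if y ∈ X then (1 : ℝ) else 0 := by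
  unfold meets
  split_ifs with hd
  · exact Finset.sum_nonneg fun _ _ => by split_ifs <;> norm_num
  · obtain ⟨z, hzX, hzY⟩ := Finset.not_disjoint_iff.1 hd
    calc (1 : ℝ) = if z ∈ X then (1 : ℝ) else 0 := by simp [hzX]
      _ ≤ _ := Finset.single_le_sum (f := fun y => if y ∈ X then (1 : ℝ) else 0)
        (fun _ _ => by split_ifs <;> norm_num) hzY

end Decay

section LiebRobinson
variable {d : ℕ} {h : ℝ≥0 → ℝ≥0} {β C : ℝ} {N : ℝ≥0} {Φ : Interaction d}

/-- The content of `‖Φ‖_{h,β} ≤ N` for finitely many terms. -/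
theorem sum_norm_term_le (hN : Φ.decayNorm h β ≤ N) (s : Finset (Finset ℤ)) (x y : ℤ) :
    ∑ Z ∈ s, ‖Φ.term Z‖ * ((if x ∈ Z then 1 else 0) * (if y ∈ Z then 1 else 0)) ≤
      N * decayF h β (siteDist x y) := by
  have hF := decayF_pos h β (siteDist x y)
  have h1 : ∑' Z : {Z : Finset ℤ // x ∈ Z ∧ y ∈ Z},
      ENNReal.ofReal (‖Φ.term Z‖ / decayF h β (siteDist x y)) ≤ N :=
    (le_iSup₂ (f := fun x y : ℤ => ∑' Z : {Z : Finset ℤ // x ∈ Z ∧ y ∈ Z},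
      ENNReal.ofReal (‖Φ.term Z‖ / decayF h β (siteDist x y))) x y).trans hN
  have h2 := (ENNReal.sum_le_tsum (s.subtype fun Z => x ∈ Z ∧ y ∈ Z)).trans h1
  rw [← ENNReal.ofReal_sum_of_nonneg fun Z _ => by positivity, ← ENNReal.ofReal_coe_nnreal]
    at h2
  replace h2 := (ENNReal.ofReal_le_ofReal_iff N.2).1 h2
  rw [← Finset.sum_div, div_le_iff₀ hF] at h2
  refine le_trans (le_of_eq ?_) h2
  rw [Finset.sum_subtype_eq_sum_filter (f := fun Z => ‖Φ.term Z‖), Finset.sum_filter]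
  refine Finset.sum_congr rfl fun Z _ => ?_
  by_cases hx : x ∈ Z <;> by_cases hy : y ∈ Z <;> simp [hx, hy]

/-- First-order term of the Lieb–Robinson iteration: the interaction terms that couple `X`
and `Y` directly. -/
theorem sum_norm_term_mul_meets_le (hN : Φ.decayNorm h β ≤ N) (s : Finset (Finset ℤ))
    (X Y : Finset ℤ) :
    ∑ Z ∈ s, ‖Φ.term Z‖ * (meets Z X * meets Z Y) ≤ N * coupling h β X Y := by
  calc ∑ Z ∈ s, ‖Φ.term Z‖ * (meets Z X * meets Z Y)
      ≤ ∑ Z ∈ s, ‖Φ.term Z‖ * ((∑ x ∈ X, if x ∈ Z then 1 else 0) *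
          ∑ y ∈ Y, if y ∈ Z then 1 else 0) := by
        refine Finset.sum_le_sum fun Z _ => mul_le_mul_of_nonneg_left ?_ (norm_nonneg _)
        exact mul_le_mul (meets_le_sum _ _) (meets_le_sum _ _) (meets_nonneg _ _)
          (Finset.sum_nonneg fun _ _ => by split_ifs <;> norm_num)
    _ = ∑ x ∈ X, ∑ y ∈ Y, ∑ Z ∈ s,
          ‖Φ.term Z‖ * ((if x ∈ Z then 1 else 0) * (if y ∈ Z then 1 else 0)) := by
        simp only [Finset.sum_mul_sum]
        simp only [Finset.mul_sum]
        rw [Finset.sum_comm]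
        exact Finset.sum_congr rfl fun x _ => Finset.sum_comm
    _ ≤ ∑ x ∈ X, ∑ y ∈ Y, N * decayF h β (siteDist x y) :=
        Finset.sum_le_sum fun x _ => Finset.sum_le_sum fun y _ => sum_norm_term_le hN s x y
    _ = _ := by simp only [coupling, Finset.mul_sum]

/-- The step of the Lieb–Robinson iteration: a term that meets `X`, followed by a coupling to
`Y`, is again a coupling of `X` and `Y`, by the convolution property of `F_β`. -/
theorem sum_norm_term_mul_coupling_le (hC : IsConvolutionConstant h β C)
    (hN : Φ.decayNorm h β ≤ N) (Λ X Y : Finset ℤ) :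
    ∑ Z ∈ Λ.powerset, ‖Φ.term Z‖ * (meets Z X * coupling h β Z Y) ≤
      N * (C * coupling h β X Y) := by
  have hG : ∀ z, 0 ≤ ∑ y ∈ Y, decayF h β (siteDist z y) :=
    fun z => Finset.sum_nonneg fun _ _ => (decayF_pos _ _ _).le
  calc ∑ Z ∈ Λ.powerset, ‖Φ.term Z‖ * (meets Z X * coupling h β Z Y)
      ≤ ∑ Z ∈ Λ.powerset, ‖Φ.term Z‖ * ((∑ x ∈ X, if x ∈ Z then 1 else 0) *
          ∑ z ∈ Λ, (if z ∈ Z then 1 else 0) * ∑ y ∈ Y, decayF h β (siteDist z y)) := by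
        refine Finset.sum_le_sum fun Z hZ => mul_le_mul_of_nonneg_left ?_ (norm_nonneg _)
        refine mul_le_mul (meets_le_sum _ _) (le_of_eq ?_) (coupling_nonneg _ _ _ _)
          (Finset.sum_nonneg fun _ _ => by split_ifs <;> norm_num)
        simp only [ite_mul, one_mul, zero_mul, coupling]
        rw [← Finset.sum_filter]
        congr 1
        ext z
        simpa using fun hz => Finset.mem_powerset.1 hZ hz
    _ = ∑ x ∈ X, ∑ z ∈ Λ, (∑ Z ∈ Λ.powerset,
          ‖Φ.term Z‖ * ((if x ∈ Z then 1 else 0) * (if z ∈ Z then 1 else 0))) *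
            ∑ y ∈ Y, decayF h β (siteDist z y) := by
        simp only [Finset.sum_mul_sum]
        simp only [Finset.mul_sum]
        rw [Finset.sum_comm]
        refine Finset.sum_congr rfl fun x _ => ?_
        rw [Finset.sum_comm]
        exact Finset.sum_congr rfl fun z _ => Finset.sum_congr rfl fun Z _ =>
          Finset.sum_congr rfl fun y _ => by ring
    _ ≤ ∑ x ∈ X, ∑ z ∈ Λ, (N * decayF h β (siteDist x z)) *
            ∑ y ∈ Y, decayF h β (siteDist z y) :=
        Finset.sum_le_sum fun x _ => Finset.sum_le_sum fun z _ =>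
          mul_le_mul_of_nonneg_right (sum_norm_term_le hN _ x z) (hG z)
    _ = ∑ x ∈ X, ∑ y ∈ Y, N * ∑ z ∈ Λ,
          decayF h β (siteDist x z) * decayF h β (siteDist z y) := by
        simp only [Finset.mul_sum]
        refine Finset.sum_congr rfl fun x _ => ?_
        rw [Finset.sum_comm]
        exact Finset.sum_congr rfl fun y _ => Finset.sum_congr rfl fun Z _ => by ring
    _ ≤ ∑ x ∈ X, ∑ y ∈ Y, N * (C * decayF h β (siteDist x y)) :=
        Finset.sum_le_sum fun x _ => Finset.sum_le_sum fun y _ =>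
          mul_le_mul_of_nonneg_left (hC.sum_le Λ x y) N.2
    _ = _ := by simp only [coupling, Finset.mul_sum]

/-- The time-dependence `(e^{ν t} - 1) / C` of the Lieb–Robinson bound, `ν = 2 N C`. -/
def growth (N : ℝ≥0) (C t : ℝ) : ℝ := (Real.exp (velocity N C * t) - 1) / C

theorem growth_zero (N : ℝ≥0) (C : ℝ) : growth N C 0 = 0 := by simp [growth]

theorem velocity_nonneg (N : ℝ≥0) (hC : 0 ≤ C) : 0 ≤ velocity N C := by
  unfold velocity; positivity

theorem growth_mono (N : ℝ≥0) (hC : 0 < C) : Monotone (growth N C) := by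
  intro s t hst
  have := velocity_nonneg N hC.le
  unfold growth
  gcongr

theorem growth_nonneg (N : ℝ≥0) (hC : 0 < C) {t : ℝ} (ht : 0 ≤ t) : 0 ≤ growth N C t := by
  rw [← growth_zero N C]
  exact growth_mono N hC ht

/-- The growth function solves the linear differential equation that the Lieb–Robinson
iteration produces. -/
theorem hasDerivAt_growth (N : ℝ≥0) (hC : 0 < C) (t : ℝ) :
    HasDerivAt (growth N C) (2 * (N + N * (C * growth N C t))) t := by
  have h1 : HasDerivAt (growth N C)
      ((Real.exp (velocity N C * t) * (velocity N C * 1)) / C) t :=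
    ((((hasDerivAt_id t).const_mul _).exp).sub_const 1).div_const C
  refine h1.congr_deriv ?_
  unfold growth velocity
  field_simp
  ring

/-- The Lieb–Robinson bound in a finite volume, up to the remainder after `k` iterations. -/
theorem norm_lie_heis_le_growth_add (hC : IsConvolutionConstant h β C)
    (hN : Φ.decayNorm h β ≤ N) (Λ Y : Finset ℤ) {B : QuasiLocal d}
    (hB : B ∈ localAlgebra d Y) (k : ℕ) :
    ∀ (X : Finset ℤ), ∀ A ∈ localAlgebra d X, ∀ t : ℝ, 0 ≤ t →
      ‖⁅heis (Φ.hamiltonian Λ) t A, B⁆‖ ≤ 2 * ‖A‖ * ‖B‖ *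
        (meets X Y + growth N C t * coupling h β X Y +
          (2 * (∑ Z ∈ Λ.powerset, ‖Φ.term Z‖) * t) ^ k / k.factorial) := by
  have hC0 := hC.pos
  set M := ∑ Z ∈ Λ.powerset, ‖Φ.term Z‖ with hM
  have hM0 : 0 ≤ M := Finset.sum_nonneg fun _ _ => norm_nonneg _
  have hH := isSelfAdjoint_hamiltonian Φ Λ
  induction k with
  | zero =>
    intro X A hA t ht
    refine (norm_lie_le _ _).trans ?_
    rw [norm_heis hH]
    refine le_mul_of_one_le_right (by positivity) ?_
    have := mul_nonneg (growth_nonneg N hC0 ht) (coupling_nonneg h β X Y)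
    have := meets_nonneg X Y
    simp only [pow_zero, Nat.factorial_zero, Nat.cast_one, div_one]
    linarith
  | succ k ih =>
    intro X A hA t ht
    -- The terms disjoint from the support of `A` commute with `A`.
    let L := ∑ Z ∈ Λ.powerset with Disjoint Z X, Φ.term Z
    have hL : IsSelfAdjoint L := isSelfAdjoint_sum _ fun Z _ => Φ.isSelfAdjoint Z
    have hAL : Commute A L := Commute.sum_right _ _ _ fun Z hZ =>
      (commute_of_disjoint (Finset.mem_filter.1 hZ).2 (Φ.mem_localAlgebra Z) hA).symm
    have hJ : Φ.hamiltonian Λ - L = ∑ Z ∈ Λ.powerset with ¬ Disjoint Z X, Φ.term Z := by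
      rw [sub_eq_iff_eq_add', Finset.sum_filter_add_sum_filter_not]
      rfl
    let R : ℕ → ℝ → ℝ := fun k t => (2 * M * t) ^ k / k.factorial
    have hR : ∀ s, HasDerivAt (R (k + 1)) (2 * (M * R k s)) s := by
      intro s
      have := ((((hasDerivAt_id s).const_mul (2 * M)).pow (k + 1)).div_const
        ((k + 1).factorial : ℝ))
      refine this.congr_deriv ?_
      simp only [R, Nat.factorial_succ, Nat.cast_mul, Nat.cast_add, Nat.cast_one, id,
        Nat.add_sub_cancel]
      have : (k.factorial : ℝ) ≠ 0 := by positivity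
      field_simp
    refine norm_lie_heis_le hH hL hAL
      (b := fun s => 2 * ‖A‖ * ‖B‖ *
        (meets X Y + growth N C s * coupling h β X Y + R (k + 1) s))
      (b' := fun s => 2 * ‖A‖ * ‖B‖ * (2 * (N + N * (C * growth N C s)) * coupling h β X Y +
        2 * (M * R k s)))
      (fun s => ((((hasDerivAt_growth N hC0 s).mul_const _).const_add _).add
        (hR s)).const_mul _) ?_ ?_ ht
    · have h0 : 2 * ‖A‖ * ‖B‖ * (meets X Y + growth N C 0 * coupling h β X Y + R (k + 1) 0) =
          2 * ‖A‖ * ‖B‖ * meets X Y := by simp [R, growth_zero]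
      rw [h0, meets]
      split_ifs with hd
      · rw [lie_eq_zero_of_disjoint hd hA hB]; simp
      · simpa using norm_lie_le A B
    · intro s hs
      have h1 : ‖⁅heis (Φ.hamiltonian Λ) s (Φ.hamiltonian Λ - L), B⁆‖ ≤
          ∑ Z ∈ Λ.powerset, meets Z X * (2 * ‖Φ.term Z‖ * ‖B‖ *
            (meets Z Y + growth N C s * coupling h β Z Y + R k s)) := by
        rw [hJ, heis_sum, Ring.lie_def, Finset.sum_mul, Finset.mul_sum, ← Finset.sum_sub_distrib]
        refine (norm_sum_le _ _).trans ?_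
        rw [Finset.sum_filter]
        refine Finset.sum_le_sum fun Z _ => ?_
        by_cases hd : Disjoint Z X
        · simp [meets, hd]
        · rw [if_pos hd, meets, if_neg hd, one_mul]
          exact ih Z _ (Φ.mem_localAlgebra Z) s hs
      have h2 : ∑ Z ∈ Λ.powerset, meets Z X * (2 * ‖Φ.term Z‖ * ‖B‖ *
            (meets Z Y + growth N C s * coupling h β Z Y + R k s)) =
          2 * ‖B‖ * (∑ Z ∈ Λ.powerset, ‖Φ.term Z‖ * (meets Z X * meets Z Y) +
            growth N C s * ∑ Z ∈ Λ.powerset, ‖Φ.term Z‖ * (meets Z X * coupling h β Z Y) +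
            (∑ Z ∈ Λ.powerset, ‖Φ.term Z‖ * meets Z X) * R k s) := by
        simp only [Finset.mul_sum, Finset.sum_mul, ← Finset.sum_add_distrib]
        exact Finset.sum_congr rfl fun Z _ => by ring
      have h3 : ∑ Z ∈ Λ.powerset, ‖Φ.term Z‖ * meets Z X ≤ M :=
        Finset.sum_le_sum fun Z _ => mul_le_of_le_one_right (norm_nonneg _) (by
          unfold meets; split_ifs <;> norm_num)
      have hR0 : 0 ≤ R k s := by positivity
      have hD := growth_nonneg N hC0 hs
      calc 2 * ‖A‖ * ‖⁅heis (Φ.hamiltonian Λ) s (Φ.hamiltonian Λ - L), B⁆‖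
          ≤ 2 * ‖A‖ * (2 * ‖B‖ * (N * coupling h β X Y +
              growth N C s * (N * (C * coupling h β X Y)) + M * R k s)) := by
            refine mul_le_mul_of_nonneg_left (h1.trans ?_) (by positivity)
            rw [h2]
            gcongr
            · exact sum_norm_term_mul_meets_le hN _ X Y
            · exact sum_norm_term_mul_coupling_le hC hN Λ X Y
        _ = _ := by ring

/-- The Lieb–Robinson bound in a finite volume. -/
theorem norm_lie_heis_le_growth (hC : IsConvolutionConstant h β C)
    (hN : Φ.decayNorm h β ≤ N) (Λ : Finset ℤ) {X Y : Finset ℤ} {A B : QuasiLocal d}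
    (hA : A ∈ localAlgebra d X) (hB : B ∈ localAlgebra d Y) (t : ℝ) :
    ‖⁅heis (Φ.hamiltonian Λ) t A, B⁆‖ ≤ 2 * ‖A‖ * ‖B‖ *
        (meets X Y + growth N C |t| * coupling h β X Y) := by
  have key : ∀ {X Y : Finset ℤ} {A B : QuasiLocal d}, A ∈ localAlgebra d X →
      B ∈ localAlgebra d Y → ∀ t : ℝ, 0 ≤ t →
      ‖⁅heis (Φ.hamiltonian Λ) t A, B⁆‖ ≤ 2 * ‖A‖ * ‖B‖ *
        (meets X Y + growth N C t * coupling h β X Y) := by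
    intro X Y A B hA hB t ht
    have hlim : Tendsto (fun k : ℕ => 2 * ‖A‖ * ‖B‖ *
        (meets X Y + growth N C t * coupling h β X Y +
          (2 * (∑ Z ∈ Λ.powerset, ‖Φ.term Z‖) * t) ^ k / k.factorial)) atTop
        (𝓝 (2 * ‖A‖ * ‖B‖ * (meets X Y + growth N C t * coupling h β X Y + 0))) :=
      ((FloorSemiring.tendsto_pow_div_factorial_atTop _).const_add _).const_mul _
    rw [add_zero] at hlim
    exact ge_of_tendsto' hlim fun k =>
      norm_lie_heis_le_growth_add hC hN Λ Y hB k X A hA t ht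
  rcases le_total 0 t with ht | ht
  · rw [abs_of_nonneg ht]
    exact key hA hB t ht
  · rw [abs_of_nonpos ht]
    -- Conjugation by the evolution moves a negative time to the other observable.
    have := key hB hA (-t) (by linarith)
    rw [← norm_lie_heis_neg (isSelfAdjoint_hamiltonian Φ Λ), neg_neg, meets_comm,
      coupling_comm] at this
    linarith

end LiebRobinson

/-! ### Comparison of finite-volume dynamics -/

section Comparison
variable {𝒜 : Type*} [CStarAlgebra 𝒜]

/-- Duhamel estimate for two Heisenberg evolutions. -/
theorem norm_heis_sub_heis_le {H K : 𝒜} (hH : IsSelfAdjoint H) (A : 𝒜) {t c : ℝ}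
    (hc : ∀ s, |s| ≤ |t| → ‖⁅H - K, heis K s A⁆‖ ≤ c) :
    ‖heis H t A - heis K t A‖ ≤ |t| * c := by
  have hderiv : ∀ s, HasDerivAt (fun s => heis H (-s) (heis K s A))
      (heis H (-s) (-(Complex.I • ⁅H - K, heis K s A⁆))) s := by
    intro s
    have h1 := ((hasDerivAt_propagator_neg H s).mul (hasDerivAt_heis K s A)).mul
      (hasDerivAt_propagator H s)
    have e : (fun s => heis H (-s) (heis K s A)) =
        (fun s => propagator H (-s)) * (fun s => heis K s A) * propagator H := by
      funext s; simp [heis]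
    rw [e]
    have h2 : propagator H s * (Complex.I • H) = (Complex.I • H) * propagator H s :=
      (commute_propagator ((Commute.refl H).smul_left _) s).symm
    have h3 : (Complex.I • H) * propagator H (-s) = propagator H (-s) * (Complex.I • H) :=
      commute_propagator ((Commute.refl H).smul_left _) (-s)
    have h4 : heis K s (Complex.I • ⁅K, A⁆) = Complex.I • ⁅K, heis K s A⁆ := by
      rw [heis_smul, heis_lie]
      congr 2
      have : Commute K (propagator K s) := commute_propagator (Commute.refl K) s
      rw [heis, ← this.eq, mul_assoc, propagator_mul_neg, mul_one]
    refine h1.congr_deriv ?_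
    rw [h2, h3, h4]
    simp only [Pi.mul_apply, heis, Ring.lie_def, neg_neg, mul_sub, sub_mul, smul_sub, mul_assoc,
      smul_mul_assoc, mul_smul_comm, neg_mul, add_mul, neg_sub]
    abel
  have key := (convex_Icc (-|t|) |t|).norm_image_sub_le_of_norm_hasDerivWithin_le
    (f := fun s => heis H (-s) (heis K s A)) (C := c)
    (fun x _ => (hderiv x).hasDerivWithinAt)
    (fun x hx => by
      rw [norm_heis hH, norm_neg, norm_smul, Complex.norm_I, one_mul]
      exact hc x (abs_le.2 hx))
    (Set.mem_Icc.2 ⟨by simp, by simp⟩ : (0 : ℝ) ∈ Set.Icc (-|t|) |t|)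
    (Set.mem_Icc.2 ⟨neg_abs_le t, le_abs_self t⟩)
  have e : heis H t A - heis K t A = -heis H t (heis H (-t) (heis K t A) - A) := by
    rw [heis_sub, ← heis_add_time]
    simp
  rw [e, norm_neg, norm_heis hH]
  simpa [mul_comm] using key

/-- A first-order Taylor estimate of the Heisenberg evolution at time `0`. The element `D` is an
approximation of the derivative `i[H, B]` by an observable whose commutator with `H` stays bounded
as the volume grows, so that no second commutator of `H` with `B` is needed. -/
theorem norm_heis_sub_sub_le {H : 𝒜} (hH : IsSelfAdjoint H) (B D : 𝒜) (t : ℝ) :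
    ‖heis H t B - B - t • (Complex.I • ⁅H, B⁆)‖ ≤
      |t| * (2 * ‖Complex.I • ⁅H, B⁆ - D‖ + |t| * ‖⁅H, D⁆‖) := by
  set G := Complex.I • ⁅H, B⁆
  have hderiv : ∀ s, HasDerivAt (fun s => heis H s B - s • G) (heis H s G - (1 : ℝ) • G) s :=
    fun s => (hasDerivAt_heis H s B).sub ((hasDerivAt_id s).smul_const G)
  have key := (convex_Icc (-|t|) |t|).norm_image_sub_le_of_norm_hasDerivWithin_le
    (f := fun s => heis H s B - s • G) (C := 2 * ‖G - D‖ + |t| * ‖⁅H, D⁆‖)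
    (fun x _ => (hderiv x).hasDerivWithinAt)
    (fun x hx => by
      have e : heis H x G - (1 : ℝ) • G = heis H x (G - D) + (heis H x D - D) - (G - D) := by
        rw [heis_sub, one_smul]; abel
      rw [e]
      have h1 := norm_heis_sub_self_le hH x D
      have h2 := norm_heis hH x (G - D)
      have h3 : |x| * ‖⁅H, D⁆‖ ≤ |t| * ‖⁅H, D⁆‖ :=
        mul_le_mul_of_nonneg_right (abs_le.2 hx) (norm_nonneg _)
      have h4 := norm_sub_le (heis H x (G - D) + (heis H x D - D)) (G - D)
      have h5 := norm_add_le (heis H x (G - D)) (heis H x D - D)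
      linarith)
    (Set.mem_Icc.2 ⟨by simp, by simp⟩ : (0 : ℝ) ∈ Set.Icc (-|t|) |t|)
    (Set.mem_Icc.2 ⟨neg_abs_le t, le_abs_self t⟩)
  have e : heis H t B - B - t • G = heis H t B - t • G - (heis H 0 B - (0 : ℝ) • G) := by
    simp only [heis_zero_time, zero_smul]; abel
  rw [e]
  simpa [mul_comm] using key

end Comparison

section Tails
variable {d : ℕ} {h : ℝ≥0 → ℝ≥0} {β C : ℝ} {N : ℝ≥0} {Φ : Interaction d}

/-- The box `[-n, n]`. -/
def box (n : ℕ) : Finset ℤ := Finset.Icc (-(n : ℤ)) n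

theorem box_mono : Monotone box := fun m n hmn => by
  unfold box
  exact Finset.Icc_subset_Icc (by simpa using hmn) (by simpa using hmn)

theorem exists_subset_box (Z : Finset ℤ) : ∃ n, Z ⊆ box n := by
  refine ⟨Z.sup Int.natAbs, fun z hz => ?_⟩
  have : z.natAbs ≤ Z.sup Int.natAbs := Finset.le_sup (f := Int.natAbs) hz
  rw [box, Finset.mem_Icc]
  omega

theorem tendsto_powerset_box : Tendsto (fun n => (box n).powerset) atTop atTop :=
  tendsto_atTop_finset_of_monotone (fun _ _ hmn => Finset.powerset_mono.2 (box_mono hmn))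
    fun Z => (exists_subset_box Z).imp fun _ hn => Finset.mem_powerset.2 hn

/-- `∑_{Z ∋ y, Z ⊄ [-n, n]} ‖Φ(Z)‖`. -/
def tailAt (Φ : Interaction d) (n : ℕ) (y : ℤ) : ℝ :=
  ∑' Z : Finset ℤ, if y ∈ Z ∧ ¬ Z ⊆ box n then ‖Φ.term Z‖ else 0

theorem summable_norm_term (hN : Φ.decayNorm h β ≤ N) (y : ℤ) :
    Summable fun Z : Finset ℤ => if y ∈ Z then ‖Φ.term Z‖ else 0 := by
  refine summable_of_sum_le (c := N * decayF h β (siteDist y y))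
    (fun Z => by split_ifs <;> positivity) fun s => ?_
  refine le_trans (le_of_eq ?_) (sum_norm_term_le hN s y y)
  exact Finset.sum_congr rfl fun Z _ => by split_ifs <;> simp

theorem tailAt_term_le (n : ℕ) (y : ℤ) (Z : Finset ℤ) :
    ‖(if y ∈ Z ∧ ¬ Z ⊆ box n then ‖Φ.term Z‖ else 0)‖ ≤ if y ∈ Z then ‖Φ.term Z‖ else 0 := by
  by_cases hy : y ∈ Z <;> by_cases hZ : Z ⊆ box n <;> simp [hy, hZ]

theorem summable_tailAt (hN : Φ.decayNorm h β ≤ N) (n : ℕ) (y : ℤ) :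
    Summable fun Z : Finset ℤ => if y ∈ Z ∧ ¬ Z ⊆ box n then ‖Φ.term Z‖ else 0 :=
  (summable_norm_term hN y).of_norm_bounded fun Z => tailAt_term_le n y Z

theorem tailAt_nonneg (Φ : Interaction d) (n : ℕ) (y : ℤ) : 0 ≤ tailAt Φ n y :=
  tsum_nonneg fun Z => by split_ifs <;> positivity

/-- A bound on the tails that is uniform in the site and in `n`, for dominated convergence. -/
theorem tailAt_le (hN : Φ.decayNorm h β ≤ N) (n : ℕ) (y : ℤ) :
    tailAt Φ n y ≤ N * decayF h β 0 := by
  refine (summable_tailAt hN n y).tsum_le_of_sum_le fun s => ?_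
  have := sum_norm_term_le hN s y y
  rw [show siteDist y y = 0 by simp [siteDist]] at this
  refine le_trans (Finset.sum_le_sum fun Z _ => ?_) this
  by_cases hy : y ∈ Z <;> by_cases hZ : Z ⊆ box n <;> simp [hy, hZ]

theorem tendsto_tailAt (hN : Φ.decayNorm h β ≤ N) (y : ℤ) :
    Tendsto (fun n => tailAt Φ n y) atTop (𝓝 0) := by
  have := tendsto_tsum_of_dominated_convergence (𝓕 := atTop)
    (f := fun (n : ℕ) (Z : Finset ℤ) => if y ∈ Z ∧ ¬ Z ⊆ box n then ‖Φ.term Z‖ else 0)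
    (g := fun _ => (0 : ℝ)) (summable_norm_term hN y) (fun Z => by
      obtain ⟨n, hn⟩ := exists_subset_box Z
      refine tendsto_const_nhds.congr' ?_
      filter_upwards [eventually_ge_atTop n] with m hm
      simp [hn.trans (box_mono hm)])
    (Eventually.of_forall fun n Z => tailAt_term_le n y Z)
  simpa [tailAt] using this

theorem summable_decayF (h : ℝ≥0 → ℝ≥0) (hβ : 1 < β) (x : ℤ) :
    Summable fun y : ℤ => decayF h β (siteDist x y) := by
  -- The shift by `1 / 2` keeps the base away from `0`, where the summand has a junk value.
  have h1 := (Real.summable_one_div_int_add_rpow (-(x : ℝ) + 1 / 2) β).2 hβ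
  refine Summable.of_nonneg_of_le (fun _ => (decayF_pos _ _ _).le) (fun y => ?_) h1
  have h2 : (siteDist x y : ℝ) = |(x : ℝ) - y| := by
    simp [siteDist, Nat.cast_natAbs]
  have h0 : 0 < |(y : ℝ) + (-(x : ℝ) + 1 / 2)| := by
    rw [abs_pos]
    intro h0
    have h3 : (2 * y - 2 * x + 1 : ℝ) = 0 := by linarith
    have h4 : (2 * y - 2 * x + 1 : ℤ) = 0 := by exact_mod_cast h3
    omega
  have h3 : |(y : ℝ) + (-(x : ℝ) + 1 / 2)| ≤ 1 + siteDist x y := by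
    rw [h2, abs_sub_comm]
    calc |(y : ℝ) + (-(x : ℝ) + 1 / 2)| = |((y : ℝ) - x) + 1 / 2| := by congr 1; ring
      _ ≤ |(y : ℝ) - x| + |(1 / 2 : ℝ)| := abs_add_le _ _
      _ ≤ _ := by rw [abs_of_pos (by norm_num : (0 : ℝ) < 1 / 2)]; linarith
  unfold decayF
  refine (mul_le_of_le_one_left (by positivity) (Real.exp_le_one_iff.2 (by simp))).trans ?_
  exact one_div_le_one_div_of_le (Real.rpow_pos_of_pos h0 _)
    (Real.rpow_le_rpow h0.le h3 (by linarith))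

/-- The factor `η_n(X, T)` in the bound `∑_{Z ⊄ [-n, n]} ‖[Φ(Z), τ^{[-n,n]}_s(A)]‖ ≤ ‖A‖ η_n(X, T)`,
`A ∈ 𝔄_X`, `|s| ≤ T`. -/
def boundaryError (Φ : Interaction d) (h : ℝ≥0 → ℝ≥0) (β C : ℝ) (N : ℝ≥0) (X : Finset ℤ) (T : ℝ)
    (n : ℕ) : ℝ :=
  2 * (∑ x ∈ X, tailAt Φ n x +
    growth N C T * ∑ x ∈ X, ∑' y : ℤ, decayF h β (siteDist x y) * tailAt Φ n y)

theorem summable_decayF_mul_tailAt (hβ : 1 < β) (hN : Φ.decayNorm h β ≤ N) (n : ℕ) (x : ℤ) :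
    Summable fun y : ℤ => decayF h β (siteDist x y) * tailAt Φ n y :=
  Summable.of_nonneg_of_le
    (fun _ => mul_nonneg (decayF_pos _ _ _).le (tailAt_nonneg _ _ _))
    (fun y => mul_le_mul_of_nonneg_left (tailAt_le hN n y) (decayF_pos _ _ _).le)
    ((summable_decayF h hβ x).mul_right _)

theorem tendsto_boundaryError (hβ : 1 < β) (hN : Φ.decayNorm h β ≤ N) (C : ℝ) (X : Finset ℤ)
    (T : ℝ) : Tendsto (boundaryError Φ h β C N X T) atTop (𝓝 0) := by
  have h1 : Tendsto (fun n => ∑ x ∈ X, tailAt Φ n x) atTop (𝓝 (∑ x ∈ X, 0)) :=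
    tendsto_finsetSum _ fun x _ => tendsto_tailAt hN x
  have h2 : Tendsto (fun n => ∑ x ∈ X, ∑' y : ℤ, decayF h β (siteDist x y) * tailAt Φ n y) atTop
      (𝓝 (∑ x ∈ X, 0)) := by
    refine tendsto_finsetSum _ fun x _ => ?_
    have := tendsto_tsum_of_dominated_convergence (𝓕 := atTop)
      (f := fun (n : ℕ) (y : ℤ) => decayF h β (siteDist x y) * tailAt Φ n y)
      (g := fun _ => (0 : ℝ)) ((summable_decayF h hβ x).mul_right (N * decayF h β 0))
      (fun y => by simpa using (tendsto_tailAt hN y).const_mul (decayF h β (siteDist x y)))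
      (Eventually.of_forall fun n y => by
        rw [Real.norm_of_nonneg (mul_nonneg (decayF_pos _ _ _).le (tailAt_nonneg _ _ _))]
        exact mul_le_mul_of_nonneg_left (tailAt_le hN n y) (decayF_pos _ _ _).le)
    simpa using this
  have e : boundaryError Φ h β C N X T = fun n => 2 * (∑ x ∈ X, tailAt Φ n x +
      growth N C T * ∑ x ∈ X, ∑' y : ℤ, decayF h β (siteDist x y) * tailAt Φ n y) := rfl
  rw [e]
  simpa using (h1.add (h2.const_mul (growth N C T))).const_mul 2

/-- Interaction terms that leave the box `[-n, n]` have a small commutator with an observable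
evolved inside the box. This makes the dynamics converge and makes a ground state invariant. -/
theorem sum_norm_lie_heis_le (hβ : 1 < β) (hC : IsConvolutionConstant h β C)
    (hN : Φ.decayNorm h β ≤ N) (n : ℕ) {X : Finset ℤ} {A : QuasiLocal d}
    (hA : A ∈ localAlgebra d X) {s T : ℝ} (hs : |s| ≤ T) (𝒵 : Finset (Finset ℤ))
    (h𝒵 : ∀ Z ∈ 𝒵, ¬ Z ⊆ box n) :
    ∑ Z ∈ 𝒵, ‖⁅Φ.term Z, heis (Φ.hamiltonian (box n)) s A⁆‖ ≤
      ‖A‖ * boundaryError Φ h β C N X T n := by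
  have hg : growth N C |s| ≤ growth N C T := growth_mono N hC.pos hs
  have hg0 : 0 ≤ growth N C |s| := growth_nonneg N hC.pos (abs_nonneg s)
  have htail : ∀ y, ∑ Z ∈ 𝒵, ‖Φ.term Z‖ * (if y ∈ Z then 1 else 0) ≤ tailAt Φ n y := by
    intro y
    refine le_trans (le_of_eq ?_) ((summable_tailAt hN n y).sum_le_tsum 𝒵 fun Z _ => by
      split_ifs <;> positivity)
    exact Finset.sum_congr rfl fun Z hZ => by by_cases hy : y ∈ Z <;> simp [hy, h𝒵 Z hZ]
  have h1 : ∑ Z ∈ 𝒵, ‖Φ.term Z‖ * meets X Z ≤ ∑ x ∈ X, tailAt Φ n x := by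
    calc ∑ Z ∈ 𝒵, ‖Φ.term Z‖ * meets X Z
        ≤ ∑ Z ∈ 𝒵, ‖Φ.term Z‖ * ∑ x ∈ X, (if x ∈ Z then 1 else 0) :=
          Finset.sum_le_sum fun Z _ => mul_le_mul_of_nonneg_left
            (meets_comm X Z ▸ meets_le_sum Z X) (norm_nonneg _)
      _ = ∑ x ∈ X, ∑ Z ∈ 𝒵, ‖Φ.term Z‖ * (if x ∈ Z then 1 else 0) := by
          simp only [Finset.mul_sum]
          exact Finset.sum_comm
      _ ≤ _ := Finset.sum_le_sum fun x _ => htail x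
  have h2 : ∑ Z ∈ 𝒵, ‖Φ.term Z‖ * coupling h β X Z ≤
      ∑ x ∈ X, ∑' y : ℤ, decayF h β (siteDist x y) * tailAt Φ n y := by
    let U := 𝒵.biUnion id
    calc ∑ Z ∈ 𝒵, ‖Φ.term Z‖ * coupling h β X Z
        = ∑ Z ∈ 𝒵, ‖Φ.term Z‖ * ∑ x ∈ X, ∑ y ∈ U,
            (if y ∈ Z then 1 else 0) * decayF h β (siteDist x y) := by
          refine Finset.sum_congr rfl fun Z hZ => ?_
          congr 1
          refine Finset.sum_congr rfl fun x _ => ?_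
          simp only [ite_mul, one_mul, zero_mul]
          rw [← Finset.sum_filter]
          congr 1
          ext y
          simpa [U] using fun hy => ⟨Z, hZ, hy⟩
      _ = ∑ x ∈ X, ∑ y ∈ U, decayF h β (siteDist x y) *
            ∑ Z ∈ 𝒵, ‖Φ.term Z‖ * (if y ∈ Z then 1 else 0) := by
          simp only [Finset.mul_sum]
          rw [Finset.sum_comm]
          refine Finset.sum_congr rfl fun x _ => ?_
          rw [Finset.sum_comm]
          exact Finset.sum_congr rfl fun y _ => Finset.sum_congr rfl fun Z _ => by ring
      _ ≤ ∑ x ∈ X, ∑ y ∈ U, decayF h β (siteDist x y) * tailAt Φ n y :=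
          Finset.sum_le_sum fun x _ => Finset.sum_le_sum fun y _ =>
            mul_le_mul_of_nonneg_left (htail y) (decayF_pos _ _ _).le
      _ ≤ _ := Finset.sum_le_sum fun x _ =>
          (summable_decayF_mul_tailAt hβ hN n x).sum_le_tsum U fun y _ =>
            mul_nonneg (decayF_pos _ _ _).le (tailAt_nonneg _ _ _)
  have h3 : 0 ≤ ∑ Z ∈ 𝒵, ‖Φ.term Z‖ * coupling h β X Z :=
    Finset.sum_nonneg fun Z _ => mul_nonneg (norm_nonneg _) (coupling_nonneg _ _ _ _)
  calc ∑ Z ∈ 𝒵, ‖⁅Φ.term Z, heis (Φ.hamiltonian (box n)) s A⁆‖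
      ≤ ∑ Z ∈ 𝒵, 2 * ‖A‖ * ‖Φ.term Z‖ * (meets X Z + growth N C |s| * coupling h β X Z) :=
        Finset.sum_le_sum fun Z _ => by
          rw [norm_lie_comm]
          exact norm_lie_heis_le_growth hC hN (box n) hA (Φ.mem_localAlgebra Z) s
    _ = 2 * ‖A‖ * (∑ Z ∈ 𝒵, ‖Φ.term Z‖ * meets X Z +
          growth N C |s| * ∑ Z ∈ 𝒵, ‖Φ.term Z‖ * coupling h β X Z) := by
        simp only [Finset.mul_sum, ← Finset.sum_add_distrib]
        exact Finset.sum_congr rfl fun Z _ => by ring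
    _ ≤ 2 * ‖A‖ * (∑ x ∈ X, tailAt Φ n x +
          growth N C T * ∑ x ∈ X, ∑' y : ℤ, decayF h β (siteDist x y) * tailAt Φ n y) := by
        refine mul_le_mul_of_nonneg_left (add_le_add h1 ?_) (by positivity)
        exact mul_le_mul hg h2 h3 (hg0.trans hg)
    _ = _ := by unfold boundaryError; ring

end Tails

/-! ### Infinite-volume dynamics -/

section Dynamics
variable {d : ℕ} {h : ℝ≥0 → ℝ≥0} {β C : ℝ} {N : ℝ≥0} {Φ : Interaction d}

/-- Enlarging the box adds exactly the terms that leave the smaller box. -/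
theorem hamiltonian_box_sub {m n : ℕ} (hnm : n ≤ m) :
    Φ.hamiltonian (box m) - Φ.hamiltonian (box n) =
      ∑ Z ∈ (box m).powerset with ¬ Z ⊆ box n, Φ.term Z := by
  have e : (box n).powerset = (box m).powerset.filter fun Z => Z ⊆ box n := by
    ext Z
    simp only [Finset.mem_powerset, Finset.mem_filter]
    exact ⟨fun hZ => ⟨hZ.trans (box_mono hnm), hZ⟩, fun hZ => hZ.2⟩
  rw [Interaction.hamiltonian, Interaction.hamiltonian, e, sub_eq_iff_eq_add',
    Finset.sum_filter_add_sum_filter_not]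

theorem norm_heis_box_sub_le (hβ : 1 < β) (hC : IsConvolutionConstant h β C)
    (hN : Φ.decayNorm h β ≤ N) {m n : ℕ} (hnm : n ≤ m) {X : Finset ℤ} {A : QuasiLocal d}
    (hA : A ∈ localAlgebra d X) (t : ℝ) :
    ‖heis (Φ.hamiltonian (box m)) t A - heis (Φ.hamiltonian (box n)) t A‖ ≤
      |t| * (‖A‖ * boundaryError Φ h β C N X |t| n) := by
  refine norm_heis_sub_heis_le (isSelfAdjoint_hamiltonian Φ _) A fun s hs => ?_
  rw [hamiltonian_box_sub hnm, Ring.lie_def, Finset.sum_mul, Finset.mul_sum,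
    ← Finset.sum_sub_distrib]
  exact (norm_sum_le _ _).trans
    (sum_norm_lie_heis_le hβ hC hN n hA hs _ fun Z hZ => (Finset.mem_filter.1 hZ).2)

/-- The local dynamics converge, first on local observables and then by density. -/
theorem cauchySeq_heis_box (hβ : 1 < β) (hC : IsConvolutionConstant h β C)
    (hN : Φ.decayNorm h β ≤ N) (t : ℝ) (A : QuasiLocal d) :
    CauchySeq fun n => heis (Φ.hamiltonian (box n)) t A := by
  rw [Metric.cauchySeq_iff']
  intro ε hε
  obtain ⟨X, B, hB, hAB⟩ := exists_localAlgebra_norm_sub_lt A (half_pos (half_pos hε))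
  have hlim : Tendsto (fun n => |t| * (‖B‖ * boundaryError Φ h β C N X |t| n)) atTop (𝓝 0) := by
    simpa using ((tendsto_boundaryError hβ hN C X |t|).const_mul ‖B‖).const_mul |t|
  obtain ⟨n, hn⟩ := (hlim.eventually_lt_const (half_pos hε)).exists
  refine ⟨n, fun m hm => ?_⟩
  have h1 := norm_heis_box_sub_le hβ hC hN hm hB t
  have h2 := norm_heis (isSelfAdjoint_hamiltonian Φ (box m)) t (A - B)
  have h3 := norm_heis (isSelfAdjoint_hamiltonian Φ (box n)) t (A - B)
  have e : heis (Φ.hamiltonian (box m)) t A - heis (Φ.hamiltonian (box n)) t A =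
      heis (Φ.hamiltonian (box m)) t (A - B) +
      (heis (Φ.hamiltonian (box m)) t B - heis (Φ.hamiltonian (box n)) t B) -
      heis (Φ.hamiltonian (box n)) t (A - B) := by
    simp only [heis_sub]; abel
  rw [dist_eq_norm, e]
  have h4 := norm_sub_le (heis (Φ.hamiltonian (box m)) t (A - B) +
      (heis (Φ.hamiltonian (box m)) t B - heis (Φ.hamiltonian (box n)) t B))
      (heis (Φ.hamiltonian (box n)) t (A - B))
  have h5 := norm_add_le (heis (Φ.hamiltonian (box m)) t (A - B))
      (heis (Φ.hamiltonian (box m)) t B - heis (Φ.hamiltonian (box n)) t B)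
  linarith

/-- The limit in the definition of the dynamics exists for every observable. -/
def HasDynamics (Φ : Interaction d) : Prop :=
  ∀ (t : ℝ) (A : QuasiLocal d),
    Tendsto (fun n => heis (Φ.hamiltonian (box n)) t A) atTop (𝓝 (Φ.dynamics t A))

theorem hasDynamics (hβ : 1 < β) (hC : IsConvolutionConstant h β C)
    (hN : Φ.decayNorm h β ≤ N) : HasDynamics Φ := fun t A => by
  have := tendsto_nhds_limUnder (cauchySeq_tendsto_of_complete (cauchySeq_heis_box hβ hC hN t A))
  have e : Φ.dynamics t A = limUnder atTop fun n => heis (Φ.hamiltonian (box n)) t A := by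
    simp only [Interaction.dynamics, localDynamics_eq_heis, box]
  rwa [e]

namespace HasDynamics

theorem dynamics_zero (hτ : HasDynamics Φ) (A : QuasiLocal d) : Φ.dynamics 0 A = A :=
  tendsto_nhds_unique (hτ 0 A) (by simp)

theorem dynamics_sub (hτ : HasDynamics Φ) (t : ℝ) (A B : QuasiLocal d) :
    Φ.dynamics t (A - B) = Φ.dynamics t A - Φ.dynamics t B :=
  tendsto_nhds_unique (hτ t (A - B)) (by simpa only [heis_sub] using (hτ t A).sub (hτ t B))

theorem dynamics_add (hτ : HasDynamics Φ) (t : ℝ) (A B : QuasiLocal d) :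
    Φ.dynamics t (A + B) = Φ.dynamics t A + Φ.dynamics t B :=
  tendsto_nhds_unique (hτ t (A + B)) (by simpa only [heis_add] using (hτ t A).add (hτ t B))

theorem dynamics_smul (hτ : HasDynamics Φ) (t : ℝ) (c : ℂ) (A : QuasiLocal d) :
    Φ.dynamics t (c • A) = c • Φ.dynamics t A :=
  tendsto_nhds_unique (hτ t (c • A)) (by simpa only [heis_smul] using (hτ t A).const_smul c)

theorem dynamics_mul (hτ : HasDynamics Φ) (t : ℝ) (A B : QuasiLocal d) :
    Φ.dynamics t (A * B) = Φ.dynamics t A * Φ.dynamics t B :=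
  tendsto_nhds_unique (hτ t (A * B)) (by simpa only [heis_mul] using (hτ t A).mul (hτ t B))

theorem dynamics_one (hτ : HasDynamics Φ) (t : ℝ) : Φ.dynamics t 1 = 1 :=
  tendsto_nhds_unique (hτ t 1) (by simp [heis_one])

theorem dynamics_star (hτ : HasDynamics Φ) (t : ℝ) (A : QuasiLocal d) :
    Φ.dynamics t (star A) = star (Φ.dynamics t A) :=
  tendsto_nhds_unique (hτ t (star A)) (by
    simpa only [star_heis (isSelfAdjoint_hamiltonian Φ _)] using (hτ t A).star)

theorem norm_dynamics (hτ : HasDynamics Φ) (t : ℝ) (A : QuasiLocal d) : ‖Φ.dynamics t A‖ = ‖A‖ :=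
  tendsto_nhds_unique (hτ t A).norm (by simp [norm_heis (isSelfAdjoint_hamiltonian Φ _)])

theorem dynamics_add_time (hτ : HasDynamics Φ) (s t : ℝ) (A : QuasiLocal d) :
    Φ.dynamics (s + t) A = Φ.dynamics s (Φ.dynamics t A) := by
  refine tendsto_nhds_unique (hτ (s + t) A) ?_
  have h1 : Tendsto (fun n => heis (Φ.hamiltonian (box n)) s
      (heis (Φ.hamiltonian (box n)) t A - Φ.dynamics t A)) atTop (𝓝 0) := by
    rw [tendsto_zero_iff_norm_tendsto_zero]
    simp only [norm_heis (isSelfAdjoint_hamiltonian Φ _)]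
    exact tendsto_iff_norm_sub_tendsto_zero.1 (hτ t A)
  have h2 := h1.add (hτ s (Φ.dynamics t A))
  rw [zero_add] at h2
  refine h2.congr fun n => ?_
  rw [heis_sub, sub_add_cancel, heis_add_time]

end HasDynamics

/-- Only the interaction terms that meet the support of `A` contribute. -/
theorem summable_norm_lie_term (hN : Φ.decayNorm h β ≤ N) {X : Finset ℤ} {A : QuasiLocal d}
    (hA : A ∈ localAlgebra d X) : Summable fun Z : Finset ℤ => ‖⁅Φ.term Z, A⁆‖ := by
  have h1 : Summable fun Z : Finset ℤ =>
      2 * ‖A‖ * ∑ x ∈ X, if x ∈ Z then ‖Φ.term Z‖ else 0 :=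
    (summable_sum fun x _ => summable_norm_term hN x).mul_left _
  refine Summable.of_nonneg_of_le (fun _ => norm_nonneg _) (fun Z => ?_) h1
  by_cases hd : Disjoint Z X
  · rw [lie_eq_zero_of_disjoint hd (Φ.mem_localAlgebra Z) hA, norm_zero]
    refine mul_nonneg (by positivity) (Finset.sum_nonneg fun x _ => ?_)
    split_ifs <;> positivity
  · obtain ⟨z, hzZ, hzX⟩ := Finset.not_disjoint_iff.1 hd
    have h2 : ‖Φ.term Z‖ ≤ ∑ x ∈ X, if x ∈ Z then ‖Φ.term Z‖ else 0 := by
      calc ‖Φ.term Z‖ = if z ∈ Z then ‖Φ.term Z‖ else 0 := by simp [hzZ]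
        _ ≤ _ := Finset.single_le_sum (f := fun x => if x ∈ Z then ‖Φ.term Z‖ else 0)
          (fun _ _ => by split_ifs <;> positivity) hzX
    calc ‖⁅Φ.term Z, A⁆‖ ≤ 2 * ‖Φ.term Z‖ * ‖A‖ := norm_lie_le _ _
      _ = 2 * ‖A‖ * ‖Φ.term Z‖ := by ring
      _ ≤ _ := mul_le_mul_of_nonneg_left h2 (by positivity)

theorem derivation_eq (Φ : Interaction d) (A : QuasiLocal d) :
    Φ.derivation A = Complex.I • ∑' Z : Finset ℤ, ⁅Φ.term Z, A⁆ := rfl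

theorem lie_hamiltonian (Φ : Interaction d) (Λ : Finset ℤ) (A : QuasiLocal d) :
    ⁅Φ.hamiltonian Λ, A⁆ = ∑ Z ∈ Λ.powerset, ⁅Φ.term Z, A⁆ := by
  simp only [Interaction.hamiltonian, Ring.lie_def, Finset.sum_mul, Finset.mul_sum,
    Finset.sum_sub_distrib]

theorem tendsto_lie_hamiltonian_box (hN : Φ.decayNorm h β ≤ N) {X : Finset ℤ}
    {A : QuasiLocal d} (hA : A ∈ localAlgebra d X) :
    Tendsto (fun n => Complex.I • ⁅Φ.hamiltonian (box n), A⁆) atTop (𝓝 (Φ.derivation A)) := by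
  simp only [lie_hamiltonian]
  exact ((summable_norm_lie_term hN hA).of_norm.hasSum.comp tendsto_powerset_box).const_smul _

theorem norm_lie_hamiltonian_le (hN : Φ.decayNorm h β ≤ N) {X : Finset ℤ}
    {A : QuasiLocal d} (hA : A ∈ localAlgebra d X) (Λ : Finset ℤ) :
    ‖⁅Φ.hamiltonian Λ, A⁆‖ ≤ ∑' Z : Finset ℤ, ‖⁅Φ.term Z, A⁆‖ := by
  rw [lie_hamiltonian]
  exact (norm_sum_le _ _).trans
    ((summable_norm_lie_term hN hA).sum_le_tsum _ fun _ _ => norm_nonneg _)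

/-- Local observables are differentiable along the dynamics, with derivative `δ`. -/
theorem hasDerivAt_dynamics_zero (hτ : HasDynamics Φ) (hN : Φ.decayNorm h β ≤ N)
    {X : Finset ℤ} {B : QuasiLocal d} (hB : B ∈ localAlgebra d X) :
    HasDerivAt (fun t => Φ.dynamics t B) (Φ.derivation B) 0 := by
  rw [hasDerivAt_iff_isLittleO, Asymptotics.isLittleO_iff]
  intro ε hε
  obtain ⟨W, D, hD, hBD⟩ := exists_localAlgebra_norm_sub_lt (Φ.derivation B)
    (show 0 < ε / 4 by positivity)
  set c := ∑' Z : Finset ℤ, ‖⁅Φ.term Z, D⁆‖ with hc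
  have hc0 : 0 ≤ c := tsum_nonneg fun _ => norm_nonneg _
  have hev : ∀ᶠ t : ℝ in 𝓝 0, |t| * c < ε / 2 := by
    have : Tendsto (fun t : ℝ => |t| * c) (𝓝 0) (𝓝 (|0| * c)) :=
      (continuous_abs.mul continuous_const).tendsto 0
    rw [abs_zero, zero_mul] at this
    exact this.eventually_lt_const (half_pos hε)
  filter_upwards [hev] with t ht
  have hlim1 : Tendsto (fun n => ‖heis (Φ.hamiltonian (box n)) t B - B -
      t • (Complex.I • ⁅Φ.hamiltonian (box n), B⁆)‖) atTop
      (𝓝 ‖Φ.dynamics t B - B - t • Φ.derivation B‖) :=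
    (((hτ t B).sub_const B).sub ((tendsto_lie_hamiltonian_box hN hB).const_smul t)).norm
  have hlim2 : Tendsto (fun n => |t| * (2 * ‖Complex.I • ⁅Φ.hamiltonian (box n), B⁆ - D‖ + |t| * c))
      atTop (𝓝 (|t| * (2 * ‖Φ.derivation B - D‖ + |t| * c))) :=
    (((((tendsto_lie_hamiltonian_box hN hB).sub_const D).norm).const_mul 2).add_const _).const_mul _
  have key := le_of_tendsto_of_tendsto' hlim1 hlim2 fun n =>
    (norm_heis_sub_sub_le (isSelfAdjoint_hamiltonian Φ (box n)) B D t).trans (by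
      have := norm_lie_hamiltonian_le hN hD (box n)
      gcongr)
  rw [hτ.dynamics_zero, sub_zero, Real.norm_eq_abs, mul_comm ε]
  refine key.trans (mul_le_mul_of_nonneg_left ?_ (abs_nonneg _))
  linarith

/-- The Lieb–Robinson bound in infinite volume, for disjoint supports. -/
theorem norm_lie_dynamics_le (hτ : HasDynamics Φ) (hC : IsConvolutionConstant h β C)
    (hN : Φ.decayNorm h β ≤ N) {X Y : Finset ℤ} (hXY : Disjoint X Y) {A B : QuasiLocal d}
    (hA : A ∈ localAlgebra d X) (hB : B ∈ localAlgebra d Y) (t : ℝ) :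
    ‖⁅A, Φ.dynamics t B⁆‖ ≤ 2 * ‖A‖ * ‖B‖ * (growth N C |t| * coupling h β X Y) := by
  have hlim : Tendsto (fun n => ‖⁅A, heis (Φ.hamiltonian (box n)) t B⁆‖) atTop
      (𝓝 ‖⁅A, Φ.dynamics t B⁆‖) :=
    (((hτ t B).const_mul A).sub ((hτ t B).mul_const A)).norm
  refine le_of_tendsto' hlim fun n => ?_
  rw [norm_lie_comm]
  refine (norm_lie_heis_le_growth hC hN (box n) hB hA t).trans (le_of_eq ?_)
  rw [meets, if_pos hXY.symm, zero_add, coupling_comm]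
  ring

end Dynamics

/-! ### Ground states and their GNS unitaries -/

section GroundState
variable {d : ℕ} {h : ℝ≥0 → ℝ≥0} {β C : ℝ} {N : ℝ≥0} {Φ : Interaction d}
  {ω : QuasiLocal d →ₚ[ℂ] ℂ}

theorem inner_gnsVec (ω : QuasiLocal d →ₚ[ℂ] ℂ) (A B : QuasiLocal d) :
    inner ℂ (gnsVec ω A) (gnsVec ω B) = ω (star A * B) := by
  rw [gnsVec, gnsVec, UniformSpace.Completion.inner_coe, PositiveLinearMap.preGNS_inner_def]
  rfl

theorem norm_gnsVec_sq (ω : QuasiLocal d →ₚ[ℂ] ℂ) (A : QuasiLocal d) :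
    ((‖gnsVec ω A‖ ^ 2 : ℝ) : ℂ) = ω (star A * A) := by
  rw [Complex.ofReal_pow, ← Complex.coe_algebraMap, ← inner_self_eq_norm_sq_to_K (𝕜 := ℂ),
    inner_gnsVec]

theorem gnsVec_sub (ω : QuasiLocal d →ₚ[ℂ] ℂ) (A B : QuasiLocal d) :
    gnsVec ω (A - B) = gnsVec ω A - gnsVec ω B := by
  rw [gnsVec, map_sub, UniformSpace.Completion.coe_sub]; rfl

theorem gnsVec_smul (ω : QuasiLocal d →ₚ[ℂ] ℂ) (c : ℂ) (A : QuasiLocal d) :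
    gnsVec ω (c • A) = c • gnsVec ω A := by
  rw [gnsVec, map_smul, UniformSpace.Completion.coe_smul]; rfl

theorem norm_gnsVec_le (h1 : ω 1 = 1) (A : QuasiLocal d) : ‖gnsVec ω A‖ ≤ ‖A‖ := by
  have hle : star A * A ≤ ((‖A‖ ^ 2 : ℝ) : ℂ) • (1 : QuasiLocal d) := by
    have := CStarAlgebra.star_mul_le_algebraMap_norm_sq (a := A)
    rwa [Algebra.algebraMap_eq_smul_one, ← Complex.coe_smul] at this
  have h2 : ω (star A * A) ≤ ((‖A‖ ^ 2 : ℝ) : ℂ) := by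
    have := OrderHomClass.mono ω hle
    rwa [map_smul, h1, smul_eq_mul, mul_one] at this
  have h3 : ((‖gnsVec ω A‖ ^ 2 : ℝ) : ℂ) ≤ ((‖A‖ ^ 2 : ℝ) : ℂ) := by
    rw [norm_gnsVec_sq]
    exact h2
  exact le_of_sq_le_sq (Complex.real_le_real.1 h3) (norm_nonneg _)

theorem norm_state_le (h1 : ω 1 = 1) (A : QuasiLocal d) : ‖ω A‖ ≤ ‖A‖ := by
  have e : ω A = inner ℂ (gnsVec ω 1) (gnsVec ω A) := by rw [inner_gnsVec]; simp
  have h2 : ‖gnsVec ω 1‖ = 1 := by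
    have : ((‖gnsVec ω 1‖ ^ 2 : ℝ) : ℂ) = 1 := by
      rw [norm_gnsVec_sq]
      simpa using h1
    have h3 : ‖gnsVec ω 1‖ ^ 2 = 1 := by exact_mod_cast this
    exact (pow_eq_one_iff_of_nonneg (norm_nonneg _) two_ne_zero).1 h3
  rw [e]
  refine (norm_inner_le_norm _ _).trans ?_
  rw [h2, one_mul]
  exact norm_gnsVec_le h1 A

/-- A state as a bounded functional. -/
def stateCLM (ω : QuasiLocal d →ₚ[ℂ] ℂ) (h1 : ω 1 = 1) : QuasiLocal d →L[ℂ] ℂ :=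
  LinearMap.mkContinuous (ω : QuasiLocal d →ₗ[ℂ] ℂ) 1 fun A => by
    rw [one_mul]; exact norm_state_le h1 A

/-- The generator vanishes in a ground state: the ground state inequality for `A + c`, `c ∈ ℂ`, is
affine in `c`. -/
theorem IsGroundState.apply_derivation (hω : IsGroundState Φ ω) {X : Finset ℤ}
    {A : QuasiLocal d} (hA : A ∈ localAlgebra d X) : ω (Φ.derivation A) = 0 := by
  by_contra hw
  set z := -Complex.I * ω (star A * Φ.derivation A)
  set w := -Complex.I * ω (Φ.derivation A) with hwdef
  have hw0 : w ≠ 0 := mul_ne_zero (neg_ne_zero.2 Complex.I_ne_zero) hw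
  have key : ∀ c : ℂ, 0 ≤ z + c * w := by
    intro c
    have h2 := hω.2 X (A + star c • 1) (add_mem hA (SMulMemClass.smul_mem _ (one_mem _)))
    have h3 : Φ.derivation (A + star c • 1) = Φ.derivation A := by
      rw [derivation_eq, derivation_eq]
      simp [Ring.lie_def, mul_add, add_mul]
    rw [h3, star_add, star_smul, star_star, star_one, add_mul, smul_mul_assoc, one_mul, map_add,
      map_smul, smul_eq_mul] at h2
    convert h2 using 1
    simp only [z, w]
    ring
  -- This choice of `c` gives the value `-1`.
  have := key (-(z + 1) / w)
  rw [div_mul_cancel₀ _ hw0] at this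
  norm_num at this

/-- A ground state is almost invariant under the dynamics of a large box. The derivative of
`ω(τ^{[-n,n]}_s(A))` is `ω(i[H_{[-n,n]}, a])`, `a = τ^{[-n,n]}_s(A)`. As `ω(δ(a)) = 0`, only the
interaction terms that leave the box contribute. -/
theorem IsGroundState.norm_apply_heis_sub_le (hω : IsGroundState Φ ω) (hβ : 1 < β)
    (hC : IsConvolutionConstant h β C) (hN : Φ.decayNorm h β ≤ N) {X : Finset ℤ}
    {A : QuasiLocal d} (hA : A ∈ localAlgebra d X) (t : ℝ) (n : ℕ) :
    ‖ω (heis (Φ.hamiltonian (box n)) t A) - ω A‖ ≤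
      ‖A‖ * boundaryError Φ h β C N X |t| n * |t| := by
  set H := Φ.hamiltonian (box n)
  have hderiv : ∀ s, HasDerivAt (fun s => ω (heis H s A)) (ω (heis H s (Complex.I • ⁅H, A⁆))) s :=
    fun s => ((stateCLM ω hω.1).restrictScalars ℝ).hasFDerivAt.comp_hasDerivAt s
      (hasDerivAt_heis H s A)
  have hbound : ∀ s, |s| ≤ |t| → ‖ω (heis H s (Complex.I • ⁅H, A⁆))‖ ≤
      ‖A‖ * boundaryError Φ h β C N X |t| n := by
    intro s hs
    set a := heis H s A
    have ha : a ∈ localAlgebra d (X ∪ box n) :=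
      heis_mem_localAlgebra
        (localAlgebra_mono Finset.subset_union_right (hamiltonian_mem_localAlgebra Φ _))
        (localAlgebra_mono Finset.subset_union_left hA) s
    have e : heis H s (Complex.I • ⁅H, A⁆) = Complex.I • ⁅H, a⁆ := by
      have : Commute H (propagator H s) := commute_propagator (Commute.refl H) s
      rw [heis_smul, heis_lie]
      congr 2
      rw [heis, ← this.eq, mul_assoc, propagator_mul_neg, mul_one]
    have hlim : Tendsto (fun m => ‖ω (Complex.I • ⁅Φ.hamiltonian (box m), a⁆) -
        ω (Complex.I • ⁅H, a⁆)‖) atTop (𝓝 ‖ω (Φ.derivation a) - ω (Complex.I • ⁅H, a⁆)‖) :=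
      ((((stateCLM ω hω.1).continuous.tendsto _).comp
        (tendsto_lie_hamiltonian_box hN ha)).sub_const _).norm
    rw [hω.apply_derivation ha, zero_sub, norm_neg] at hlim
    rw [e]
    refine le_of_tendsto hlim ?_
    filter_upwards [eventually_ge_atTop n] with m hm
    rw [← map_sub, ← smul_sub]
    refine (norm_state_le hω.1 _).trans ?_
    rw [norm_smul, Complex.norm_I, one_mul]
    have e2 : ⁅Φ.hamiltonian (box m), a⁆ - ⁅H, a⁆ = ⁅Φ.hamiltonian (box m) - H, a⁆ := by
      simp only [Ring.lie_def, sub_mul, mul_sub]; abel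
    rw [e2, hamiltonian_box_sub hm, Ring.lie_def, Finset.sum_mul, Finset.mul_sum,
      ← Finset.sum_sub_distrib]
    exact (norm_sum_le _ _).trans
      (sum_norm_lie_heis_le hβ hC hN n hA hs _ fun Z hZ => (Finset.mem_filter.1 hZ).2)
  have key := (convex_Icc (-|t|) |t|).norm_image_sub_le_of_norm_hasDerivWithin_le
    (f := fun s => ω (heis H s A)) (fun x _ => (hderiv x).hasDerivWithinAt)
    (fun x hx => hbound x (abs_le.2 hx))
    (Set.mem_Icc.2 ⟨by simp, by simp⟩ : (0 : ℝ) ∈ Set.Icc (-|t|) |t|)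
    (Set.mem_Icc.2 ⟨neg_abs_le t, le_abs_self t⟩)
  simpa using key

/-- A ground state is invariant under the dynamics. -/
theorem IsGroundState.apply_dynamics (hω : IsGroundState Φ ω) (hβ : 1 < β)
    (hC : IsConvolutionConstant h β C) (hN : Φ.decayNorm h β ≤ N) (t : ℝ) (A : QuasiLocal d) :
    ω (Φ.dynamics t A) = ω A := by
  have hτ := hasDynamics hβ hC hN
  have hlocal : ∀ X : Finset ℤ, ∀ B ∈ localAlgebra d X, ω (Φ.dynamics t B) = ω B := by
    intro X B hB
    have h1 : Tendsto (fun n => ‖ω (heis (Φ.hamiltonian (box n)) t B) - ω B‖) atTop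
        (𝓝 ‖ω (Φ.dynamics t B) - ω B‖) :=
      ((((stateCLM ω hω.1).continuous.tendsto _).comp (hτ t B)).sub_const _).norm
    have h2 : Tendsto (fun n => ‖B‖ * boundaryError Φ h β C N X |t| n * |t|) atTop (𝓝 0) := by
      simpa using ((tendsto_boundaryError hβ hN C X |t|).const_mul ‖B‖).mul_const |t|
    have h3 := le_of_tendsto_of_tendsto' h1 h2 fun n =>
      hω.norm_apply_heis_sub_le hβ hC hN hB t n
    exact sub_eq_zero.1 (norm_le_zero_iff.1 h3)
  refine eq_of_forall_dist_le fun ε hε => ?_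
  obtain ⟨X, B, hB, hAB⟩ := exists_localAlgebra_norm_sub_lt A (half_pos hε)
  have e : ω (Φ.dynamics t A) - ω A = ω (Φ.dynamics t (A - B)) - ω (A - B) := by
    rw [hτ.dynamics_sub, map_sub, map_sub, hlocal X B hB]; ring
  rw [dist_eq_norm, e]
  have h1 := norm_state_le hω.1 (Φ.dynamics t (A - B))
  rw [hτ.norm_dynamics] at h1
  have h2 := norm_state_le hω.1 (A - B)
  have h3 := norm_sub_le (ω (Φ.dynamics t (A - B))) (ω (A - B))
  linarith

/-- For an invariant state, `π_ω(A) Ω ↦ π_ω(τ_t(A)) Ω` is isometric and extends to the GNS space,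
so the operator chosen in `gnsUnitary` has its defining property. -/
theorem gnsUnitary_gnsVec (hτ : HasDynamics Φ) (hinv : ∀ t A, ω (Φ.dynamics t A) = ω A)
    (t : ℝ) (A : QuasiLocal d) : gnsUnitary Φ ω t (gnsVec ω A) = gnsVec ω (Φ.dynamics t A) := by
  let τ : QuasiLocal d →ₗ[ℂ] QuasiLocal d :=
    { toFun := Φ.dynamics t
      map_add' := hτ.dynamics_add t
      map_smul' := hτ.dynamics_smul t }
  let u : ω.PreGNS →L[ℂ] ω.PreGNS :=
    (ω.toPreGNS.toLinearMap ∘ₗ τ ∘ₗ ω.ofPreGNS.toLinearMap).mkContinuous 1 fun x => by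
      rw [one_mul, PositiveLinearMap.preGNS_norm_def, PositiveLinearMap.preGNS_norm_def]
      have : star (Φ.dynamics t (ω.ofPreGNS x)) * Φ.dynamics t (ω.ofPreGNS x) =
          Φ.dynamics t (star (ω.ofPreGNS x) * ω.ofPreGNS x) := by
        rw [hτ.dynamics_mul, hτ.dynamics_star]
      refine le_of_eq ?_
      change √(ω (star (Φ.dynamics t (ω.ofPreGNS x)) * Φ.dynamics t (ω.ofPreGNS x))).re = _
      rw [this, hinv]
  have hex : ∃ U : ω.GNS →L[ℂ] ω.GNS,
      ∀ A : QuasiLocal d, U (gnsVec ω A) = gnsVec ω (Φ.dynamics t A) :=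
    ⟨u.completion, fun A => ContinuousLinearMap.completion_apply_coe u (ω.toPreGNS A)⟩
  exact Classical.epsilon_spec hex A

theorem gns_induction {p : ω.GNS → Prop} (hp : IsClosed {ψ | p ψ}) (h : ∀ A, p (gnsVec ω A))
    (ψ : ω.GNS) : p ψ :=
  UniformSpace.Completion.induction_on ψ hp fun a => h (ω.ofPreGNS a)

theorem gnsUnitary_zero (hτ : HasDynamics Φ) (hinv : ∀ t A, ω (Φ.dynamics t A) = ω A)
    (ψ : ω.GNS) : gnsUnitary Φ ω 0 ψ = ψ := by
  refine gns_induction (p := fun ψ => gnsUnitary Φ ω 0 ψ = ψ)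
    (isClosed_eq (by fun_prop) (by fun_prop)) (fun A => ?_) ψ
  rw [gnsUnitary_gnsVec hτ hinv, hτ.dynamics_zero]

theorem gnsUnitary_add (hτ : HasDynamics Φ) (hinv : ∀ t A, ω (Φ.dynamics t A) = ω A) (s t : ℝ)
    (ψ : ω.GNS) : gnsUnitary Φ ω (s + t) ψ = gnsUnitary Φ ω s (gnsUnitary Φ ω t ψ) := by
  refine gns_induction (p := fun ψ => gnsUnitary Φ ω (s + t) ψ =
    gnsUnitary Φ ω s (gnsUnitary Φ ω t ψ))
    (isClosed_eq (by fun_prop) (by fun_prop)) (fun A => ?_) ψ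
  simp only [gnsUnitary_gnsVec hτ hinv, hτ.dynamics_add_time]

theorem norm_gnsUnitary (hτ : HasDynamics Φ) (hinv : ∀ t A, ω (Φ.dynamics t A) = ω A) (t : ℝ)
    (ψ : ω.GNS) : ‖gnsUnitary Φ ω t ψ‖ = ‖ψ‖ := by
  refine gns_induction (p := fun ψ => ‖gnsUnitary Φ ω t ψ‖ = ‖ψ‖)
    (isClosed_eq (by fun_prop) (by fun_prop)) (fun A => ?_) ψ
  have h1 : ((‖gnsVec ω (Φ.dynamics t A)‖ ^ 2 : ℝ) : ℂ) = ((‖gnsVec ω A‖ ^ 2 : ℝ) : ℂ) := by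
    rw [norm_gnsVec_sq, norm_gnsVec_sq, ← hτ.dynamics_star, ← hτ.dynamics_mul, hinv]
  rw [gnsUnitary_gnsVec hτ hinv]
  exact (pow_left_inj₀ (norm_nonneg _) (norm_nonneg _) two_ne_zero).1 (by exact_mod_cast h1)

/-- Local observables applied to the GNS vector lie in the domain of the generator. -/
theorem isGenerated_gnsVec (hτ : HasDynamics Φ) (hinv : ∀ t A, ω (Φ.dynamics t A) = ω A)
    (h1 : ω 1 = 1) (hN : Φ.decayNorm h β ≤ N) {X : Finset ℤ} {B : QuasiLocal d}
    (hB : B ∈ localAlgebra d X) :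
    ∃ φ, IsGenerated (gnsUnitary Φ ω) (gnsVec ω B) φ := by
  let V : QuasiLocal d →L[ℂ] ω.GNS := LinearMap.mkContinuous
    { toFun := gnsVec ω
      map_add' := fun A B => by rw [gnsVec, map_add, UniformSpace.Completion.coe_add]; rfl
      map_smul' := gnsVec_smul ω } 1 fun A => by
        rw [one_mul]; exact norm_gnsVec_le h1 A
  refine ⟨V ((Complex.I)⁻¹ • Φ.derivation B), ?_⟩
  have h2 := (hasDerivAt_iff_tendsto_slope.1 (hasDerivAt_dynamics_zero hτ hN hB)).const_smul
    (Complex.I)⁻¹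
  refine ((V.continuous.tendsto _).comp h2).congr fun t => ?_
  simp only [Function.comp_apply, slope_def_module, sub_zero]
  rw [hτ.dynamics_zero, gnsUnitary_gnsVec hτ hinv, ← gnsVec_sub, ← gnsVec_smul, mul_inv, mul_smul]
  change gnsVec ω _ = _
  congr 2
  rw [← Complex.coe_smul, Complex.ofReal_inv]

end GroundState

/-! ### Gaussian integrals -/

section Gaussian
open MeasureTheory Set

theorem integrableOn_gaussian {b : ℝ} (hb : 0 < b) (s : Set ℝ) :
    IntegrableOn (fun x : ℝ => Real.exp (-b * x ^ 2)) s :=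
  (integrable_exp_neg_mul_sq hb).integrableOn

/-- The Gaussian tail bound. -/
theorem integral_Ioi_gaussian_le {b a : ℝ} (hb : 0 < b) (ha : 0 ≤ a) :
    ∫ x in Ioi a, Real.exp (-b * x ^ 2) ≤ Real.exp (-b * a ^ 2) * (√(Real.pi / b) / 2) := by
  have h1 : ∫ x in Ioi a, Real.exp (-b * x ^ 2) =
      ∫ x in Ioi (0 : ℝ), Real.exp (-b * (x + a) ^ 2) := by
    have := (measurePreserving_add_right volume a).setIntegral_preimage_emb
      (measurableEmbedding_addRight a) (fun x : ℝ => Real.exp (-b * x ^ 2)) (Ioi a)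
    simpa using this.symm
  rw [h1, ← integral_gaussian_Ioi, ← integral_const_mul]
  refine integral_mono_of_nonneg (Eventually.of_forall fun x => (Real.exp_pos _).le)
    ((integrableOn_gaussian hb _).const_mul _) ?_
  refine (ae_restrict_iff' measurableSet_Ioi).2 (Eventually.of_forall fun x hx => ?_)
  simp only
  rw [← Real.exp_add]
  refine Real.exp_le_exp.2 ?_
  have : 0 ≤ b * (x * a) := by have := mem_Ioi.1 hx; positivity
  nlinarith

/-- The normalised error function `(πα)^{-1/2} ∫_0^λ e^{-s²/4α} ds`. -/
def gaussErf (α l : ℝ) : ℝ :=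
  (√(Real.pi * α))⁻¹ * ∫ s in (0 : ℝ)..l, Real.exp (-(1 / (4 * α)) * s ^ 2)

theorem gaussErf_zero (α : ℝ) : gaussErf α 0 = 0 := by simp [gaussErf]

theorem continuous_gaussErf (α : ℝ) : Continuous (gaussErf α) :=
  continuous_const.mul (intervalIntegral.continuous_primitive
    (fun _ _ => (by fun_prop : Continuous fun s : ℝ =>
      Real.exp (-(1 / (4 * α)) * s ^ 2)).intervalIntegrable _ _) 0)

theorem sqrt_pi_div_inv_four {α : ℝ} : √(Real.pi / (1 / (4 * α))) / 2 = √(Real.pi * α) := by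
  rw [show Real.pi / (1 / (4 * α)) = 2 ^ 2 * (Real.pi * α) by field_simp; ring,
    Real.sqrt_mul (by positivity), Real.sqrt_sq (by positivity)]
  ring

theorem one_sub_gaussErf {α : ℝ} (hα : 0 < α) (l : ℝ) :
    1 - gaussErf α l =
      (√(Real.pi * α))⁻¹ * ∫ s in Ioi l, Real.exp (-(1 / (4 * α)) * s ^ 2) := by
  have hb : 0 < 1 / (4 * α) := by positivity
  have hpos : 0 < √(Real.pi * α) := Real.sqrt_pos.2 (by positivity)
  have h1 := intervalIntegral.integral_interval_add_Ioi
    (integrableOn_gaussian hb (Ioi 0)) (integrableOn_gaussian hb (Ioi l))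
  rw [integral_gaussian_Ioi, sqrt_pi_div_inv_four] at h1
  rw [gaussErf, eq_comm, eq_sub_iff_add_eq', ← mul_add, h1, inv_mul_cancel₀ hpos.ne']

theorem one_sub_gaussErf_nonneg {α : ℝ} (hα : 0 < α) (l : ℝ) : 0 ≤ 1 - gaussErf α l := by
  rw [one_sub_gaussErf hα]
  exact mul_nonneg (by positivity) (integral_nonneg fun _ => (Real.exp_pos _).le)

theorem one_sub_gaussErf_le {α l : ℝ} (hα : 0 < α) (hl : 0 ≤ l) :
    1 - gaussErf α l ≤ Real.exp (-(1 / (4 * α)) * l ^ 2) := by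
  have hb : 0 < 1 / (4 * α) := by positivity
  have hpos : 0 < √(Real.pi * α) := Real.sqrt_pos.2 (by positivity)
  rw [one_sub_gaussErf hα]
  have h1 := integral_Ioi_gaussian_le hb hl
  rw [sqrt_pi_div_inv_four] at h1
  calc _ ≤ (√(Real.pi * α))⁻¹ * (Real.exp (-(1 / (4 * α)) * l ^ 2) * √(Real.pi * α)) :=
        mul_le_mul_of_nonneg_left h1 (by positivity)
    _ = _ := by field_simp

/-- The cosine transform of a Gaussian, the real part of its Fourier transform. -/
theorem integral_Ioi_gaussian_mul_cos {α : ℝ} (hα : 0 < α) (s : ℝ) :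
    ∫ t in Ioi (0 : ℝ), Real.exp (-α * t ^ 2) * Real.cos (s * t) =
      √(Real.pi / α) / 2 * Real.exp (-(1 / (4 * α)) * s ^ 2) := by
  have h1 := fourierIntegral_gaussian (b := (α : ℂ)) (by simpa using hα) s
  have h2 : ∀ t : ℝ, (Complex.exp (Complex.I * s * t) * Complex.exp (-α * t ^ 2)).re =
      Real.exp (-α * t ^ 2) * Real.cos (s * t) := by
    intro t
    rw [show -(α : ℂ) * t ^ 2 = ((-α * t ^ 2 : ℝ) : ℂ) by push_cast; ring,
      show Complex.I * s * t = ((s * t : ℝ) : ℂ) * Complex.I by push_cast; ring,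
      ← Complex.ofReal_exp, Complex.re_mul_ofReal, Complex.exp_ofReal_mul_I_re, mul_comm]
  have hint : Integrable fun t : ℝ =>
      Complex.exp (Complex.I * s * t) * Complex.exp (-α * t ^ 2) := by
    refine (integrable_exp_neg_mul_sq hα).mono' (by fun_prop) (Eventually.of_forall fun t => ?_)
    rw [norm_mul, show -(α : ℂ) * t ^ 2 = ((-α * t ^ 2 : ℝ) : ℂ) by push_cast; ring,
      show Complex.I * s * t = ((s * t : ℝ) : ℂ) * Complex.I by push_cast; ring,
      Complex.norm_exp_ofReal_mul_I, one_mul, Complex.norm_exp_ofReal]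
  have h3 := integral_re hint
  have h4 : (fun t : ℝ => RCLike.re (Complex.exp (Complex.I * s * t) * Complex.exp (-α * t ^ 2))) =
      fun t : ℝ => Real.exp (-α * |t| ^ 2) * Real.cos (s * |t|) := by
    funext t
    rw [sq_abs, show Real.cos (s * |t|) = Real.cos (s * t) by
      rw [← Real.cos_abs (s * t), ← Real.cos_abs (s * |t|)]; simp [abs_mul]]
    exact h2 t
  rw [h4, integral_comp_abs (f := fun t => Real.exp (-α * t ^ 2) * Real.cos (s * t)), h1] at h3
  have h5 : ((Real.pi : ℂ) / α) ^ (1 / 2 : ℂ) * Complex.exp (-(s : ℂ) ^ 2 / (4 * α)) =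
      ((√(Real.pi / α) * Real.exp (-(1 / (4 * α)) * s ^ 2) : ℝ) : ℂ) := by
    push_cast
    congr 1
    · rw [Real.sqrt_eq_rpow, Complex.ofReal_cpow (by positivity)]
      push_cast; rfl
    · congr 1; ring
  rw [h5] at h3
  have h6 : RCLike.re ((√(Real.pi / α) * Real.exp (-(1 / (4 * α)) * s ^ 2) : ℝ) : ℂ) =
    √(Real.pi / α) * Real.exp (-(1 / (4 * α)) * s ^ 2) := Complex.ofReal_re _
  rw [h6] at h3
  linarith

/-- The sine transform of `e^{-αt²}/t` is the error function, because `2 sin(λt)/t` is the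
integral of `2 cos(st)` over `0 ≤ s ≤ λ`. -/
theorem integral_Ioi_gaussian_mul_sin_div {α : ℝ} (hα : 0 < α) (l : ℝ) (hl : 0 ≤ l) :
    ∫ t in Ioi (0 : ℝ), Real.exp (-α * t ^ 2) / t * (2 * Real.sin (l * t)) =
      Real.pi * gaussErf α l := by
  have h1 : ∀ t ∈ Ioi (0 : ℝ), Real.exp (-α * t ^ 2) / t * (2 * Real.sin (l * t)) =
      2 * ∫ s in Ioc (0 : ℝ) l, Real.exp (-α * t ^ 2) * Real.cos (s * t) := by
    intro t ht
    have ht0 : t ≠ 0 := (mem_Ioi.1 ht).ne'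
    rw [integral_const_mul, ← intervalIntegral.integral_of_le hl,
      intervalIntegral.integral_comp_mul_right _ ht0, integral_cos]
    simp
    field_simp
  rw [setIntegral_congr_fun measurableSet_Ioi h1, integral_const_mul]
  have hint : Integrable (Function.uncurry fun (t s : ℝ) =>
      Real.exp (-α * t ^ 2) * Real.cos (s * t))
      ((volume.restrict (Ioi 0)).prod (volume.restrict (Ioc 0 l))) := by
    have h2 : Integrable (fun z : ℝ × ℝ => Real.exp (-α * z.1 ^ 2) * (1 : ℝ))
        ((volume.restrict (Ioi 0)).prod (volume.restrict (Ioc 0 l))) :=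
      Integrable.mul_prod (f := fun t => Real.exp (-α * t ^ 2)) (g := fun _ => (1 : ℝ))
        (integrableOn_gaussian hα _) (integrable_const _)
    refine h2.mono' (by fun_prop) (Eventually.of_forall fun z => ?_)
    simp only [Function.uncurry, norm_mul, Real.norm_eq_abs, Real.abs_exp]
    exact mul_le_mul_of_nonneg_left (Real.abs_cos_le_one _) (Real.exp_pos _).le
  rw [integral_integral_swap hint]
  simp only [integral_Ioi_gaussian_mul_cos hα]
  rw [integral_const_mul, ← intervalIntegral.integral_of_le hl, gaussErf]
  have h3 : √(Real.pi / α) = Real.pi * (√(Real.pi * α))⁻¹ := by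
    rw [Real.sqrt_div Real.pi_pos.le, Real.sqrt_mul Real.pi_pos.le]
    have : √Real.pi ≠ 0 := (Real.sqrt_pos.2 Real.pi_pos).ne'
    have h4 : √Real.pi * √Real.pi = Real.pi := Real.mul_self_sqrt Real.pi_pos.le
    field_simp
    nlinarith
  rw [h3]
  ring

end Gaussian

/-! ### Unitary groups and the resolvent of their generator -/

section UnitaryGroup
variable {E : Type*} [NormedAddCommGroup E] [InnerProductSpace ℂ E] {U : ℝ → E →L[ℂ] E}

/-- A one-parameter group of isometries. Strong continuity is not part of the definition: it is
only needed on vectors in the domain of the generator, where differentiability supplies it. -/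
structure IsUnitaryGroup (U : ℝ → E →L[ℂ] E) : Prop where
  zero : ∀ ψ, U 0 ψ = ψ
  add : ∀ s t ψ, U (s + t) ψ = U s (U t ψ)
  norm : ∀ t ψ, ‖U t ψ‖ = ‖ψ‖

theorem isGenerated_generator (ψ : (generator U).domain) :
    IsGenerated U ψ (generator U ψ) :=
  Classical.choose_spec ψ.2

theorem IsGenerated.unique {ψ φ φ' : E} (h : IsGenerated U ψ φ) (h' : IsGenerated U ψ φ') :
    φ = φ' := tendsto_nhds_unique h h'

theorem IsGenerated.generator_eq {ψ φ : E} (h : IsGenerated U ψ φ) :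
    ∃ hψ : ψ ∈ (generator U).domain, generator U ⟨ψ, hψ⟩ = φ :=
  ⟨⟨φ, h⟩, (isGenerated_generator ⟨ψ, ⟨φ, h⟩⟩).unique h⟩

namespace IsUnitaryGroup

theorem neg_apply (hU : IsUnitaryGroup U) (t : ℝ) (ψ : E) : U t (U (-t) ψ) = ψ := by
  rw [← hU.add, add_neg_cancel, hU.zero]

theorem inner_apply (hU : IsUnitaryGroup U) (t : ℝ) (φ ψ : E) :
    inner ℂ (U t φ) (U t ψ) = inner ℂ φ ψ :=
  LinearIsometry.inner_map_map (⟨(U t : E →ₗ[ℂ] E), hU.norm t⟩ : E →ₗᵢ[ℂ] E) φ ψ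

theorem isGenerated_apply (hU : IsUnitaryGroup U) {ψ φ : E} (h : IsGenerated U ψ φ) (s : ℝ) :
    IsGenerated U (U s ψ) (U s φ) := by
  refine (((U s).continuous.tendsto _).comp h).congr fun t => ?_
  rw [Function.comp_apply, map_smul, map_sub, ← hU.add, ← hU.add, add_comm]

theorem hasDerivAt (hU : IsUnitaryGroup U) {ψ φ : E} (h : IsGenerated U ψ φ) (t : ℝ) :
    HasDerivAt (fun s => U s ψ) (Complex.I • U t φ) t := by
  rw [hasDerivAt_iff_tendsto_slope_zero]
  refine ((hU.isGenerated_apply h t).const_smul Complex.I).congr fun s => ?_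
  rw [← hU.add, add_comm s t, mul_inv, smul_smul, ← mul_assoc, mul_inv_cancel₀ Complex.I_ne_zero,
    one_mul, ← Complex.ofReal_inv, Complex.coe_smul]

theorem symm (hU : IsUnitaryGroup U) {ψ φ ψ' φ' : E} (h : IsGenerated U ψ φ)
    (h' : IsGenerated U ψ' φ') : inner ℂ φ ψ' = inner ℂ ψ φ' := by
  have h1 := (hU.hasDerivAt h 0).inner ℂ (hU.hasDerivAt h' 0)
  simp only [hU.inner_apply, hU.zero] at h1
  have h2 := h1.unique (hasDerivAt_const (0 : ℝ) (inner ℂ ψ ψ'))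
  rw [inner_smul_right, inner_smul_left, Complex.conj_I, neg_mul, ← sub_eq_add_neg, ← mul_sub,
    mul_eq_zero, or_iff_right Complex.I_ne_zero] at h2
  exact (sub_eq_zero.1 h2).symm

end IsUnitaryGroup

/-- `T = (H + 1)⁻¹` for the generator `H` of `U`: the range of `T` lies in the domain of `H`,
`H T = 1 - T`, and `T (H + 1)` is the identity of the domain. -/
structure IsResolventNegOne (U : ℝ → E →L[ℂ] E) (T : E →L[ℂ] E) : Prop where
  isGenerated : ∀ ψ, IsGenerated U (T ψ) (ψ - T ψ)
  apply_add : ∀ {ψ φ}, IsGenerated U ψ φ → T (φ + ψ) = ψ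

theorem exists_of_notMem_operatorSpectrum {z : ℂ} (hz : z ∉ operatorSpectrum (generator U)) :
    ∃ R : E →L[ℂ] E, (∀ ψ, IsGenerated U (R ψ) (ψ + z • R ψ)) ∧
      ∀ ψ φ, IsGenerated U ψ φ → R (φ - z • ψ) = ψ := by
  obtain ⟨R, h1, h2⟩ := not_not.1 hz
  refine ⟨R, fun ψ => ?_, fun ψ φ h => ?_⟩
  · obtain ⟨hψ, e⟩ := h1 ψ
    have := isGenerated_generator ⟨R ψ, hψ⟩
    rwa [sub_eq_iff_eq_add.1 e] at this
  · obtain ⟨hψ, e⟩ := h.generator_eq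
    have := h2 ⟨ψ, hψ⟩
    rwa [e] at this

theorem exists_isResolventNegOne (h : (-1 : ℂ) ∉ operatorSpectrum (generator U)) :
    ∃ T, IsResolventNegOne U T := by
  obtain ⟨T, h1, h2⟩ := exists_of_notMem_operatorSpectrum h
  refine ⟨T, fun ψ => ?_, fun {ψ φ} h => ?_⟩
  · simpa [sub_eq_add_neg] using h1 ψ
  · simpa using h2 ψ φ h

namespace IsResolventNegOne
variable {T : E →L[ℂ] E}

theorem inner_left (hT : IsResolventNegOne U T) (hU : IsUnitaryGroup U) (φ ψ : E) :
    inner ℂ (T φ) ψ = inner ℂ φ (T ψ) := by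
  have := hU.symm (hT.isGenerated φ) (hT.isGenerated ψ)
  rw [inner_sub_left, inner_sub_right, sub_left_inj] at this
  exact this.symm

theorem isSelfAdjoint [CompleteSpace E] (hT : IsResolventNegOne U T) (hU : IsUnitaryGroup U) :
    IsSelfAdjoint T :=
  (ContinuousLinearMap.isSelfAdjoint_iff_isSymmetric).2 fun φ ψ => hT.inner_left hU φ ψ

theorem injective (hT : IsResolventNegOne U T) {ψ : E} (h : T ψ = 0) : ψ = 0 := by
  have h1 := hT.isGenerated ψ
  rw [h, sub_zero] at h1
  exact h1.unique (by simp [IsGenerated])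

theorem apply_comm (hT : IsResolventNegOne U T) (hU : IsUnitaryGroup U) (t : ℝ) (ψ : E) :
    T (U t ψ) = U t (T ψ) := by
  have := hT.apply_add (hU.isGenerated_apply (hT.isGenerated ψ) t)
  rwa [← map_add, sub_add_cancel] at this

/-- The spectral mapping `λ ↦ (1 + λ)⁻¹` takes the gap of `H` to a gap of `T = (H + 1)⁻¹`. -/
theorem spectrum_subset [CompleteSpace E] (hT : IsResolventNegOne U T) (hU : IsUnitaryGroup U)
    {γ : ℝ} (hγ : 0 < γ)
    (hspec : operatorSpectrum (generator U) \ {0} ⊆ (fun r : ℝ => (r : ℂ)) '' Set.Ici γ)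
    {z : ℂ} (hz : z ∈ spectrum ℂ T) :
    z = (z.re : ℂ) ∧ (z.re = 1 ∨ (0 ≤ z.re ∧ z.re * (1 + γ) ≤ 1)) := by
  have hre := (hT.isSelfAdjoint hU).mem_spectrum_eq_re hz
  refine ⟨hre, ?_⟩
  by_contra! hcon
  obtain ⟨h1, h2⟩ := hcon
  set x := z.re
  -- The points `0` and `1` satisfy the alternatives. Any other `x` corresponds to
  -- `λ = 1/x - 1 ≠ 0`.
  have hx0 : x ≠ 0 := by
    intro h0
    have := h2 h0.ge
    rw [h0, zero_mul] at this
    linarith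
  have hw : ((1 / x - 1 : ℝ) : ℂ) ∉ operatorSpectrum (generator U) := by
    intro hmem
    have hne : ((1 / x - 1 : ℝ) : ℂ) ∉ ({0} : Set ℂ) := by
      intro h0
      have h3 : (1 / x - 1 : ℝ) = 0 := by
        exact_mod_cast Set.mem_singleton_iff.1 h0
      field_simp at h3
      exact h1 (by linarith)
    obtain ⟨r, hr, hre⟩ := hspec ⟨hmem, hne⟩
    have h4 : r = 1 / x - 1 := Complex.ofReal_injective hre
    have h5 : 1 + γ ≤ 1 / x := by have := Set.mem_Ici.1 hr; linarith
    have h6 : 0 < x := by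
      have : 0 < 1 / x := by linarith
      exact one_div_pos.1 this
    have := h2 h6.le
    rw [le_div_iff₀ h6] at h5
    linarith
  obtain ⟨R, hR1, hR2⟩ := exists_of_notMem_operatorSpectrum hw
  have hxC : (x : ℂ) ≠ 0 := by exact_mod_cast hx0
  -- The resolvent identities `R - T = x⁻¹ T R = x⁻¹ R T`, which make `x⁻¹ (1 + x⁻¹ R)` the inverse
  -- of `x - T`.
  have e1 : ∀ ψ, R ψ - T ψ - (x : ℂ)⁻¹ • T (R ψ) = 0 := by
    intro ψ
    have h3 := hT.apply_add (hR1 ψ)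
    have h4 : ψ + ((1 / x - 1 : ℝ) : ℂ) • R ψ + R ψ = ψ + (x : ℂ)⁻¹ • R ψ := by
      push_cast
      rw [sub_smul, one_div, one_smul]; abel
    rw [h4, map_add, map_smul] at h3
    nth_rewrite 1 [← h3]
    abel
  have e2 : ∀ ψ, R ψ - T ψ - (x : ℂ)⁻¹ • R (T ψ) = 0 := by
    intro ψ
    have h3 := hR2 _ _ (hT.isGenerated ψ)
    have h4 : ψ - T ψ - ((1 / x - 1 : ℝ) : ℂ) • T ψ = ψ - (x : ℂ)⁻¹ • T ψ := by
      push_cast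
      rw [sub_smul, one_div, one_smul]; abel
    rw [h4, map_sub, map_smul] at h3
    nth_rewrite 1 [← h3]
    abel
  have hunit : IsUnit (algebraMap ℂ (E →L[ℂ] E) (x : ℂ) - T) := by
    refine isUnit_iff_exists.2 ⟨(x : ℂ)⁻¹ • (1 + (x : ℂ)⁻¹ • R), ?_, ?_⟩
    · ext ψ
      have : (algebraMap ℂ (E →L[ℂ] E) (x : ℂ) - T) (((x : ℂ)⁻¹ • (1 + (x : ℂ)⁻¹ • R)) ψ) =
          ψ + (x : ℂ)⁻¹ • (R ψ - T ψ - (x : ℂ)⁻¹ • T (R ψ)) := by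
        simp only [Algebra.algebraMap_eq_smul_one, sub_apply, _root_.smul_apply, _root_.add_apply,
          one_apply_eq_self, map_smul, map_add, smul_add, smul_sub, smul_smul]
        match_scalars <;> field_simp
      rw [_root_.mul_apply_eq_comp, this, e1, smul_zero, add_zero]; rfl
    · ext ψ
      have : ((x : ℂ)⁻¹ • (1 + (x : ℂ)⁻¹ • R)) ((algebraMap ℂ (E →L[ℂ] E) (x : ℂ) - T) ψ) =
          ψ + (x : ℂ)⁻¹ • (R ψ - T ψ - (x : ℂ)⁻¹ • R (T ψ)) := by
        simp only [Algebra.algebraMap_eq_smul_one, sub_apply, _root_.smul_apply, _root_.add_apply,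
          one_apply_eq_self, map_smul, map_sub, smul_add, smul_sub, smul_smul]
        match_scalars <;> field_simp
      rw [_root_.mul_apply_eq_comp, this, e2, smul_zero, add_zero]; rfl
  rw [hre] at hz
  exact (spectrum.mem_iff.1 hz) hunit

end IsResolventNegOne

end UnitaryGroup

/-! ### Functional calculus of the resolvent -/

section FunctionalCalculus

/-- The function `x e^{it(1/x - 1)}`, which represents `e^{itH} T` for `T = (H + 1)⁻¹`. The factor
`x` makes it continuous at `x = 0`, where `1/x` has the value `0`. -/
def phase (t x : ℝ) : ℂ := x * Complex.exp (Complex.I * (t * (1 / x - 1) : ℝ))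

theorem norm_phase (t x : ℝ) : ‖phase t x‖ = |x| := by
  rw [phase, norm_mul, mul_comm Complex.I, Complex.norm_exp_ofReal_mul_I, mul_one,
    Complex.norm_real, Real.norm_eq_abs]

theorem phase_zero (x : ℝ) : phase 0 x = x := by simp [phase]

theorem continuous_phase : Continuous fun p : ℝ × ℝ => phase p.1 p.2 := by
  rw [continuous_iff_continuousAt]
  rintro ⟨t, x⟩
  by_cases hx : x = 0
  · subst hx
    have h0 : phase t 0 = 0 := by simp [phase]
    rw [ContinuousAt, h0, tendsto_zero_iff_norm_tendsto_zero]
    simp only [norm_phase]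
    have : Continuous fun p : ℝ × ℝ => |p.2| := by fun_prop
    simpa using this.tendsto (t, (0 : ℝ))
  · unfold phase
    have h1 : ContinuousAt (fun p : ℝ × ℝ => 1 / p.2) (t, x) :=
      continuousAt_const.div continuousAt_snd hx
    have h2 : ContinuousAt (fun p : ℝ × ℝ => p.1 * (1 / p.2 - 1)) (t, x) :=
      continuousAt_fst.mul (h1.sub continuousAt_const)
    exact (Complex.continuous_ofReal.continuousAt.comp continuousAt_snd).mul
      ((continuousAt_const.mul (Complex.continuous_ofReal.continuousAt.comp h2)).cexp)

theorem norm_exp_I_mul_sub_sub_le (y : ℝ) :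
    ‖Complex.exp (Complex.I * y) - 1 - Complex.I * y‖ ≤ y ^ 2 := by
  have hderiv : ∀ s : ℝ, HasDerivAt (fun s : ℝ => Complex.exp (Complex.I * s) - Complex.I * s)
      (Complex.exp (Complex.I * s) * (Complex.I * 1) - Complex.I * 1) s := fun s =>
    (((Complex.ofRealCLM.hasDerivAt (x := s)).const_mul Complex.I).cexp).sub
      ((Complex.ofRealCLM.hasDerivAt (x := s)).const_mul Complex.I)
  have key := (convex_Icc (-|y|) |y|).norm_image_sub_le_of_norm_hasDerivWithin_le (C := |y|)
    (fun x _ => (hderiv x).hasDerivWithinAt)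
    (fun x hx => by
      rw [mul_one, ← sub_one_mul, norm_mul, Complex.norm_I, mul_one]
      exact Real.norm_exp_I_mul_ofReal_sub_one_le.trans (abs_le.2 hx))
    (Set.mem_Icc.2 ⟨by simp, by simp⟩ : (0 : ℝ) ∈ Set.Icc (-|y|) |y|)
    (Set.mem_Icc.2 ⟨neg_abs_le y, le_abs_self y⟩)
  have e : Complex.exp (Complex.I * y) - 1 - Complex.I * y =
      Complex.exp (Complex.I * y) - Complex.I * y -
        (Complex.exp (Complex.I * (0 : ℝ)) - Complex.I * (0 : ℝ)) := by simp; ring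
  rw [e, ← sq_abs, sq]
  simpa using key

/-- The remainder of the derivative of `x phase t x` with respect to `t` is quadratic uniformly in
`x ∈ [0, 1]`. The second factor `x` compensates the unbounded frequency `1/x - 1`. -/
theorem norm_phase_sub_sub_le (t s : ℝ) {x : ℝ} (h0 : 0 ≤ x) (h1 : x ≤ 1) :
    ‖x * phase (t + s) x - x * phase t x - s * (Complex.I * ((1 - x) * phase t x))‖ ≤ s ^ 2 := by
  rcases h0.eq_or_lt with h | h
  · rw [← h]; simp [phase]; positivity
  have hx : (x : ℂ) ≠ 0 := by exact_mod_cast h.ne'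
  set y := s * (1 / x - 1) with hy
  have e1 : phase (t + s) x = phase t x * Complex.exp (Complex.I * y) := by
    rw [phase, phase, mul_assoc, ← Complex.exp_add]
    congr 2
    rw [hy]; push_cast; ring
  have e2 : (s : ℂ) * (Complex.I * ((1 - x) * phase t x)) = x * phase t x * (Complex.I * y) := by
    rw [hy]; push_cast; field_simp
  have e3 : x * phase (t + s) x - x * phase t x - s * (Complex.I * ((1 - x) * phase t x)) =
      x * phase t x * (Complex.exp (Complex.I * y) - 1 - Complex.I * y) := by
    rw [e1, e2]; ring
  rw [e3, norm_mul, norm_mul, norm_phase, Complex.norm_real, Real.norm_eq_abs, abs_of_pos h]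
  calc x * x * ‖Complex.exp (Complex.I * y) - 1 - Complex.I * y‖ ≤ x * x * y ^ 2 :=
        mul_le_mul_of_nonneg_left (norm_exp_I_mul_sub_sub_le y) (by positivity)
    _ = (s * (1 - x)) ^ 2 := by rw [hy]; field_simp
    _ ≤ s ^ 2 := by
        rw [mul_pow]
        exact mul_le_of_le_one_right (sq_nonneg _) (pow_le_one₀ (by linarith) (by linarith))

variable {E : Type*} [NormedAddCommGroup E] [InnerProductSpace ℂ E] [CompleteSpace E]
  {U : ℝ → E →L[ℂ] E} {T : E →L[ℂ] E}

theorem continuous_phase_re (t : ℝ) : Continuous fun z : ℂ => phase t z.re :=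
  continuous_phase.comp (continuous_const.prodMk Complex.continuous_re)

theorem cfc_re_eq (hT : IsSelfAdjoint T) : cfc (fun z : ℂ => (z.re : ℂ)) T = T := by
  have := hT.isStarNormal
  have h1 : cfc (fun z : ℂ => (z.re : ℂ)) T = cfc (fun z : ℂ => z) T :=
    cfc_congr fun z hz => (hT.mem_spectrum_eq_re hz).symm
  rw [h1, cfc_id' ℂ T]

namespace IsResolventNegOne

/-- The family `W_t = e^{itH} T`, realised by functional calculus, satisfies the Schrödinger
equation after multiplication by `T`: `(T W_t)' = i (1 - T) W_t`, where `1 - T = H T`. -/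
theorem hasDerivAt_mul_cfc_phase (hT : IsSelfAdjoint T)
    (hsp : ∀ z ∈ spectrum ℂ T, 0 ≤ z.re ∧ z.re ≤ 1) (t : ℝ) :
    HasDerivAt (fun s => T * cfc (fun z : ℂ => phase s z.re) T)
      (Complex.I • ((1 - T) * cfc (fun z : ℂ => phase t z.re) T)) t := by
  have hn := hT.isStarNormal
  have hre : Continuous fun z : ℂ => (z.re : ℂ) := by fun_prop
  have e1 : ∀ s, T * cfc (fun z : ℂ => phase s z.re) T =
      cfc (fun z : ℂ => z.re * phase s z.re) T := by
    intro s
    have h2 := (continuous_phase_re s).continuousOn (s := spectrum ℂ T)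
    rw [cfc_mul _ _ T hre.continuousOn h2, cfc_re_eq hT]
  have e2 : (1 - T) * cfc (fun z : ℂ => phase t z.re) T =
      cfc (fun z : ℂ => (1 - z.re) * phase t z.re) T := by
    have h2 := (continuous_phase_re t).continuousOn (s := spectrum ℂ T)
    rw [cfc_mul _ _ T (by fun_prop) h2, cfc_sub _ _ T (by fun_prop) (by fun_prop),
      cfc_const_one ℂ T, cfc_re_eq hT]
  rw [hasDerivAt_iff_isLittleO_nhds_zero]
  simp only [e1, e2]
  have hbound : ∀ s : ℝ, ‖cfc (fun z : ℂ => z.re * phase (t + s) z.re) T -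
      cfc (fun z : ℂ => z.re * phase t z.re) T -
      s • (Complex.I • cfc (fun z : ℂ => (1 - z.re) * phase t z.re) T)‖ ≤ s ^ 2 := by
    intro s
    have d1 : Continuous fun z : ℂ => z.re * phase t z.re := hre.mul (continuous_phase_re t)
    have d2 : Continuous fun z : ℂ => z.re * phase (t + s) z.re :=
      hre.mul (continuous_phase_re (t + s))
    have d3 : Continuous fun z : ℂ => (1 - z.re) * phase t z.re :=
      (continuous_const.sub hre).mul (continuous_phase_re t)
    have d4 : Continuous fun z : ℂ => z.re * phase (t + s) z.re - z.re * phase t z.re := d2.sub d1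
    have d5 : Continuous fun z : ℂ => Complex.I * ((1 - z.re) * phase t z.re) := d3.const_mul _
    have h3 : cfc (fun z : ℂ => z.re * phase (t + s) z.re) T -
      cfc (fun z : ℂ => z.re * phase t z.re) T -
      s • (Complex.I • cfc (fun z : ℂ => (1 - z.re) * phase t z.re) T) =
      cfc (fun z : ℂ => z.re * phase (t + s) z.re - z.re * phase t z.re -
        s * (Complex.I * ((1 - z.re) * phase t z.re))) T := by
      rw [cfc_sub _ _ T d4.continuousOn (d5.const_mul _).continuousOn,
        cfc_sub _ _ T d2.continuousOn d1.continuousOn,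
        cfc_const_mul _ _ T d5.continuousOn,
        cfc_const_mul _ _ T d3.continuousOn, Complex.coe_smul]
    rw [h3]
    exact norm_cfc_le (sq_nonneg s) fun z hz =>
      norm_phase_sub_sub_le t s (hsp z hz).1 (hsp z hz).2
  refine (Asymptotics.IsBigO.of_bound 1 (Eventually.of_forall fun s => ?_)).trans_isLittleO
    (Asymptotics.isLittleO_pow_id (𝕜 := ℝ) (n := 2) (by norm_num))
  simpa using hbound s

/-- `e^{itH} T` is a continuous function of `T = (H + 1)⁻¹`. -/
theorem apply_eq_cfc_phase (hT : IsResolventNegOne U T) (hU : IsUnitaryGroup U)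
    (hsp : ∀ z ∈ spectrum ℂ T, 0 ≤ z.re ∧ z.re ≤ 1) (t : ℝ) (ψ : E) :
    U t (T ψ) = cfc (fun z : ℂ => phase t z.re) T ψ := by
  have hsa := hT.isSelfAdjoint hU
  have hn := hsa.isStarNormal
  let W : ℝ → E →L[ℂ] E := fun t => cfc (fun z : ℂ => phase t z.re) T
  have hW0 : W 0 = T := by
    simp only [W, phase_zero]
    exact cfc_re_eq hsa
  have hcomm : ∀ s χ, T (U s χ) = U s (T χ) := hT.apply_comm hU
  -- `U_s T χ` and `T W_s ψ` solve the same Schrödinger equation, whose generator is symmetric, so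
  -- their inner product does not depend on `s`.
  have hconst : ∀ χ, inner ℂ (U t (T χ)) (T (W t ψ)) = inner ℂ (T χ) (T (T ψ)) := by
    intro χ
    have hd : ∀ s, HasDerivAt (fun s => inner ℂ (U s (T χ)) ((T * W s) ψ)) 0 s := by
      intro s
      have h1 := hU.hasDerivAt (hT.isGenerated χ) s
      have h2 : HasDerivAt (fun s => (T * W s) ψ) ((Complex.I • ((1 - T) * W s)) ψ) s :=
        ((ContinuousLinearMap.apply ℂ E ψ).restrictScalars ℝ).hasFDerivAt.comp_hasDerivAt s
          (hasDerivAt_mul_cfc_phase hsa hsp s)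
      have h3 := h1.inner ℂ h2
      refine h3.congr_deriv ?_
      simp only [_root_.smul_apply, _root_.mul_apply_eq_comp, _root_.sub_apply,
        one_apply_eq_self, map_sub, map_smul, inner_smul_left, inner_smul_right, Complex.conj_I,
        inner_sub_left, inner_sub_right, ← hcomm, hT.inner_left hU]
      ring
    have h4 := is_const_of_deriv_eq_zero (fun s => (hd s).differentiableAt)
      (fun s => (hd s).deriv) t 0
    simpa [hW0, hU.zero] using h4
  set v := W t ψ - U t (T ψ) with hv
  have h5 : ∀ χ, inner ℂ (T (U t χ)) (T v) = 0 := by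
    intro χ
    have h6 := hconst χ
    rw [hv, map_sub, inner_sub_right, sub_eq_zero, hcomm, h6, hcomm, hU.inner_apply]
  have h7 := h5 (U (-t) v)
  rw [hU.neg_apply, inner_self_eq_zero] at h7
  exact (sub_eq_zero.1 (hT.injective h7)).symm

end IsResolventNegOne

end FunctionalCalculus

/-! ### Gaussian spectral filter -/

section SpectralFilter
open MeasureTheory Set

/-- The defect `1 - E(λ)` of the Gaussian filter as a function of `x = (1 + λ)⁻¹`, continuously
extended by `0` to `x = 0`, i.e. `λ = ∞`. -/
def filterDefect (α x : ℝ) : ℝ := if x = 0 then 0 else 1 - gaussErf α (1 / x - 1)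

theorem one_div_sub_one_nonneg {x : ℝ} (h0 : 0 < x) (h1 : x ≤ 1) : 0 ≤ 1 / x - 1 :=
  sub_nonneg.2 ((one_le_div h0).2 h1)

theorem filterDefect_nonneg {α x : ℝ} (hα : 0 < α) : 0 ≤ filterDefect α x := by
  unfold filterDefect
  split_ifs with h
  · exact le_rfl
  · exact one_sub_gaussErf_nonneg hα _

theorem filterDefect_le {α x l : ℝ} (hα : 0 < α) (hl : 0 ≤ l) (h0 : 0 ≤ x)
    (hx : x * (1 + l) ≤ 1) : filterDefect α x ≤ Real.exp (-(1 / (4 * α)) * l ^ 2) := by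
  unfold filterDefect
  split_ifs with h
  · exact (Real.exp_pos _).le
  · have hx0 : 0 < x := lt_of_le_of_ne h0 (Ne.symm h)
    have h1 : l ≤ 1 / x - 1 := by
      have : 1 + l ≤ 1 / x := by rw [le_div_iff₀ hx0]; linarith
      linarith
    refine (one_sub_gaussErf_le hα (hl.trans h1)).trans (Real.exp_le_exp.2 ?_)
    have h2 : l ^ 2 ≤ (1 / x - 1) ^ 2 := pow_le_pow_left₀ hl h1 2
    have h3 : 0 < 1 / (4 * α) := by positivity
    nlinarith

/-- A linear bound near `x = 0`, which gives continuity there. It follows from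
`e^{-u} ≤ 1/(1 + u)`. -/
theorem filterDefect_le_mul {α x : ℝ} (hα : 0 < α) (h0 : 0 ≤ x) (h1 : x ≤ 1) :
    filterDefect α x ≤ (2 + 4 * α) * x := by
  rcases h0.eq_or_lt with h | h
  · simp [filterDefect, ← h]
  have hl := one_div_sub_one_nonneg h h1
  have h2 : filterDefect α x ≤ Real.exp (-(1 / (4 * α)) * (1 / x - 1) ^ 2) := by
    rw [filterDefect, if_neg h.ne']
    exact one_sub_gaussErf_le hα hl
  set c := 1 / (4 * α)
  set u := c * (1 / x - 1) ^ 2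
  have hc : 0 < c := by positivity
  have hu : 0 ≤ u := by positivity
  have h3 : Real.exp (-c * (1 / x - 1) ^ 2) ≤ 1 / (1 + u) := by
    rw [neg_mul, Real.exp_neg, ← one_div]
    exact one_div_le_one_div_of_le (by linarith) (by linarith [Real.add_one_le_exp u])
  refine h2.trans (h3.trans ?_)
  rw [div_le_iff₀ (by linarith)]
  have h4 : 1 / x ≤ (2 + 4 * α) * (1 + u) := by
    have e : 4 * α * u = (1 / x - 1) ^ 2 := by simp only [u, c]; field_simp
    nlinarith [sq_nonneg (1 / x - 1 - 1), mul_nonneg hα.le hu]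
  calc 1 = 1 / x * x := by field_simp
    _ ≤ (2 + 4 * α) * (1 + u) * x := mul_le_mul_of_nonneg_right h4 h.le
    _ = _ := by ring

theorem continuousOn_filterDefect {α : ℝ} (hα : 0 < α) :
    ContinuousOn (filterDefect α) (Icc 0 1) := by
  intro x hx
  by_cases h : x = 0
  · subst h
    have h0 : filterDefect α 0 = 0 := by simp [filterDefect]
    rw [ContinuousWithinAt, h0]
    have hlim : Tendsto (fun x : ℝ => (2 + 4 * α) * x) (𝓝[Icc 0 1] 0) (𝓝 0) := by
      have : Continuous fun x : ℝ => (2 + 4 * α) * x := by fun_prop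
      simpa using (this.tendsto 0).mono_left nhdsWithin_le_nhds
    refine tendsto_of_tendsto_of_tendsto_of_le_of_le' tendsto_const_nhds hlim
      (Eventually.of_forall fun y => filterDefect_nonneg hα) ?_
    filter_upwards [self_mem_nhdsWithin] with y hy
    exact filterDefect_le_mul hα hy.1 hy.2
  · have h1 : ContinuousAt (fun y : ℝ => 1 - gaussErf α (1 / y - 1)) x :=
      continuousAt_const.sub ((continuous_gaussErf α).continuousAt.comp
        ((continuousAt_const.div continuousAt_id h).sub continuousAt_const))
    refine (h1.congr ?_).continuousWithinAt
    filter_upwards [isOpen_ne.mem_nhds h] with y hy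
    simp [filterDefect, hy]

/-- The filtered propagator `e^{-αt²} (e^{itλ} - e^{-itλ}) / (it)`, `λ = 1/x - 1`, times `x`. -/
def filterKernel (α t x : ℝ) : ℂ :=
  ((Real.exp (-α * t ^ 2) / t : ℝ) : ℂ) * (-Complex.I * (phase t x - phase (-t) x))

theorem filterKernel_eq (α t x : ℝ) : filterKernel α t x =
    ((x * (Real.exp (-α * t ^ 2) / t * (2 * Real.sin ((1 / x - 1) * t))) : ℝ) : ℂ) := by
  rw [filterKernel, phase, phase]
  set y := t * (1 / x - 1)
  have e1 : -t * (1 / x - 1) = -y := by simp only [y]; ring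
  have e2 : (1 / x - 1) * t = y := by simp only [y]; ring
  rw [e1, e2]
  push_cast
  rw [Complex.sin]
  have e3 : Complex.exp (Complex.I * -(y : ℂ)) = Complex.exp (-(y : ℂ) * Complex.I) := by
    congr 1; ring
  have e4 : Complex.exp (Complex.I * (y : ℂ)) = Complex.exp ((y : ℂ) * Complex.I) := by
    congr 1; ring
  rw [e3, e4]
  ring

/-- The bound `|sin y| ≤ |y|` cancels the singularity at `t = 0`, and the factor `x` compensates the
unbounded frequency `1/x - 1`. -/
theorem norm_filterKernel_le {α t x : ℝ} (ht : 0 < t) (h0 : 0 ≤ x) (h1 : x ≤ 1) :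
    ‖filterKernel α t x‖ ≤ 2 * Real.exp (-α * t ^ 2) := by
  rw [filterKernel_eq, Complex.norm_real, Real.norm_eq_abs]
  rcases h0.eq_or_lt with h | h
  · rw [← h]; simp; positivity
  have h2 : |Real.sin ((1 / x - 1) * t)| ≤ (1 / x - 1) * t := by
    refine Real.abs_sin_le_abs.trans (le_of_eq (abs_of_nonneg ?_))
    exact mul_nonneg (one_div_sub_one_nonneg h h1) ht.le
  rw [abs_mul, abs_mul, abs_mul, abs_of_pos h, abs_of_pos (by positivity), abs_two]
  calc x * (Real.exp (-α * t ^ 2) / t * (2 * |Real.sin ((1 / x - 1) * t)|))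
      ≤ x * (Real.exp (-α * t ^ 2) / t * (2 * ((1 / x - 1) * t))) := by gcongr
    _ = 2 * Real.exp (-α * t ^ 2) * (1 - x) := by field_simp
    _ ≤ _ := mul_le_of_le_one_right (by positivity) (by linarith)

theorem continuousOn_filterKernel (α : ℝ) (s : Set ℂ) :
    ContinuousOn (Function.uncurry fun (t : ℝ) (z : ℂ) => filterKernel α t z.re) (Ioi 0 ×ˢ s) := by
  have h1 : Continuous fun p : ℝ × ℂ => phase p.1 p.2.re :=
    continuous_phase.comp (continuous_fst.prodMk (Complex.continuous_re.comp continuous_snd))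
  have h2 : Continuous fun p : ℝ × ℂ => phase (-p.1) p.2.re :=
    continuous_phase.comp (continuous_fst.neg.prodMk (Complex.continuous_re.comp continuous_snd))
  have h3 : ContinuousOn (fun p : ℝ × ℂ => Real.exp (-α * p.1 ^ 2) / p.1) (Ioi 0 ×ˢ s) :=
    ContinuousOn.div (by fun_prop) (by fun_prop) fun p hp => (mem_Ioi.1 hp.1).ne'
  exact (Complex.continuous_ofReal.comp_continuousOn h3).mul
    (continuous_const.mul (h1.sub h2)).continuousOn

/-- The filter integral, scalar version: `x E(λ)` with `λ = 1/x - 1`. -/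
theorem integral_filterKernel {α x : ℝ} (hα : 0 < α) (h0 : 0 ≤ x) (h1 : x ≤ 1) :
    ∫ t in Ioi (0 : ℝ), filterKernel α t x =
      ((Real.pi * (x - x * filterDefect α x) : ℝ) : ℂ) := by
  simp only [filterKernel_eq]
  rw [integral_complex_ofReal, integral_const_mul]
  congr 1
  rcases h0.eq_or_lt with h | h
  · rw [← h]; simp
  · rw [integral_Ioi_gaussian_mul_sin_div hα _ (one_div_sub_one_nonneg h h1), filterDefect,
      if_neg h.ne']
    ring

variable {E : Type*} [NormedAddCommGroup E] [InnerProductSpace ℂ E] [CompleteSpace E]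
  {U : ℝ → E →L[ℂ] E} {T : E →L[ℂ] E}

/-- The scalar function `e^{-αt²} ⟨φ, (U_t - U_{-t}) ψ⟩ / (it)`. -/
def filteredInner (U : ℝ → E →L[ℂ] E) (α : ℝ) (φ ψ : E) (t : ℝ) : ℂ :=
  ((Real.exp (-α * t ^ 2) / t : ℝ) : ℂ) * (-Complex.I * inner ℂ φ (U t ψ - U (-t) ψ))

/-- The filtered propagator applied to a vector in the range of `T = (H + 1)⁻¹`. -/
theorem IsResolventNegOne.integral_filteredInner (hT : IsResolventNegOne U T)
    (hU : IsUnitaryGroup U) (hsp : ∀ z ∈ spectrum ℂ T, 0 ≤ z.re ∧ z.re ≤ 1) {α : ℝ} (hα : 0 < α)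
    (φ χ : E) :
    IntegrableOn (filteredInner U α φ (T χ)) (Ioi 0) ∧
    ∫ t in Ioi (0 : ℝ), filteredInner U α φ (T χ) t =
      Real.pi * (inner ℂ φ (T χ) -
        inner ℂ φ (cfc (fun z : ℂ => ((z.re * filterDefect α z.re : ℝ) : ℂ)) T χ)) := by
  have hsa := hT.isSelfAdjoint hU
  have hn := hsa.isStarNormal
  let ℓ : (E →L[ℂ] E) →L[ℂ] ℂ := (innerSL ℂ φ).comp (ContinuousLinearMap.apply ℂ E χ)
  have hℓ : ∀ A, ℓ A = inner ℂ φ (A χ) := fun A => rfl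
  have e1 : ∀ t, filteredInner U α φ (T χ) t =
      ℓ (cfc (fun z : ℂ => filterKernel α t z.re) T) := by
    intro t
    have c1 := (continuous_phase_re t)
    have c2 := (continuous_phase_re (-t))
    have c3 : Continuous fun z : ℂ => phase t z.re - phase (-t) z.re := c1.sub c2
    have : cfc (fun z : ℂ => filterKernel α t z.re) T =
        ((Real.exp (-α * t ^ 2) / t : ℝ) : ℂ) • (-Complex.I • (cfc (fun z : ℂ => phase t z.re) T -
          cfc (fun z : ℂ => phase (-t) z.re) T)) := by
      unfold filterKernel
      rw [cfc_const_mul _ _ T (c3.const_mul _).continuousOn, cfc_const_mul _ _ T c3.continuousOn,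
        cfc_sub _ _ T c1.continuousOn c2.continuousOn]
    rw [this, map_smul, map_smul, map_sub, hℓ, hℓ, ← hT.apply_eq_cfc_phase hU hsp,
      ← hT.apply_eq_cfc_phase hU hsp, ← inner_sub_right, filteredInner, smul_eq_mul, smul_eq_mul]
  have hbd : ∀ᵐ t ∂(volume.restrict (Ioi (0 : ℝ))), ∀ z ∈ spectrum ℂ T,
      ‖filterKernel α t z.re‖ ≤ 2 * Real.exp (-α * t ^ 2) :=
    (ae_restrict_iff' measurableSet_Ioi).2 (Eventually.of_forall fun t ht z hz =>
      norm_filterKernel_le ht (hsp z hz).1 (hsp z hz).2)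
  have hfin : HasFiniteIntegral (fun t : ℝ => 2 * Real.exp (-α * t ^ 2))
      (volume.restrict (Ioi (0 : ℝ))) := ((integrableOn_gaussian hα _).const_mul 2).2
  have hint := integrableOn_cfc measurableSet_Ioi (fun (t : ℝ) (z : ℂ) => filterKernel α t z.re)
    (fun t => 2 * Real.exp (-α * t ^ 2)) T (continuousOn_filterKernel α _) hbd hfin
  have hval := cfc_setIntegral measurableSet_Ioi (fun (t : ℝ) (z : ℂ) => filterKernel α t z.re)
    (fun t => 2 * Real.exp (-α * t ^ 2)) T (continuousOn_filterKernel α _) hbd hfin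
  have e2 : filteredInner U α φ (T χ) = fun t =>
      ℓ (cfc (fun z : ℂ => filterKernel α t z.re) T) := funext e1
  rw [e2]
  refine ⟨ℓ.integrable_comp hint, ?_⟩
  rw [ℓ.integral_comp_comm hint, ← hval]
  have hcont : ContinuousOn (fun z : ℂ => ((z.re * filterDefect α z.re : ℝ) : ℂ))
      (spectrum ℂ T) := by
    refine Complex.continuous_ofReal.comp_continuousOn (Complex.continuous_re.continuousOn.mul ?_)
    exact (continuousOn_filterDefect hα).comp Complex.continuous_re.continuousOn
      fun z hz => hsp z hz
  have e3 : cfc (fun z : ℂ => ∫ t in Ioi (0 : ℝ), filterKernel α t z.re) T =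
      (Real.pi : ℂ) • (T - cfc (fun z : ℂ => ((z.re * filterDefect α z.re : ℝ) : ℂ)) T) := by
    have c1 : ContinuousOn (fun z : ℂ => (z.re : ℂ)) (spectrum ℂ T) := by fun_prop
    have e4 : cfc (fun z : ℂ => ∫ t in Ioi (0 : ℝ), filterKernel α t z.re) T =
        cfc (fun z : ℂ => (Real.pi : ℂ) * ((z.re : ℂ) -
          ((z.re * filterDefect α z.re : ℝ) : ℂ))) T :=
      cfc_congr fun z hz => by
        rw [integral_filterKernel hα (hsp z hz).1 (hsp z hz).2]
        push_cast; ring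
    have c2 : ContinuousOn (fun z : ℂ => (z.re : ℂ) - ((z.re * filterDefect α z.re : ℝ) : ℂ))
        (spectrum ℂ T) := c1.sub hcont
    rw [e4, cfc_const_mul _ _ T c2, cfc_sub _ _ T c1 hcont, cfc_re_eq hsa]
  rw [e3, map_smul, map_sub, hℓ, hℓ, smul_eq_mul]

/-- The Gaussian filter reproduces the inner product with a vector orthogonal to the kernel of the
generator, up to an error `e^{-γ²/(4α)}`, if the generator has a spectral gap `γ`. -/
theorem IsUnitaryGroup.norm_inner_sub_integral_filteredInner_le (hU : IsUnitaryGroup U) {γ : ℝ}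
    (hγ : 0 < γ)
    (hspec : operatorSpectrum (generator U) \ {0} ⊆ (fun r : ℝ => (r : ℂ)) '' Set.Ici γ)
    {α : ℝ} (hα : 0 < α) (φ : E) {ψ : E} (hψ : ∃ η, IsGenerated U ψ η)
    (hker : ∀ v, IsGenerated U v 0 → inner ℂ v ψ = 0) :
    IntegrableOn (filteredInner U α φ ψ) (Ioi 0) ∧
    ‖inner ℂ φ ψ - (Real.pi : ℂ)⁻¹ * ∫ t in Ioi (0 : ℝ), filteredInner U α φ ψ t‖ ≤
      Real.exp (-(1 / (4 * α)) * γ ^ 2) * (‖φ‖ * ‖ψ‖) := by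
  have hneg : (-1 : ℂ) ∉ operatorSpectrum (generator U) := by
    intro hmem
    obtain ⟨r, hr, hr1⟩ := hspec ⟨hmem, by simp⟩
    have : r = -1 := by exact_mod_cast (show ((r : ℝ) : ℂ) = ((-1 : ℝ) : ℂ) by simpa using hr1)
    have := mem_Ici.1 hr
    linarith
  obtain ⟨T, hT⟩ := exists_isResolventNegOne hneg
  have hsa := hT.isSelfAdjoint hU
  have hn := hsa.isStarNormal
  have hgap : ∀ z ∈ spectrum ℂ T, z.re = 1 ∨ (0 ≤ z.re ∧ z.re * (1 + γ) ≤ 1) :=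
    fun z hz => (hT.spectrum_subset hU hγ hspec hz).2
  have hsp : ∀ z ∈ spectrum ℂ T, 0 ≤ z.re ∧ z.re ≤ 1 := by
    intro z hz
    rcases hgap z hz with h | ⟨h1, h2⟩
    · rw [h]; norm_num
    · exact ⟨h1, by nlinarith⟩
  obtain ⟨η, hη⟩ := hψ
  set χ := η + ψ with hχ
  have hTχ : T χ = ψ := hT.apply_add hη
  -- `p` equals the indicator function of `1` on the spectrum of `T`.
  let p : ℝ → ℝ := fun x => max 0 ((x * (1 + γ) - 1) / γ)
  have hp : Continuous p := by fun_prop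
  have hp1 : p 1 = 1 := by simp [p, hγ.ne']
  have hp0 : ∀ x, x * (1 + γ) ≤ 1 → p x = 0 := fun x hx =>
    max_eq_left (div_nonpos_of_nonpos_of_nonneg (by linarith) hγ.le)
  have cp : ContinuousOn (fun z : ℂ => (p z.re : ℂ)) (spectrum ℂ T) := by fun_prop
  have cre : ContinuousOn (fun z : ℂ => (z.re : ℂ)) (spectrum ℂ T) := by fun_prop
  have cG : ContinuousOn (fun z : ℂ => (((1 - p z.re) * filterDefect α z.re : ℝ) : ℂ))
      (spectrum ℂ T) := by
    refine Complex.continuous_ofReal.comp_continuousOn (ContinuousOn.mul (by fun_prop) ?_)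
    exact (continuousOn_filterDefect hα).comp Complex.continuous_re.continuousOn
      fun z hz => hsp z hz
  -- `P` is the projection onto the kernel of the generator, `G` the defect of the filter off it.
  set P := cfc (fun z : ℂ => (p z.re : ℂ)) T with hP
  set G := cfc (fun z : ℂ => (((1 - p z.re) * filterDefect α z.re : ℝ) : ℂ)) T with hG
  have hTP : T * P = P := by
    have : cfc (fun z : ℂ => (z.re : ℂ) * (p z.re : ℂ)) T = P := cfc_congr fun z hz => by
      rcases hgap z hz with h | ⟨_, h⟩
      · simp [h]
      · simp [hp0 _ h]
    rwa [cfc_mul _ _ T cre cp, cfc_re_eq hsa] at this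
  have hPT : P * T = P := by
    have : cfc (fun z : ℂ => (p z.re : ℂ) * (z.re : ℂ)) T = P := cfc_congr fun z hz => by
      rcases hgap z hz with h | ⟨_, h⟩
      · simp [h]
      · simp [hp0 _ h]
    rwa [cfc_mul _ _ T cp cre, cfc_re_eq hsa] at this
  have hPP : P * P = P := by
    have : cfc (fun z : ℂ => (p z.re : ℂ) * (p z.re : ℂ)) T = P := cfc_congr fun z hz => by
      rcases hgap z hz with h | ⟨_, h⟩
      · simp [h, hp1]
      · simp [hp0 _ h]
    rwa [cfc_mul _ _ T cp cp] at this
  have hPsa : IsSelfAdjoint P := by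
    rw [IsSelfAdjoint, hP, ← cfc_star]
    simp
  have hPψ : P ψ = 0 := by
    have h1 := hT.isGenerated (P ψ)
    have h2 : T (P ψ) = P ψ := congrArg (fun A : E →L[ℂ] E => A ψ) hTP
    rw [h2, sub_self] at h1
    have h3 := hker _ h1
    have h4 : inner ℂ (P ψ) (P ψ) = (0 : ℂ) := by
      have h5 := (ContinuousLinearMap.isSelfAdjoint_iff_isSymmetric.1 hPsa) (P ψ) ψ
      have h6 : P (P ψ) = P ψ := congrArg (fun A : E →L[ℂ] E => A ψ) hPP
      change inner ℂ (P (P ψ)) ψ = inner ℂ (P ψ) (P ψ) at h5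
      rw [← h5, h6, h3]
    exact inner_self_eq_zero.1 h4
  have hm : cfc (fun z : ℂ => ((z.re * filterDefect α z.re : ℝ) : ℂ)) T = G * T + P := by
    have : cfc (fun z : ℂ => ((z.re * filterDefect α z.re : ℝ) : ℂ)) T =
        cfc (fun z : ℂ => (((1 - p z.re) * filterDefect α z.re : ℝ) : ℂ) * (z.re : ℂ) +
          (p z.re : ℂ)) T := cfc_congr fun z hz => by
      rcases hgap z hz with h | ⟨_, h⟩
      · simp [h, hp1, filterDefect, gaussErf_zero]
      · simp [hp0 _ h, mul_comm]
    have c1 : ContinuousOn (fun z : ℂ => (((1 - p z.re) * filterDefect α z.re : ℝ) : ℂ) *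
        (z.re : ℂ)) (spectrum ℂ T) := cG.mul cre
    rw [this, cfc_add T _ _ c1 cp, cfc_mul _ _ T cG cre, cfc_re_eq hsa]
  have hGn : ‖G‖ ≤ Real.exp (-(1 / (4 * α)) * γ ^ 2) := by
    refine norm_cfc_le (Real.exp_pos _).le fun z hz => ?_
    rw [Complex.norm_real, Real.norm_eq_abs]
    rcases hgap z hz with h | ⟨h1, h2⟩
    · rw [h, hp1]; simp; positivity
    · rw [hp0 _ h2, sub_zero, one_mul, abs_of_nonneg (filterDefect_nonneg hα)]
      exact filterDefect_le hα hγ.le h1 h2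
  obtain ⟨hint, hval⟩ := hT.integral_filteredInner hU hsp hα φ χ
  rw [hTχ] at hint hval
  refine ⟨hint, ?_⟩
  have hpi : (Real.pi : ℂ) ≠ 0 := by exact_mod_cast Real.pi_ne_zero
  have hPχ : P χ = 0 := by
    rw [← hPψ, ← hTχ]
    exact (congrArg (fun A : E →L[ℂ] E => A χ) hPT).symm
  have hmχ : cfc (fun z : ℂ => ((z.re * filterDefect α z.re : ℝ) : ℂ)) T χ = G ψ := by
    rw [hm, _root_.add_apply, hPχ, add_zero, _root_.mul_apply_eq_comp, hTχ]
  rw [hval, inv_mul_cancel_left₀ hpi, sub_sub_cancel, hmχ]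
  calc ‖inner ℂ φ (G ψ)‖ ≤ ‖φ‖ * ‖G ψ‖ := norm_inner_le_norm _ _
    _ ≤ ‖φ‖ * (Real.exp (-(1 / (4 * α)) * γ ^ 2) * ‖ψ‖) := by
        gcongr
        exact (G.le_opNorm ψ).trans (mul_le_mul_of_nonneg_right hGn (norm_nonneg _))
    _ = _ := by ring

end SpectralFilter

/-! ### Clustering -/

section CouplingBound
variable {h : ℝ≥0 → ℝ≥0} {β C : ℝ}

/-- Comparison of the sum with `1 + ∫_1^∞ x^{-p} dx`. -/
theorem sum_range_rpow_neg_le {p : ℝ} (hp : 1 < p) (n : ℕ) :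
    ∑ j ∈ Finset.range n, (1 + (j : ℝ)) ^ (-p) ≤ p / (p - 1) := by
  have hp1 : 0 < p - 1 := by linarith
  have hone : p / (p - 1) = 1 + 1 / (p - 1) := by field_simp; ring
  rcases n with _ | n
  · simp; positivity
  rw [Finset.sum_range_succ', hone, add_comm]
  refine add_le_add (by simp) ?_
  have hanti : AntitoneOn (fun x : ℝ => x ^ (-p)) (Set.Icc (1 : ℝ) (1 + n)) := by
    intro x hx y hy hxy
    exact Real.rpow_le_rpow_of_nonpos (by linarith [hx.1]) hxy (by linarith)
  have h1 := hanti.sum_le_integral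
  have h2 : ∫ x in (1 : ℝ)..1 + n, x ^ (-p) = ((1 + n : ℝ) ^ (-p + 1) - 1) / (-p + 1) := by
    rw [integral_rpow]
    · simp
    · right
      refine ⟨by linarith, ?_⟩
      rw [Set.uIcc_of_le (by simp)]
      simp
  have h3 : ((1 + n : ℝ) ^ (-p + 1) - 1) / (-p + 1) ≤ 1 / (p - 1) := by
    rw [show -p + 1 = -(p - 1) by ring, div_neg, ← neg_div, neg_sub]
    refine div_le_div_of_nonneg_right ?_ hp1.le
    have : 0 ≤ (1 + n : ℝ) ^ (-(p - 1)) := by positivity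
    linarith
  exact (h1.trans (le_of_eq h2)).trans h3

/-- The sum of `(1 + j)^{-p}` over any finite set of distinct natural numbers `j` is at most
`p / (p - 1)`. -/
theorem sum_rpow_neg_le_of_injOn {p : ℝ} (hp : 1 < p) (X : Finset ℤ) (f : ℤ → ℕ)
    (hf : Set.InjOn f X) : ∑ x ∈ X, (1 + (f x : ℝ)) ^ (-p) ≤ p / (p - 1) := by
  rw [← Finset.sum_image (f := fun j : ℕ => (1 + (j : ℝ)) ^ (-p)) hf]
  refine (Finset.sum_le_sum_of_subset_of_nonneg
    (Finset.subset_range_sup_succ (X.image f)) fun j _ _ => by positivity).trans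
    (sum_range_rpow_neg_le hp _)

theorem setDist_le {X Y : Finset ℤ} {x y : ℤ} (hx : x ∈ X) (hy : y ∈ Y) :
    setDist X Y ≤ siteDist x y := by
  unfold setDist siteDist
  exact_mod_cast Nat.sInf_le (⟨x, hx, y, hy, rfl⟩ :
    (x - y).natAbs ∈ {n : ℕ | ∃ x ∈ X, ∃ y ∈ Y, n = (x - y).natAbs})

/-- Two sets of sites on different sides of a cut have a coupling that decays in their distance but
does not depend on their sizes: `|x - y|` is at least the sum of the distances to the cut. -/
theorem coupling_le (h_mono : Monotone h) (hβ : 2 < β) {X Y : Finset ℤ} (hX : X.Nonempty)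
    (hY : Y.Nonempty) (hXY : X.max' hX < Y.min' hY) :
    coupling h β X Y ≤ 8 * ((β / 2 - 1) ^ 2)⁻¹ * Real.exp (-(h (setDist X Y) : ℝ)) := by
  set p := β / 2 with hp
  have hp1 : 1 < p := by rw [hp]; linarith
  set x₀ := X.max' hX
  set y₀ := Y.min' hY
  set a : ℤ → ℝ := fun x => (1 + ((x₀ - x).natAbs : ℝ)) ^ (-p)
  set b : ℤ → ℝ := fun y => (1 + ((y - y₀).natAbs : ℝ)) ^ (-p)
  have ha : ∑ x ∈ X, a x ≤ p / (p - 1) :=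
    sum_rpow_neg_le_of_injOn hp1 X (fun x => (x₀ - x).natAbs) fun x hx y hy hxy => by
      have h1 := X.le_max' x hx
      have h2 := X.le_max' y hy
      simp only at hxy
      omega
  have hb : ∑ y ∈ Y, b y ≤ p / (p - 1) :=
    sum_rpow_neg_le_of_injOn hp1 Y (fun y => (y - y₀).natAbs) fun x hx y hy hxy => by
      have h1 := Y.min'_le x hx
      have h2 := Y.min'_le y hy
      simp only at hxy
      omega
  have ha0 : 0 ≤ ∑ x ∈ X, a x := Finset.sum_nonneg fun _ _ => by positivity
  have hb0 : 0 ≤ ∑ y ∈ Y, b y := Finset.sum_nonneg fun _ _ => by positivity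
  have hterm : ∀ x ∈ X, ∀ y ∈ Y, decayF h β (siteDist x y) ≤
      Real.exp (-(h (setDist X Y) : ℝ)) * ((4 : ℝ) ^ (-p) * (a x * b y)) := by
    intro x hx y hy
    have h1 : x ≤ x₀ := X.le_max' x hx
    have h2 : y₀ ≤ y := Y.min'_le y hy
    unfold decayF
    refine mul_le_mul (Real.exp_le_exp.2 (neg_le_neg ?_)) ?_ (by positivity) (Real.exp_pos _).le
    · exact_mod_cast h_mono (setDist_le hx hy)
    set j : ℝ := ((x₀ - x).natAbs : ℝ)
    set k : ℝ := ((y - y₀).natAbs : ℝ)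
    have hj : 0 ≤ j := Nat.cast_nonneg _
    have hk : 0 ≤ k := Nat.cast_nonneg _
    have h3 : 1 + j + k ≤ (siteDist x y : ℝ) := by
      have : 1 + (x₀ - x).natAbs + (y - y₀).natAbs ≤ (x - y).natAbs := by omega
      simp only [siteDist, j, k]
      exact_mod_cast this
    -- The inequality of arithmetic and geometric means separates the two distances to the cut.
    have h4 : 4 * ((1 + j) * (1 + k)) ≤ (1 + (siteDist x y : ℝ)) ^ 2 := by
      have h5 : ((1 + j) + (1 + k)) ^ 2 ≤ (1 + (siteDist x y : ℝ)) ^ 2 :=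
        pow_le_pow_left₀ (by positivity) (by linarith) 2
      nlinarith [sq_nonneg (j - k)]
    have e : 1 / (1 + (siteDist x y : ℝ)) ^ β = ((1 + (siteDist x y : ℝ)) ^ 2) ^ (-p) := by
      rw [← Real.rpow_natCast, ← Real.rpow_mul (by positivity), one_div, ← Real.rpow_neg
        (by positivity)]
      congr 1
      rw [hp]; push_cast; ring
    rw [e, ← Real.mul_rpow (by positivity) (by positivity), ← Real.mul_rpow (by norm_num)
      (by positivity)]
    exact Real.rpow_le_rpow_of_nonpos (by positivity) h4 (by linarith)
  have hp4 : p ^ 2 * (4 : ℝ) ^ (-p) ≤ 8 := by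
    have h5 := one_add_mul_self_le_rpow_one_add (s := 1) (by norm_num) hp1.le
    -- Bernoulli's inequality.
    have h6 : p ≤ (2 : ℝ) ^ p := by norm_num at h5; linarith
    have h7 : (4 : ℝ) ^ p = ((2 : ℝ) ^ p) ^ 2 := by
      rw [← Real.rpow_natCast, ← Real.rpow_mul (by norm_num), mul_comm, Real.rpow_mul (by norm_num)]
      norm_num
    rw [Real.rpow_neg (by norm_num), ← div_eq_mul_inv, div_le_iff₀ (by positivity), h7]
    have h8 : p ^ 2 ≤ ((2 : ℝ) ^ p) ^ 2 := pow_le_pow_left₀ (by linarith) h6 2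
    nlinarith [sq_nonneg ((2 : ℝ) ^ p)]
  have hp0 : 0 < p - 1 := by linarith
  calc coupling h β X Y
      ≤ ∑ x ∈ X, ∑ y ∈ Y, Real.exp (-(h (setDist X Y) : ℝ)) * ((4 : ℝ) ^ (-p) * (a x * b y)) :=
        Finset.sum_le_sum fun x hx => Finset.sum_le_sum fun y hy => hterm x hx y hy
    _ = (4 : ℝ) ^ (-p) * ((∑ x ∈ X, a x) * ∑ y ∈ Y, b y) * Real.exp (-(h (setDist X Y) : ℝ)) := by
        rw [Finset.sum_mul_sum]
        simp only [Finset.mul_sum, Finset.sum_mul]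
        exact Finset.sum_congr rfl fun x _ => Finset.sum_congr rfl fun y _ => by ring
    _ ≤ (4 : ℝ) ^ (-p) * (p / (p - 1) * (p / (p - 1))) * Real.exp (-(h (setDist X Y) : ℝ)) := by
        gcongr
    _ = p ^ 2 * (4 : ℝ) ^ (-p) * ((p - 1) ^ 2)⁻¹ * Real.exp (-(h (setDist X Y) : ℝ)) := by
        field_simp
    _ ≤ _ := by gcongr

end CouplingBound

section Clustering
open MeasureTheory Set
variable {d : ℕ} {h : ℝ≥0 → ℝ≥0} {β C : ℝ} {N : ℝ≥0} {Φ : Interaction d}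
  {ω : QuasiLocal d →ₚ[ℂ] ℂ}

/-- The observable `A - ω(A)`. -/
def centered (ω : QuasiLocal d →ₚ[ℂ] ℂ) (A : QuasiLocal d) : QuasiLocal d := A - ω A • 1

theorem apply_centered (h1 : ω 1 = 1) (A : QuasiLocal d) : ω (centered ω A) = 0 := by
  rw [centered, map_sub, map_smul, h1, smul_eq_mul, mul_one, sub_self]

theorem star_centered (A : QuasiLocal d) : star (centered ω A) = centered ω (star A) := by
  rw [centered, centered, star_sub, star_smul, star_one, map_star]

theorem centered_mem {X : Finset ℤ} {A : QuasiLocal d} (hA : A ∈ localAlgebra d X) :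
    centered ω A ∈ localAlgebra d X :=
  sub_mem hA (SMulMemClass.smul_mem _ (one_mem _))

theorem apply_centered_mul_centered (h1 : ω 1 = 1) (A B : QuasiLocal d) :
    ω (centered ω A * centered ω B) = ω (A * B) - ω A * ω B := by
  have : centered ω A * centered ω B = A * B - ω B • A - ω A • B + (ω A * ω B) • 1 := by
    simp only [centered, sub_mul, mul_sub, smul_mul_assoc, mul_smul_comm, one_mul, mul_one,
      smul_sub, smul_smul, mul_comm (ω B)]
    abel
  rw [this, map_add, map_sub, map_sub, map_smul, map_smul, map_smul, h1]
  simp only [smul_eq_mul]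
  ring

/-- `A Ω - ω(A) Ω` is the orthogonal projection of `A Ω` to the complement of `Ω`. -/
theorem norm_gnsVec_centered_le (h1 : ω 1 = 1) (A : QuasiLocal d) :
    ‖gnsVec ω (centered ω A)‖ ≤ ‖A‖ := by
  set ψ := gnsVec ω (centered ω A) with hψ
  have h2 : inner ℂ ψ (gnsVec ω 1) = 0 := by
    rw [hψ, inner_gnsVec, mul_one, star_centered, apply_centered h1]
  have h3 : inner ℂ ψ ψ = inner ℂ ψ (gnsVec ω A) := by
    nth_rewrite 2 [hψ]
    rw [centered, gnsVec_sub, gnsVec_smul, inner_sub_right, inner_smul_right, h2, mul_zero,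
      sub_zero]
  have h4 : ‖ψ‖ * ‖ψ‖ ≤ ‖ψ‖ * ‖A‖ := by
    have h5 : ‖inner ℂ ψ ψ‖ = ‖ψ‖ * ‖ψ‖ := by
      rw [inner_self_eq_norm_sq_to_K, norm_pow, RCLike.norm_ofReal, abs_norm, sq]
    rw [← h5, h3]
    exact (norm_inner_le_norm _ _).trans
      (mul_le_mul_of_nonneg_left (norm_gnsVec_le h1 A) (norm_nonneg _))
  rcases (norm_nonneg ψ).eq_or_lt with h6 | h6
  · rw [← h6]; exact norm_nonneg _
  · exact le_of_mul_le_mul_left h4 h6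

theorem isUnitaryGroup_gnsUnitary (hτ : HasDynamics Φ) (hinv : ∀ t A, ω (Φ.dynamics t A) = ω A) :
    IsUnitaryGroup (gnsUnitary Φ ω) :=
  ⟨gnsUnitary_zero hτ hinv, gnsUnitary_add hτ hinv, norm_gnsUnitary hτ hinv⟩

/-- The commutator of the evolved observables is the difference of two GNS matrix elements. -/
theorem inner_sub_inner_eq_apply_lie (hτ : HasDynamics Φ)
    (hinv : ∀ t A, ω (Φ.dynamics t A) = ω A) (A B : QuasiLocal d) (t : ℝ) :
    inner ℂ (gnsVec ω (star (centered ω A))) (gnsUnitary Φ ω t (gnsVec ω (centered ω B))) -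
      inner ℂ (gnsVec ω (star (centered ω B))) (gnsUnitary Φ ω (-t) (gnsVec ω (centered ω A))) =
      ω ⁅A, Φ.dynamics t B⁆ := by
  rw [gnsUnitary_gnsVec hτ hinv, gnsUnitary_gnsVec hτ hinv, inner_gnsVec, inner_gnsVec, star_star,
    star_star, ← hinv t (centered ω B * _), hτ.dynamics_mul, ← hτ.dynamics_add_time,
    add_neg_cancel, hτ.dynamics_zero, ← map_sub]
  have : Φ.dynamics t (centered ω B) = Φ.dynamics t B - ω B • 1 := by
    rw [centered, hτ.dynamics_sub, hτ.dynamics_smul, hτ.dynamics_one]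
  rw [this, Ring.lie_def, centered]
  congr 1
  simp only [sub_mul, mul_sub, smul_mul_assoc, mul_smul_comm, one_mul, mul_one, smul_sub, smul_smul,
    mul_comm (ω B)]
  abel

/-- Convexity of the growth function: its difference quotient from `0` is at most its derivative.
This cancels the singularity of the kernel `e^{-αt²}/t` at `t = 0`. -/
theorem growth_div_le (N : ℝ≥0) (hC : 0 < C) {t : ℝ} (ht : 0 < t) :
    growth N C t / t ≤ 2 * (N + N * (C * growth N C t)) := by
  have e : 2 * (N + N * (C * growth N C t)) = velocity N C * Real.exp (velocity N C * t) / C := by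
    unfold growth velocity
    field_simp
    ring
  rw [e, growth, div_div, mul_comm C t, ← div_div]
  refine div_le_div_of_nonneg_right ?_ hC.le
  rw [div_le_iff₀ ht]
  have h1 := Real.add_one_le_exp (-(velocity N C * t))
  have h2 : Real.exp (velocity N C * t) * Real.exp (-(velocity N C * t)) = 1 := by
    rw [← Real.exp_add]; simp
  have h3 := mul_le_mul_of_nonneg_left h1 (Real.exp_pos (velocity N C * t)).le
  rw [h2] at h3
  linarith

/-- A kernel `e^{-αt²}/t` integrated against a function that is bounded by `1` and by the
Lieb–Robinson growth. -/
theorem norm_integral_le_growth_add (N : ℝ≥0) (hC : 0 < C) {S K α s : ℝ} (hS : 0 ≤ S)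
    (hK : 0 ≤ K) (hα : 0 < α) (hs : 0 < s) {f : ℝ → ℂ} (hf : IntegrableOn f (Ioi 0))
    (h1 : ∀ t, 0 < t → ‖f t‖ ≤ Real.exp (-α * t ^ 2) / t * (K * (growth N C t * S)))
    (h2 : ∀ t, 0 < t → ‖f t‖ ≤ Real.exp (-α * t ^ 2) / t * K) :
    ‖∫ t in Ioi (0 : ℝ), f t‖ ≤
      K * (S * growth N C s + Real.exp (-α * s ^ 2) * (√(Real.pi / α) / 2) / s) := by
  have hder : Continuous fun t => 2 * (N + N * (C * growth N C t)) := by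
    unfold growth; fun_prop
  have e : ∫ t in Ioi (0 : ℝ), f t = (∫ t in Ioc 0 s, f t) + ∫ t in Ioi s, f t := by
    rw [← setIntegral_union (Ioc_disjoint_Ioi le_rfl) measurableSet_Ioi
      (hf.mono_set Ioc_subset_Ioi_self) (hf.mono_set (Ioi_subset_Ioi hs.le)),
      Ioc_union_Ioi_eq_Ioi hs.le]
  have b1 : ‖∫ t in Ioc 0 s, f t‖ ≤ K * (S * growth N C s) := by
    have h3 : ∫ t in Ioc 0 s, K * S * (2 * (N + N * (C * growth N C t))) =
        K * (S * growth N C s) := by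
      rw [integral_const_mul, ← intervalIntegral.integral_of_le hs.le,
        intervalIntegral.integral_eq_sub_of_hasDerivAt
          (fun t _ => hasDerivAt_growth N hC t) (hder.intervalIntegrable _ _), growth_zero]
      ring
    rw [← h3]
    refine norm_integral_le_of_norm_le ?_ ?_
    · exact ((continuous_const.mul hder).integrableOn_Icc).mono_set Ioc_subset_Icc_self
    · refine (ae_restrict_iff' measurableSet_Ioc).2 (Eventually.of_forall fun t ht => ?_)
      have hg := growth_nonneg N hC ht.1.le
      have hexp : Real.exp (-α * t ^ 2) ≤ 1 := Real.exp_le_one_iff.2 (by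
        have := mul_nonneg hα.le (sq_nonneg t); linarith)
      calc ‖f t‖ ≤ Real.exp (-α * t ^ 2) / t * (K * (growth N C t * S)) := h1 t ht.1
        _ = Real.exp (-α * t ^ 2) * (K * S * (growth N C t / t)) := by ring
        _ ≤ 1 * (K * S * (growth N C t / t)) := by
            refine mul_le_mul_of_nonneg_right hexp ?_
            have := ht.1
            positivity
        _ = K * S * (growth N C t / t) := one_mul _
        _ ≤ _ := mul_le_mul_of_nonneg_left (growth_div_le N hC ht.1) (by positivity)
  have b2 : ‖∫ t in Ioi s, f t‖ ≤ K * (Real.exp (-α * s ^ 2) * (√(Real.pi / α) / 2) / s) := by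
    have h3 : ‖∫ t in Ioi s, f t‖ ≤ ∫ t in Ioi s, K / s * Real.exp (-α * t ^ 2) := by
      refine norm_integral_le_of_norm_le ((integrableOn_gaussian hα _).const_mul _) ?_
      refine (ae_restrict_iff' measurableSet_Ioi).2 (Eventually.of_forall fun t ht => ?_)
      have ht0 : 0 < t := hs.trans ht
      refine (h2 t ht0).trans ?_
      calc Real.exp (-α * t ^ 2) / t * K = K * Real.exp (-α * t ^ 2) / t := by ring
        _ ≤ K * Real.exp (-α * t ^ 2) / s :=
            div_le_div_of_nonneg_left (by positivity) hs (le_of_lt ht)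
        _ = _ := by ring
    rw [integral_const_mul] at h3
    calc ‖∫ t in Ioi s, f t‖ ≤ K / s * ∫ t in Ioi s, Real.exp (-α * t ^ 2) := h3
      _ ≤ K / s * (Real.exp (-α * s ^ 2) * (√(Real.pi / α) / 2)) :=
          mul_le_mul_of_nonneg_left (integral_Ioi_gaussian_le hα hs.le) (by positivity)
      _ = _ := by ring
  rw [e, mul_add]
  exact (norm_add_le _ _).trans (add_le_add b1 b2)

/-- The correlation bound with free parameters: a width `α` of the Gaussian filter and a time `s`
up to which the Lieb–Robinson bound is used. -/
theorem IsGroundState.norm_correlation_le (hω : IsGroundState Φ ω) (hβ : 1 < β)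
    (hC : IsConvolutionConstant h β C) (hN : Φ.decayNorm h β ≤ N) {γ : ℝ} (hγ : 0 < γ)
    (hspec : operatorSpectrum (gnsHamiltonian Φ ω) \ {0} ⊆ (fun r : ℝ => (r : ℂ)) '' Set.Ici γ)
    (hker : operatorKernel (gnsHamiltonian Φ ω) ⊆ (Submodule.span ℂ {gnsVec ω 1} : Set ω.GNS))
    {X Y : Finset ℤ} (hXY : Disjoint X Y) {A B : QuasiLocal d} (hA : A ∈ localAlgebra d X)
    (hB : B ∈ localAlgebra d Y) {α s : ℝ} (hα : 0 < α) (hs : 0 < s) :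
    ‖ω (A * B) - ω A * ω B‖ ≤ ‖A‖ * ‖B‖ * (Real.exp (-(1 / (4 * α)) * γ ^ 2) +
      2 / Real.pi * (coupling h β X Y * growth N C s +
        Real.exp (-α * s ^ 2) * (√(Real.pi / α) / 2) / s)) := by
  have hτ := hasDynamics hβ hC hN
  have hinv := hω.apply_dynamics hβ hC hN
  have hU := isUnitaryGroup_gnsUnitary hτ hinv
  have hortho : ∀ D : QuasiLocal d, ∀ v, IsGenerated (gnsUnitary Φ ω) v 0 →
      inner ℂ v (gnsVec ω (centered ω D)) = 0 := by
    intro D v hv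
    obtain ⟨c, rfl⟩ := Submodule.mem_span_singleton.1 (hker hv.generator_eq)
    rw [inner_smul_left, inner_gnsVec, star_one, one_mul, apply_centered hω.1, mul_zero]
  set φ := gnsVec ω (star (centered ω A)) with hφ
  set ψ := gnsVec ω (centered ω B) with hψ
  set ψ' := gnsVec ω (star (centered ω B)) with hψ'
  set φ' := gnsVec ω (centered ω A) with hφ'
  obtain ⟨i1, n1⟩ := hU.norm_inner_sub_integral_filteredInner_le hγ hspec hα φ
    (isGenerated_gnsVec hτ hinv hω.1 hN (centered_mem hB)) (hortho B)
  obtain ⟨i2, n2⟩ := hU.norm_inner_sub_integral_filteredInner_le hγ hspec hα ψ'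
    (isGenerated_gnsVec hτ hinv hω.1 hN (centered_mem hA)) (hortho A)
  rw [← hψ] at i1 n1
  rw [← hφ'] at i2 n2
  set ε := Real.exp (-(1 / (4 * α)) * γ ^ 2)
  have hnφ : ‖φ‖ ≤ ‖A‖ := by
    rw [hφ, star_centered, ← norm_star A]; exact norm_gnsVec_centered_le hω.1 _
  have hnψ' : ‖ψ'‖ ≤ ‖B‖ := by
    rw [hψ', star_centered, ← norm_star B]; exact norm_gnsVec_centered_le hω.1 _
  have hnψ : ‖ψ‖ ≤ ‖B‖ := norm_gnsVec_centered_le hω.1 _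
  have hnφ' : ‖φ'‖ ≤ ‖A‖ := norm_gnsVec_centered_le hω.1 _
  have c1 : inner ℂ φ ψ = ω (A * B) - ω A * ω B := by
    rw [hφ, hψ, inner_gnsVec, star_star, apply_centered_mul_centered hω.1]
  have c2 : inner ℂ ψ' φ' = ω (A * B) - ω A * ω B := by
    rw [hψ', hφ', inner_gnsVec, star_star, apply_centered_mul_centered hω.1,
      (commute_of_disjoint hXY hA hB).eq, mul_comm (ω B)]
  -- The two filtered matrix elements combine to the commutator, which locality controls.
  have hsum : ∀ t, filteredInner (gnsUnitary Φ ω) α φ ψ t +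
      filteredInner (gnsUnitary Φ ω) α ψ' φ' t =
      ((Real.exp (-α * t ^ 2) / t : ℝ) : ℂ) *
        (-Complex.I * (ω ⁅A, Φ.dynamics t B⁆ - ω ⁅A, Φ.dynamics (-t) B⁆)) := by
    intro t
    rw [← inner_sub_inner_eq_apply_lie hτ hinv, ← inner_sub_inner_eq_apply_lie hτ hinv, neg_neg,
      filteredInner, filteredInner, inner_sub_right, inner_sub_right]
    ring
  have hf : ∀ t, 0 < t → ∀ b, (∀ t', |t'| = t → ‖ω ⁅A, Φ.dynamics t' B⁆‖ ≤ b) →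
      ‖filteredInner (gnsUnitary Φ ω) α φ ψ t + filteredInner (gnsUnitary Φ ω) α ψ' φ' t‖ ≤
        Real.exp (-α * t ^ 2) / t * (2 * b) := by
    intro t ht b hb
    rw [hsum, norm_mul, norm_mul, norm_neg, Complex.norm_I, one_mul, Complex.norm_real,
      Real.norm_of_nonneg (by positivity)]
    refine mul_le_mul_of_nonneg_left ?_ (by positivity)
    have h1 := hb t (abs_of_pos ht)
    have h2 := hb (-t) (by rw [abs_neg, abs_of_pos ht])
    exact (norm_sub_le _ _).trans (by linarith)
  have hint := norm_integral_le_growth_add N hC.pos (S := coupling h β X Y)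
    (K := 4 * ‖A‖ * ‖B‖) (coupling_nonneg _ _ _ _) (by positivity) hα hs (i1.add i2)
    (fun t ht => by
      refine (hf t ht (2 * ‖A‖ * ‖B‖ * (growth N C t * coupling h β X Y)) fun t' ht' => ?_).trans
        (le_of_eq (by ring))
      rw [← ht']
      exact (norm_state_le hω.1 _).trans (norm_lie_dynamics_le hτ hC hN hXY hA hB t'))
    (fun t ht => by
      refine (hf t ht (2 * ‖A‖ * ‖B‖) fun t' _ => ?_).trans (le_of_eq (by ring))
      refine (norm_state_le hω.1 _).trans ((norm_lie_le _ _).trans ?_)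
      rw [hτ.norm_dynamics])
  rw [c1] at n1
  rw [c2] at n2
  simp only [Pi.add_apply] at hint
  rw [integral_add i1 i2] at hint
  set I1 := ∫ t in Ioi (0 : ℝ), filteredInner (gnsUnitary Φ ω) α φ ψ t
  set I2 := ∫ t in Ioi (0 : ℝ), filteredInner (gnsUnitary Φ ω) α ψ' φ' t
  set D := ω (A * B) - ω A * ω B
  set J := coupling h β X Y * growth N C s + Real.exp (-α * s ^ 2) * (√(Real.pi / α) / 2) / s
  have hε : 0 ≤ ε := (Real.exp_pos _).le
  have m1 : ε * (‖φ‖ * ‖ψ‖) ≤ ε * (‖A‖ * ‖B‖) := by gcongr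
  have m2 : ε * (‖ψ'‖ * ‖φ'‖) ≤ ε * (‖A‖ * ‖B‖) := by rw [mul_comm ‖ψ'‖]; gcongr
  have e : (2 : ℂ) * D = (D - (Real.pi : ℂ)⁻¹ * I1) + (D - (Real.pi : ℂ)⁻¹ * I2) +
      (Real.pi : ℂ)⁻¹ * (I1 + I2) := by ring
  have n3 : 2 * ‖D‖ ≤ ε * (‖A‖ * ‖B‖) + ε * (‖A‖ * ‖B‖) + Real.pi⁻¹ * (4 * ‖A‖ * ‖B‖ * J) := by
    have h1 : ‖(2 : ℂ) * D‖ = 2 * ‖D‖ := by rw [norm_mul]; norm_num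
    rw [← h1, e]
    refine (norm_add_le _ _).trans (add_le_add ((norm_add_le _ _).trans
      (add_le_add (n1.trans m1) (n2.trans m2))) ?_)
    rw [norm_mul, norm_inv, Complex.norm_real, Real.norm_of_nonneg Real.pi_pos.le]
    exact mul_le_mul_of_nonneg_left hint (by positivity)
  calc ‖D‖ = (2 * ‖D‖) / 2 := by ring
    _ ≤ (ε * (‖A‖ * ‖B‖) + ε * (‖A‖ * ‖B‖) + Real.pi⁻¹ * (4 * ‖A‖ * ‖B‖ * J)) / 2 := by gcongr
    _ = _ := by ring

/-- The choice `s = 2h/(2ν + γ)`, `α = γ/(2s)` balances all the error terms. -/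
theorem IsGroundState.norm_correlation_le_explicit (hω : IsGroundState Φ ω)
    (h_mono : Monotone h) (hβ : 2 < β)
    (hC : IsConvolutionConstant h β C) (hN : Φ.decayNorm h β ≤ N) {γ : ℝ} (hγ : 0 < γ)
    (hspec : operatorSpectrum (gnsHamiltonian Φ ω) \ {0} ⊆ (fun r : ℝ => (r : ℂ)) '' Set.Ici γ)
    (hker : operatorKernel (gnsHamiltonian Φ ω) ⊆ (Submodule.span ℂ {gnsVec ω 1} : Set ω.GNS))
    {X Y : Finset ℤ} (hX : X.Nonempty) (hY : Y.Nonempty) (hXY : X.max' hX < Y.min' hY)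
    {A B : QuasiLocal d} (hA : A ∈ localAlgebra d X) (hB : B ∈ localAlgebra d Y)
    (hd : 0 < h (setDist X Y)) :
    ‖ω (A * B) - ω A * ω B‖ ≤
      (1 + kappa β C / Real.pi +
        √((2 * velocity N C + γ) / (Real.pi * γ * h (setDist X Y)))) * ‖A‖ * ‖B‖ *
        Real.exp (-(γ / (2 * velocity N C + γ) * h (setDist X Y))) := by
  have hC0 := hC.pos
  have hdisj : Disjoint X Y := Finset.disjoint_left.2 fun x hx hy => by
    have h1 := X.le_max' x hx
    have h2 := Y.min'_le x hy
    omega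
  have hS := coupling_le h_mono hβ hX hY hXY
  set η : ℝ := (h (setDist X Y) : ℝ) with hη
  have hη0 : 0 < η := by exact_mod_cast hd
  set ν := velocity N C with hν
  have hν0 : 0 ≤ ν := velocity_nonneg N hC0.le
  have hden : 0 < 2 * ν + γ := by linarith
  set s := 2 * η / (2 * ν + γ) with hs
  have hs0 : 0 < s := by positivity
  set α := γ / (2 * s) with hα
  have hα0 : 0 < α := by positivity
  have key := hω.norm_correlation_le (by linarith) hC hN hγ hspec hker hdisj hA hB hα0 hs0
  set u := γ / (2 * ν + γ) with hu
  have e1 : -(1 / (4 * α)) * γ ^ 2 = -(u * η) := by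
    rw [hα, hu, hs]; field_simp; norm_num
  have e2 : -α * s ^ 2 = -(u * η) := by
    rw [hα, hu, hs]; field_simp
  have e3 : ν * s - η = -(u * η) := by
    rw [hu, hs]; field_simp; ring
  have b1 : 2 * (coupling h β X Y * growth N C s) ≤ kappa β C * Real.exp (-(u * η)) := by
    have h1 : growth N C s ≤ Real.exp (ν * s) / C := by
      unfold growth
      gcongr
      linarith
    calc 2 * (coupling h β X Y * growth N C s)
        ≤ 2 * (8 * ((β / 2 - 1) ^ 2)⁻¹ * Real.exp (-η) * (Real.exp (ν * s) / C)) := by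
          gcongr
          exact growth_nonneg N hC0 hs0.le
      _ = kappa β C * (Real.exp (ν * s) * Real.exp (-η)) := by unfold kappa; ring
      _ = _ := by rw [← Real.exp_add, ← sub_eq_add_neg, e3]
  have b2 : 2 / Real.pi * (√(Real.pi / α) / 2 / s) = √((2 * ν + γ) / (Real.pi * γ * η)) := by
    have h1 : (2 * ν + γ) / (Real.pi * γ * η) = Real.pi / α / (Real.pi * s) ^ 2 := by
      rw [hα, hs]; field_simp
    rw [h1, Real.sqrt_div (show 0 ≤ Real.pi / α by positivity) ((Real.pi * s) ^ 2),
      Real.sqrt_sq (by positivity)]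
    field_simp
  rw [e1, e2] at key
  refine key.trans ?_
  have h5 : 2 / Real.pi * (coupling h β X Y * growth N C s +
      Real.exp (-(u * η)) * (√(Real.pi / α) / 2) / s) =
      2 * (coupling h β X Y * growth N C s) / Real.pi +
        Real.exp (-(u * η)) * (2 / Real.pi * (√(Real.pi / α) / 2 / s)) := by ring
  rw [h5, b2]
  calc _ ≤ ‖A‖ * ‖B‖ * (Real.exp (-(u * η)) + (kappa β C * Real.exp (-(u * η)) / Real.pi +
        Real.exp (-(u * η)) * √((2 * ν + γ) / (Real.pi * γ * η)))) := by
        gcongr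
    _ = _ := by ring

end Clustering

end

end SpinChain

theorem mainTheorem6 (h : ℝ≥0 → ℝ≥0) (h_mono : Monotone h)
    (h_subadd : ∀ x y : ℝ≥0, h (x + y) ≤ h x + h y)
    (β : ℝ) (hβ : 2 < β) (C : ℝ) (hC : SpinChain.IsConvolutionConstant h β C)
    (N : ℝ≥0) (γ : ℝ) (hγ : 0 < γ) :
    ∃ μ : ℝ, 0 < μ ∧
      ∀ (d : ℕ), 2 ≤ d →
      ∀ (Φ : SpinChain.Interaction d), Φ.decayNorm h β = (N : ℝ≥0∞) →
      ∀ (ω : SpinChain.QuasiLocal d →ₚ[ℂ] ℂ), SpinChain.IsGroundState Φ ω →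
      SpinChain.operatorSpectrum (SpinChain.gnsHamiltonian Φ ω) \ {0} ⊆
        (fun r : ℝ => (r : ℂ)) '' Set.Ici γ →
      SpinChain.operatorKernel (SpinChain.gnsHamiltonian Φ ω) =
        (Submodule.span ℂ {SpinChain.gnsVec ω 1} : Set ω.GNS) →
      ∀ (X Y : Finset ℤ) (hX : X.Nonempty) (hY : Y.Nonempty), X.max' hX < Y.min' hY →
      ∀ A ∈ SpinChain.localAlgebra d X, ∀ B ∈ SpinChain.localAlgebra d Y,
        ‖ω (A * B) - ω A * ω B‖ ≤
          μ * ‖A‖ * ‖B‖ *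
            Real.exp (-(γ / (2 * SpinChain.velocity N C + γ) * h (SpinChain.setDist X Y))) ∧
        (0 < h (SpinChain.setDist X Y) →
          ‖ω (A * B) - ω A * ω B‖ ≤
            (1 + SpinChain.kappa β C / Real.pi +
                √((2 * SpinChain.velocity N C + γ) /
                  (Real.pi * γ * h (SpinChain.setDist X Y)))) * ‖A‖ * ‖B‖ *
              Real.exp (-(γ / (2 * SpinChain.velocity N C + γ) * h (SpinChain.setDist X Y)))) := by
  have hC0 := hC.pos
  have hν0 := SpinChain.velocity_nonneg N hC0.le
  set ν := SpinChain.velocity N C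
  have hκ : 0 ≤ SpinChain.kappa β C := by
    unfold SpinChain.kappa; positivity
  set u := γ / (2 * ν + γ) with hu
  have hu0 : 0 ≤ u := by positivity
  set m := 1 + SpinChain.kappa β C / Real.pi + √((2 * ν + γ) / (Real.pi * γ)) with hm
  have hm0 : 0 < m := by positivity
  -- `m` is the explicit constant at `h = 1` and bounds it for `h ≥ 1`; `2 e^u` covers `h < 1`.
  refine ⟨2 * Real.exp u + m, by positivity, ?_⟩
  intro d _ Φ hΦ ω hω hspec hker X Y hX hY hXY A hA B hB
  have hexpl := fun hd => hω.norm_correlation_le_explicit h_mono hβ hC hΦ.le hγ hspec hker.le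
    hX hY hXY hA hB hd
  refine ⟨?_, hexpl⟩
  set η : ℝ := (h (SpinChain.setDist X Y) : ℝ) with hη
  have hη0 : 0 ≤ η := NNReal.coe_nonneg _
  rcases lt_or_ge η 1 with hlt | hge
  · -- At short distances the trivial bound `2 ‖A‖ ‖B‖` suffices.
    have h1 : ‖ω (A * B) - ω A * ω B‖ ≤ 2 * ‖A‖ * ‖B‖ := by
      have h2 := (SpinChain.norm_state_le hω.1 (A * B)).trans (norm_mul_le A B)
      have h3 : ‖ω A * ω B‖ ≤ ‖A‖ * ‖B‖ := by
        rw [norm_mul]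
        exact mul_le_mul (SpinChain.norm_state_le hω.1 A) (SpinChain.norm_state_le hω.1 B)
          (norm_nonneg _) (norm_nonneg _)
      have h4 := norm_sub_le (ω (A * B)) (ω A * ω B)
      linarith
    have h5 : 1 ≤ Real.exp u * Real.exp (-(u * η)) := by
      rw [← Real.exp_add]
      exact Real.one_le_exp (by nlinarith)
    have h6 : 2 * ‖A‖ * ‖B‖ * 1 ≤ 2 * ‖A‖ * ‖B‖ * (Real.exp u * Real.exp (-(u * η))) :=
      mul_le_mul_of_nonneg_left h5 (by positivity)
    have h7 : 0 ≤ m * ‖A‖ * ‖B‖ * Real.exp (-(u * η)) := by positivity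
    calc _ ≤ 2 * ‖A‖ * ‖B‖ * (Real.exp u * Real.exp (-(u * η))) := by linarith
      _ ≤ 2 * ‖A‖ * ‖B‖ * (Real.exp u * Real.exp (-(u * η))) +
          m * ‖A‖ * ‖B‖ * Real.exp (-(u * η)) := le_add_of_nonneg_right h7
      _ = _ := by ring
  · have hd : 0 < h (SpinChain.setDist X Y) := by
      have : 0 < η := by linarith
      exact_mod_cast this
    refine (hexpl hd).trans ?_
    have h1 : √((2 * ν + γ) / (Real.pi * γ * η)) ≤ √((2 * ν + γ) / (Real.pi * γ)) := by
      refine Real.sqrt_le_sqrt (div_le_div_of_nonneg_left (by positivity) (by positivity) ?_)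
      exact le_mul_of_one_le_right (by positivity) hge
    have h2 : 0 ≤ 2 * Real.exp u := by positivity
    have h3 : 1 + SpinChain.kappa β C / Real.pi + √((2 * ν + γ) / (Real.pi * γ * η)) ≤
        2 * Real.exp u + m := by linarith
    exact mul_le_mul_of_nonneg_right (mul_le_mul_of_nonneg_right
      (mul_le_mul_of_nonneg_right h3 (norm_nonneg _)) (norm_nonneg _)) (Real.exp_pos _).le
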